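/- Let $F$ be a number field with a fixed real embedding $F\hookrightarrow\mathbb R$ and ring of integers $\mathcal O_F$, and let $\mathfrak d_1\subseteq\mathcal O_F$ be a nonzero ideal. Let $\mathcal G\subseteq \mathrm{GL}_N$ be a closed subgroup scheme over the localization of $\mathcal O_F$ away from $\mathfrak d_1$, such that the real algebraic group $\mathcal G_{\mathbb R}$ is isomorphic to $\mathrm{SO}(n,1)$ for some $n\ge 2$ or to $\mathrm{SU}(n,1)$ for some $n\ge 1$. Let $\mathfrak g=\mathrm{Lie}(\mathcal G)$, so that $\mathfrak g(B)$ consists of the $N\times N$ matrices $X$ over $B$ with $1+\varepsilon X\in\mathcal G(B[\varepsilon])$, $\varepsilon^2=0$. Then there is a nonzero ideal $\mathfrak d\subseteq \mathfrak d_1$ of $\mathcal O_F$, depending only on $\mathcal G$, such that the following holds for every nonzero prime ideal $\mathfrak p$ of $\mathcal O_F$ not dividing $\mathfrak d$ and every integer $r>1$. Put $k=\lfloor r/2\rfloor$ and $k_{\mathfrak p}=\mathcal O_F/\mathfrak p$. Let $\rho$ be a finite-dimensional complex representation (not necessarily irreducible) of the finite group $\mathcal G(\mathcal O_F/\mathfrak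 p^r)$ of level $\mathfrak p^r$, that is, for every $0\le s<r$ the kernel of the reduction $\mathcal G(\mathcal O_F/\mathfrak p^r)\to\mathcal G(\mathcal O_F/\mathfrak p^s)$ acts non-trivially. Then there is a nonzero $X\in\mathfrak g(k_{\mathfrak p})$ such that $$\dim\rho\;\ge\;\frac{|\mathcal G(k_{\mathfrak p})|\,|\mathfrak g(k_{\mathfrak p})|^{k-1}}{|C_{\mathcal G(k_{\mathfrak p})}(X)|\,|C_{\mathfrak g(k_{\mathfrak p})}(X)|^{k-1}},$$ where $C_{\mathcal G(k_{\mathfrak p})}(X)=\{g\in\mathcal G(k_{\mathfrak p}) : gX=Xg\}$ and $C_{\mathfrak g(k_{\mathfrak p})}(X)=\{Y\in\mathfrak g(k_{\mathfrak p}) : YX=XY\}$. -/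

import Mathlib

open Matrix

universe u v

/-! ### Closed subgroup schemes of `GL_N` -/

/-- A closed subgroup scheme of `GL_N` over a commutative ring `R`: the closed subscheme of `GL_N`
cut out by a set of polynomials in the matrix entries, such that over every `R`-algebra
`φ : R → B` the invertible matrices satisfying these equations form a subgroup of `GL_N(B)`.
(Equations involving `1 / det` become polynomial ones after multiplication by a power of `det`.) -/
structure ClosedSubgroupScheme (R : Type u) [CommRing R] (N : ℕ) where
  /-- the defining equations -/
  eqs : Set (MvPolynomial (Fin N × Fin N) R)
  one_mem : ∀ {B : Type u} [CommRing B] (φ : R →+* B), ∀ p ∈ eqs,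
    p.eval₂ φ (fun ij => (1 : Matrix (Fin N) (Fin N) B) ij.1 ij.2) = 0
  mul_mem : ∀ {B : Type u} [CommRing B] (φ : R →+* B) (g h : GL (Fin N) B),
    (∀ p ∈ eqs, p.eval₂ φ (fun ij => (g : Matrix (Fin N) (Fin N) B) ij.1 ij.2) = 0) →
    (∀ p ∈ eqs, p.eval₂ φ (fun ij => (h : Matrix (Fin N) (Fin N) B) ij.1 ij.2) = 0) →
    ∀ p ∈ eqs, p.eval₂ φ (fun ij => ((g * h : GL (Fin N) B) : Matrix _ _ B) ij.1 ij.2) = 0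
  inv_mem : ∀ {B : Type u} [CommRing B] (φ : R →+* B) (g : GL (Fin N) B),
    (∀ p ∈ eqs, p.eval₂ φ (fun ij => (g : Matrix (Fin N) (Fin N) B) ij.1 ij.2) = 0) →
    ∀ p ∈ eqs, p.eval₂ φ (fun ij => ((g⁻¹ : GL (Fin N) B) : Matrix _ _ B) ij.1 ij.2) = 0

namespace ClosedSubgroupScheme

variable {R : Type u} [CommRing R] {N : ℕ} (𝒢 : ClosedSubgroupScheme R N)

/-- The group `𝒢(B)` of points with values in the `R`-algebra `φ : R → B`. -/
def points {B : Type u} [CommRing B] (φ : R →+* B) : Subgroup (GL (Fin N) B) where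
  carrier := {g | ∀ p ∈ 𝒢.eqs, p.eval₂ φ (fun ij => (g : Matrix (Fin N) (Fin N) B) ij.1 ij.2) = 0}
  one_mem' := 𝒢.one_mem φ
  mul_mem' := fun {g h} hg hh => 𝒢.mul_mem φ g h hg hh
  inv_mem' := fun {g} hg => 𝒢.inv_mem φ g hg

/-- The Lie algebra `Lie(𝒢)(B)`, inside `N × N` matrices: the matrices `X` such that `1 + ε X` is a
point of `𝒢` over the dual numbers `B[ε]`. -/
def lieAlgebra {B : Type u} [CommRing B] (φ : R →+* B) : Set (Matrix (Fin N) (Fin N) B) :=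
  {X | ∀ p ∈ 𝒢.eqs, p.eval₂ ((TrivSqZeroExt.inlHom B B).comp φ)
    (fun ij => (TrivSqZeroExt.inl ((1 : Matrix (Fin N) (Fin N) B) ij.1 ij.2)
      + TrivSqZeroExt.inr (X ij.1 ij.2) : DualNumber B)) = 0}

/-- The centralizer of `X` in the group `𝒢(B)`. -/
def groupCentralizer {B : Type u} [CommRing B] (φ : R →+* B) (X : Matrix (Fin N) (Fin N) B) :
    Set (GL (Fin N) B) :=
  {g | g ∈ 𝒢.points φ ∧ (g : Matrix (Fin N) (Fin N) B) * X = X * (g : Matrix (Fin N) (Fin N) B)}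

/-- The centralizer of `X` in the Lie algebra `Lie(𝒢)(B)`. -/
def lieCentralizer {B : Type u} [CommRing B] (φ : R →+* B) (X : Matrix (Fin N) (Fin N) B) :
    Set (Matrix (Fin N) (Fin N) B) :=
  {Y | Y ∈ 𝒢.lieAlgebra φ ∧ Y * X = X * Y}

/-- Functoriality of the points: a homomorphism `f : B → C` induces `𝒢(B) → 𝒢(C)`. -/
theorem map_mem {B C : Type u} [CommRing B] [CommRing C] (φ : R →+* B) (f : B →+* C)
    {g : GL (Fin N) B} (hg : g ∈ 𝒢.points φ) :
    Matrix.GeneralLinearGroup.map f g ∈ 𝒢.points (f.comp φ) := by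
  intro p hp
  have h := congrArg f (hg p hp)
  rw [map_zero, MvPolynomial.hom_eval₂] at h
  exact h

end ClosedSubgroupScheme

/-! ### The real algebraic groups `SO(n,1)` and `SU(n,1)` -/

/-- The diagonal matrix `diag(1, …, 1, -1)` of size `n + 1`. -/
def lorentzForm (n : ℕ) (B : Type v) [CommRing B] : Matrix (Fin (n + 1)) (Fin (n + 1)) B :=
  Matrix.diagonal fun i => if i = Fin.last n then -1 else 1

/-- For an endomorphism `σ` of the commutative ring `S`, the group of all `g` over `S` with
`σ(g)ᵀ J g = J` and `det g = 1`, where `J = diag(1, …, 1, -1)`. -/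
def lorentzGroup (n : ℕ) {S : Type v} [CommRing S] (σ : S →+* S) :
    Subgroup (GL (Fin (n + 1)) S) where
  carrier := {g | (g.1.map σ)ᵀ * lorentzForm n S * g.1 = lorentzForm n S ∧ g.1.det = 1}
  one_mem' := by
    constructor
    · simp only [Units.val_one, Matrix.map_one σ (map_zero σ) (map_one σ), Matrix.transpose_one,
        Matrix.one_mul, Matrix.mul_one]
    · simp only [Units.val_one, Matrix.det_one]
  mul_mem' := by
    rintro g h ⟨hg, hg'⟩ ⟨hh, hh'⟩
    refine ⟨?_, by rw [Units.val_mul, Matrix.det_mul, hg', hh', one_mul]⟩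
    have e : ((g * h).1.map σ)ᵀ * lorentzForm n S * (g * h).1
        = (h.1.map σ)ᵀ * ((g.1.map σ)ᵀ * lorentzForm n S * g.1) * h.1 := by
      simp only [Units.val_mul, Matrix.map_mul, Matrix.transpose_mul, Matrix.mul_assoc]
    rw [e, hg, hh]
  inv_mem' := by
    rintro g ⟨hg, hg'⟩
    have e : g.1 * g⁻¹.1 = 1 := g.mul_inv
    have e' : (g⁻¹.1.map σ)ᵀ * (g.1.map σ)ᵀ = 1 := by
      rw [← Matrix.transpose_mul, ← Matrix.map_mul, e,
        Matrix.map_one σ (map_zero σ) (map_one σ), Matrix.transpose_one]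
    constructor
    · calc (g⁻¹.1.map σ)ᵀ * lorentzForm n S * g⁻¹.1
          = (g⁻¹.1.map σ)ᵀ * ((g.1.map σ)ᵀ * lorentzForm n S * g.1) * g⁻¹.1 := by rw [hg]
        _ = ((g⁻¹.1.map σ)ᵀ * (g.1.map σ)ᵀ) * lorentzForm n S * (g.1 * g⁻¹.1) := by
          simp only [Matrix.mul_assoc]
        _ = lorentzForm n S := by rw [e, e', Matrix.one_mul, Matrix.mul_one]
    · have := congrArg Matrix.det e
      rwa [Matrix.det_mul, hg', one_mul, Matrix.det_one] at this

/-- The group `SO(n,1)(B)`, for a commutative ring `B`: the matrices `g` of determinant `1` over `B`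
with `gᵀ J g = J`. -/
def lorentzSO (n : ℕ) (B : Type v) [CommRing B] : Subgroup (GL (Fin (n + 1)) B) :=
  lorentzGroup n (RingHom.id B)

/-- `B[i] = B ⊗ ℂ = B[x] / (x² + 1)`, whose `star` is the conjugation `a + b i ↦ a - b i`. -/
abbrev Complexified (B : Type v) [CommRing B] : Type v := QuadraticAlgebra B (-1) 0

/-- The map `a + b i ↦ f a + f b i` induced by a ring homomorphism `f : B → C`. -/
def Complexified.map {B C : Type v} [CommRing B] [CommRing C] (f : B →+* C) :
    Complexified B →+* Complexified C where
  toFun z := ⟨f z.re, f z.im⟩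
  map_one' := by
    apply QuadraticAlgebra.ext
    · exact map_one f
    · exact map_zero f
  map_zero' := by ext <;> simp
  map_mul' x y := by ext <;> simp
  map_add' x y := by ext <;> simp

/-- The group `SU(n,1)(B)`, for a commutative ring `B`: the matrices `g` of determinant `1`
over `B[i]` with `g* J g = J`. -/
def lorentzSU (n : ℕ) (B : Type v) [CommRing B] : Subgroup (GL (Fin (n + 1)) (Complexified B)) :=
  lorentzGroup n (starRingEnd (Complexified B))

namespace ClosedSubgroupScheme

variable {R : Type} [CommRing R] {N : ℕ} (𝒢 : ClosedSubgroupScheme R N)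

/-- The base change of `𝒢` to `ℝ` along `σ : R → ℝ` is isomorphic to `SO(n,1)` as a real algebraic
group: there are isomorphisms `𝒢(B) ≃ SO(n,1)(B)` for all commutative `ℝ`-algebras `B`, natural
in `B`. -/
def IsRealFormSO (σ : R →+* ℝ) (n : ℕ) : Prop :=
  ∃ e : ∀ (B : Type) [CommRing B] [Algebra ℝ B],
      𝒢.points ((algebraMap ℝ B).comp σ) ≃* lorentzSO n B,
    ∀ (B C : Type) [CommRing B] [CommRing C] [Algebra ℝ B] [Algebra ℝ C] (f : B →ₐ[ℝ] C)
      (g : 𝒢.points ((algebraMap ℝ B).comp σ)) (h : 𝒢.points ((algebraMap ℝ C).comp σ)),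
      (h : GL (Fin N) C) = Matrix.GeneralLinearGroup.map (f : B →+* C) (g : GL (Fin N) B) →
      (e C h : GL (Fin (n + 1)) C)
        = Matrix.GeneralLinearGroup.map (f : B →+* C) (e B g : GL (Fin (n + 1)) B)

/-- The base change of `𝒢` to `ℝ` along `σ : R → ℝ` is isomorphic to `SU(n,1)` as a real algebraic
group: there are isomorphisms `𝒢(B) ≃ SU(n,1)(B)` for all commutative `ℝ`-algebras `B`, natural
in `B`. -/
def IsRealFormSU (σ : R →+* ℝ) (n : ℕ) : Prop :=
  ∃ e : ∀ (B : Type) [CommRing B] [Algebra ℝ B],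
      𝒢.points ((algebraMap ℝ B).comp σ) ≃* lorentzSU n B,
    ∀ (B C : Type) [CommRing B] [CommRing C] [Algebra ℝ B] [Algebra ℝ C] (f : B →ₐ[ℝ] C)
      (g : 𝒢.points ((algebraMap ℝ B).comp σ)) (h : 𝒢.points ((algebraMap ℝ C).comp σ)),
      (h : GL (Fin N) C) = Matrix.GeneralLinearGroup.map (f : B →+* C) (g : GL (Fin N) B) →
      (e C h : GL (Fin (n + 1)) (Complexified C))
        = Matrix.GeneralLinearGroup.map (Complexified.map (f : B →+* C))
            (e B g : GL (Fin (n + 1)) (Complexified B))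

end ClosedSubgroupScheme

/-! ### The ring of integers localized away from an ideal -/

section Localization

variable {A : Type u} [CommRing A]

/-- The elements of `A` that lie in no prime ideal other than those containing `𝔡₁`. -/
def awaySubmonoid (𝔡₁ : Ideal A) : Submonoid A where
  carrier := {a | ∀ 𝔭 : Ideal A, 𝔭.IsPrime → a ∈ 𝔭 → 𝔡₁ ≤ 𝔭}
  one_mem' := fun 𝔭 h𝔭 h => absurd ((Ideal.eq_top_iff_one 𝔭).2 h) h𝔭.ne_top
  mul_mem' := fun {_ _} ha hb 𝔭 h𝔭 h => (h𝔭.mem_or_mem h).elim (ha 𝔭 h𝔭) (hb 𝔭 h𝔭)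

/-- The localization of `A` away from `𝔡₁`: all elements whose prime divisors divide `𝔡₁` are
inverted. -/
abbrev AwayFrom (𝔡₁ : Ideal A) : Type u := Localization (awaySubmonoid 𝔡₁)

/-- The projection to `A / 𝔮`, for an ideal `𝔮` prime to `𝔡₁`. -/
noncomputable def AwayFrom.toQuotient {𝔡₁ 𝔮 : Ideal A} (h : IsCoprime 𝔡₁ 𝔮) :
    AwayFrom 𝔡₁ →+* A ⧸ 𝔮 :=
  IsLocalization.lift (M := awaySubmonoid 𝔡₁) (g := Ideal.Quotient.mk 𝔮) (by
    rintro ⟨a, ha⟩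
    have htop : Ideal.span {a} ⊔ 𝔮 = ⊤ := by
      by_contra hne
      obtain ⟨𝔪, h𝔪, hle⟩ := Ideal.exists_le_maximal _ hne
      have h1 : 𝔡₁ ≤ 𝔪 := ha 𝔪 h𝔪.isPrime (hle (Ideal.mem_sup_left
        (Ideal.mem_span_singleton_self a)))
      have h2 : 𝔡₁ ⊔ 𝔮 = ⊤ := Ideal.isCoprime_iff_sup_eq.1 h
      exact h𝔪.ne_top (top_le_iff.1 (h2 ▸ sup_le h1 (le_sup_right.trans hle)))
    obtain ⟨x, hx, y, hy, hxy⟩ := Submodule.mem_sup.1 ((Ideal.eq_top_iff_one _).1 htop)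
    obtain ⟨c, rfl⟩ := Ideal.mem_span_singleton'.1 hx
    refine IsUnit.of_mul_eq_one (Ideal.Quotient.mk 𝔮 c) ?_
    have h3 := congrArg (Ideal.Quotient.mk 𝔮) hxy
    rw [map_add, map_mul, Ideal.Quotient.eq_zero_iff_mem.2 hy, add_zero, map_one] at h3
    rw [mul_comm]
    exact h3)

end Localization

/-- For a number field `F` with a real embedding `τ`, the map to `ℝ` from the ring of integers
localized away from a nonzero ideal. -/
noncomputable def AwayFrom.toReal {F : Type} [Field F] [NumberField F] (τ : F →+* ℝ)
    {𝔡₁ : Ideal (NumberField.RingOfIntegers F)} (h𝔡₁ : 𝔡₁ ≠ ⊥) : AwayFrom 𝔡₁ →+* ℝ :=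
  IsLocalization.lift (M := awaySubmonoid 𝔡₁)
    (g := τ.comp (algebraMap (NumberField.RingOfIntegers F) F)) (by
      rintro ⟨a, ha⟩
      refine IsUnit.mk0 _ fun h0 => h𝔡₁ ?_
      have ha0 : a = 0 := by
        apply FaithfulSMul.algebraMap_injective (NumberField.RingOfIntegers F) F
        rw [map_zero]
        exact (map_eq_zero τ).1 h0
      exact le_bot_iff.1 (ha ⊥ Ideal.isPrime_bot (by simp [ha0])))

/-! ### Representations of level `𝔭 ^ r` -/

/-- A representation of `𝒢(A / 𝔭 ^ r)` has level `𝔭 ^ r` if, for no `s < r`, it factors through the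
quotient by the kernel of the reduction `𝒢(A / 𝔭 ^ r) → 𝒢(A / 𝔭 ^ s)`; that is, for every `s < r`
this kernel acts non-trivially. -/
def HasLevel {A : Type u} [CommRing A] {𝔡₁ 𝔭 : Ideal A} {N : ℕ}
    (𝒢 : ClosedSubgroupScheme (AwayFrom 𝔡₁) N) (h : IsCoprime 𝔡₁ 𝔭) (r : ℕ)
    {V : Type v} [AddCommGroup V] [Module ℂ V]
    (ρ : Representation ℂ (𝒢.points (AwayFrom.toQuotient (h.pow_right (n := r)))) V) : Prop :=
  ∀ (s : ℕ) (hs : s < r), ∃ g : 𝒢.points (AwayFrom.toQuotient (h.pow_right (n := r))),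
    Matrix.GeneralLinearGroup.map (Ideal.Quotient.factor (Ideal.pow_le_pow_right hs.le))
      (g : GL (Fin N) (A ⧸ 𝔭 ^ r)) = 1 ∧ ρ g ≠ 1

/-! Put k + 1 = ⌊r/2⌋ and l = r - (k + 1), so that k + 1 ≤ l. Write O for the ring of integers and
let ϖ be in 𝔭 but not in 𝔭². The kernel of 𝒢(O/𝔭^r) → 𝒢(O/𝔭^l) is abelian: Y ↦ 1 + ϖ^l Y identifies
𝔤(O/𝔭^(k+1)) with it. Restrict ρ to this group. By the level condition some 1 + ϖ^(r-1) Y acts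
nontrivially, hence does so on a weight vector of some weight χ. When the trace form splits 𝔤 off
from the matrices, χ has the form Y ↦ ψ(tr(XY)) with ψ a primitive additive character and X in
𝔤(O/𝔭^(k+1)). Acting by 𝒢(O/𝔭^r) moves this weight through the conjugation orbit of X, and distinct
points of the orbit are distinct weights, so dim ρ is at least the size of the orbit
(`exists_card_conjOrbit_le`). No irreducibility enters.

The orbit is counted by orbit-stabilizer. Climbing the powers of 𝔭 one at a time, each step
multiplies the number of points by |𝔤(k_𝔭)| and the order of the centralizer of X by at most the
order of the Lie centralizer of X mod 𝔭 (`LiftsAt.card_points`, `card_centralizerSubgroup_le`).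
Finally X is nonzero mod 𝔭, since χ is nontrivial at 1 + ϖ^l (ϖ^k Y) and tr(X ϖ^k Y) depends only on
X mod 𝔭.

Two properties are needed at almost all primes: points lift from O/𝔭^j to O/𝔭^(j+1), and 𝔤 is the
image of a projection self-adjoint for the trace form of the given embedding in GL_N. Both are
established over ℂ and spread out over the localized ring with one nonzero element inverted.
`ComplexForm` collects what is needed of the complexified group, which is an orthogonal group or SL.

Smoothness (`ComplexForm.exists_smooth`): lifting the tautological point of the coordinate ring to
its first-order thickening yields a Jacobian relation over ℂ. The relation is linear in the unknown
polynomials, so a linear retraction of ℂ onto the fraction field carries it down, and denominators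
are cleared.

Trace form (`ComplexForm.eq_zero_of_trace_mul_eq_zero`): this is the unitary trick. For U
antihermitian in the Lie algebra of the model group, exp(tU) is one point over an algebra of bounded
functions. The isomorphism of functors turns it into a bounded one-parameter group in GL_N(ℂ), whose
generator X has purely imaginary eigenvalues and no nontrivial Jordan block at 0. Hence tr(X²) ≤ 0,
with equality only for X = 0. Every element of 𝔤(ℂ) is X₁ + iX₂ with X₁, X₂ of this kind, so the
form is nondegenerate. The projection then spreads out by `ComplexForm.exists_lie_projector`. -/

/-! ### Dual numbers and the Lie algebra as the solutions of linear equations -/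

/-- First-order Taylor expansion along a square-zero displacement. -/
theorem MvPolynomial.eval₂_add_of_mul_eq_zero {R B ι : Type*} [Fintype ι] [CommRing R] [CommRing B]
    (φ : R →+* B) (x d : ι → B) (hd : ∀ i j, d i * d j = 0) (p : MvPolynomial ι R) :
    p.eval₂ φ (fun i => x i + d i)
      = p.eval₂ φ x + ∑ i, (MvPolynomial.pderiv i p).eval₂ φ x * d i := by
  classical
  induction p using MvPolynomial.induction_on with
  | C a => simp
  | add p q hp hq =>
    simp only [MvPolynomial.eval₂_add, hp, hq, map_add, add_mul, Finset.sum_add_distrib]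
    ring
  | mul_X p j hp =>
    have h1 : ∀ i, (MvPolynomial.pderiv i (p * MvPolynomial.X j)).eval₂ φ x * d i
        = x j * ((MvPolynomial.pderiv i p).eval₂ φ x * d i)
          + if i = j then p.eval₂ φ x * d j else 0 := by
      intro i
      rw [MvPolynomial.pderiv_mul, MvPolynomial.eval₂_add, MvPolynomial.eval₂_mul,
        MvPolynomial.eval₂_mul, MvPolynomial.eval₂_X, MvPolynomial.pderiv_X]
      by_cases hij : i = j
      · subst hij
        simp
        ring
      · rw [Pi.single_eq_of_ne (by tauto), MvPolynomial.eval₂_zero, if_neg hij]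
        ring
    have h2 : (∑ i, (MvPolynomial.pderiv i p).eval₂ φ x * d i) * d j = 0 := by
      rw [Finset.sum_mul]
      exact Finset.sum_eq_zero fun i _ => by rw [mul_assoc, hd, mul_zero]
    rw [MvPolynomial.eval₂_mul, MvPolynomial.eval₂_mul, MvPolynomial.eval₂_X,
      MvPolynomial.eval₂_X, hp, Finset.sum_congr rfl fun i _ => h1 i, Finset.sum_add_distrib,
      ← Finset.mul_sum, Finset.sum_ite_eq' Finset.univ j, if_pos (Finset.mem_univ j)]
    linear_combination h2

/-- The matrix `1 + ε X` over the dual numbers. -/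
def oneAddDual {n : Type*} [DecidableEq n] {B : Type*} [CommRing B] (X : Matrix n n B) :
    Matrix n n (DualNumber B) :=
  Matrix.of fun i j => TrivSqZeroExt.inl ((1 : Matrix n n B) i j) + TrivSqZeroExt.inr (X i j)

theorem oneAddDual_eq {n : Type*} [DecidableEq n] {B : Type*} [CommRing B] (X : Matrix n n B) :
    oneAddDual X = 1 + X.map (TrivSqZeroExt.inr : B → DualNumber B) := by
  ext i j
  · by_cases h : i = j <;> simp [oneAddDual, Matrix.one_apply, h]
  · by_cases h : i = j <;> simp [oneAddDual, Matrix.one_apply, h]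

theorem oneAddDual_mul {n : Type*} [Fintype n] [DecidableEq n] {B : Type*} [CommRing B]
    (X Y : Matrix n n B) : oneAddDual X * oneAddDual Y = oneAddDual (X + Y) := by
  have h : X.map (TrivSqZeroExt.inr : B → DualNumber B)
      * Y.map (TrivSqZeroExt.inr : B → DualNumber B) = 0 := by
    ext1 i j
    rw [Matrix.mul_apply]
    exact Finset.sum_eq_zero fun k _ => TrivSqZeroExt.inr_mul_inr B _ _
  have h' : (X + Y).map (TrivSqZeroExt.inr : B → DualNumber B)
      = X.map TrivSqZeroExt.inr + Y.map TrivSqZeroExt.inr := by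
    ext1 i j
    exact TrivSqZeroExt.inr_add _ _ _
  rw [oneAddDual_eq, oneAddDual_eq, oneAddDual_eq, add_mul, mul_add, mul_add, h, h']
  simp only [one_mul, mul_one, add_zero]
  abel

theorem oneAddDual_zero {n : Type*} [DecidableEq n] {B : Type*} [CommRing B] :
    oneAddDual (0 : Matrix n n B) = 1 := by
  rw [oneAddDual_eq]
  ext i j <;> simp

/-- The invertible matrix `1 + ε X` over the dual numbers. -/
def dualUnit {n : Type*} [Fintype n] [DecidableEq n] {B : Type*} [CommRing B] (X : Matrix n n B) :
    GL n (DualNumber B) where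
  val := oneAddDual X
  inv := oneAddDual (-X)
  val_inv := by rw [oneAddDual_mul, add_neg_cancel, oneAddDual_zero]
  inv_val := by rw [oneAddDual_mul, neg_add_cancel, oneAddDual_zero]

section dualUnit

variable {n : Type*} [Fintype n] [DecidableEq n] {B : Type*} [CommRing B]

theorem dualUnit_apply (X : Matrix n n B) (i j : n) :
    (dualUnit X).1 i j
      = TrivSqZeroExt.inl ((1 : Matrix n n B) i j) + TrivSqZeroExt.inr (X i j) := rfl

theorem fst_dualUnit_apply (X : Matrix n n B) (i j : n) :
    TrivSqZeroExt.fst ((dualUnit X).1 i j) = (1 : Matrix n n B) i j := by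
  simp [dualUnit_apply]

theorem snd_dualUnit_apply (X : Matrix n n B) (i j : n) :
    TrivSqZeroExt.snd ((dualUnit X).1 i j) = X i j := by
  simp [dualUnit_apply]

theorem dualUnit_add (X Y : Matrix n n B) : dualUnit (X + Y) = dualUnit X * dualUnit Y := by
  exact Units.ext (oneAddDual_mul X Y).symm

theorem dualUnit_conj (g : GL n B) (X : Matrix n n B) :
    dualUnit (g.1 * X * g⁻¹.1)
      = Matrix.GeneralLinearGroup.map (TrivSqZeroExt.inlHom B B) g * dualUnit X
        * (Matrix.GeneralLinearGroup.map (TrivSqZeroExt.inlHom B B) g)⁻¹ := by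
  rw [eq_mul_inv_iff_mul_eq]
  apply Units.ext
  have h : g.1 * X * g⁻¹.1 * g.1 = g.1 * X := by
    rw [mul_assoc, Units.inv_mul, mul_one]
  ext i j
  · simp [Matrix.mul_apply, dualUnit_apply, Matrix.one_apply, TrivSqZeroExt.fst_sum]
  · have h' := congrFun (congrFun h i) j
    simp only [Units.val_mul]
    rw [Matrix.mul_apply, Matrix.mul_apply, TrivSqZeroExt.snd_sum, TrivSqZeroExt.snd_sum]
    rw [Matrix.mul_apply, Matrix.mul_apply] at h'
    simpa [dualUnit_apply, Matrix.one_apply, TrivSqZeroExt.snd_sum, apply_ite, mul_comm] using h'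

/-- An element of `GL` over the dual numbers reducing to `1` is of the form `1 + ε X`. -/
theorem exists_eq_dualUnit (g : GL n (DualNumber B))
    (hg : ∀ i j, TrivSqZeroExt.fst (g.1 i j) = (1 : Matrix n n B) i j) : ∃ X, g = dualUnit X := by
  refine ⟨Matrix.of fun i j => TrivSqZeroExt.snd (g.1 i j), Units.ext ?_⟩
  ext i j
  · rw [hg, fst_dualUnit_apply]
  · rw [snd_dualUnit_apply, Matrix.of_apply]

end dualUnit

namespace ClosedSubgroupScheme

variable {R : Type u} [CommRing R] {N : ℕ} (𝒢 : ClosedSubgroupScheme R N)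

theorem mem_points_iff {B : Type u} [CommRing B] (φ : R →+* B) (g : GL (Fin N) B) :
    g ∈ 𝒢.points φ ↔ ∀ p ∈ 𝒢.eqs, p.eval₂ φ (fun ij => g.1 ij.1 ij.2) = 0 := Iff.rfl

theorem mem_lieAlgebra_iff_dualUnit {B : Type u} [CommRing B] (φ : R →+* B)
    (X : Matrix (Fin N) (Fin N) B) :
    X ∈ 𝒢.lieAlgebra φ ↔ dualUnit X ∈ 𝒢.points ((TrivSqZeroExt.inlHom B B).comp φ) := Iff.rfl

/-- Since ε² = 0, the Taylor expansion stops after the linear term. This replaces the dual-number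
definition of the Lie algebra by linear equations with coefficients from the base ring. -/
theorem eval₂_one_add_dual {B : Type u} [CommRing B] (φ : R →+* B)
    (p : MvPolynomial (Fin N × Fin N) R) (X : Matrix (Fin N) (Fin N) B) :
    p.eval₂ ((TrivSqZeroExt.inlHom B B).comp φ)
      (fun ij => (TrivSqZeroExt.inl ((1 : Matrix (Fin N) (Fin N) B) ij.1 ij.2)
        + TrivSqZeroExt.inr (X ij.1 ij.2) : DualNumber B))
    = TrivSqZeroExt.inl (p.eval₂ φ fun ij => (1 : Matrix (Fin N) (Fin N) B) ij.1 ij.2)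
      + TrivSqZeroExt.inr (∑ ij : Fin N × Fin N, (MvPolynomial.pderiv ij p).eval₂ φ
          (fun ij => (1 : Matrix (Fin N) (Fin N) B) ij.1 ij.2) * X ij.1 ij.2) := by
  have h : ∀ q : MvPolynomial (Fin N × Fin N) R,
      q.eval₂ ((TrivSqZeroExt.inlHom B B).comp φ)
        (fun ij => (TrivSqZeroExt.inl ((1 : Matrix (Fin N) (Fin N) B) ij.1 ij.2) : DualNumber B))
      = TrivSqZeroExt.inl (q.eval₂ φ fun ij => (1 : Matrix (Fin N) (Fin N) B) ij.1 ij.2) := by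
    intro q
    have := MvPolynomial.hom_eval₂ q φ (TrivSqZeroExt.inlHom B B)
      (fun ij => (1 : Matrix (Fin N) (Fin N) B) ij.1 ij.2)
    exact this.symm
  rw [MvPolynomial.eval₂_add_of_mul_eq_zero _ _ _
    (fun i j => TrivSqZeroExt.inr_mul_inr B (X i.1 i.2) (X j.1 j.2)), h]
  congr 1
  rw [← TrivSqZeroExt.inrHom_apply, map_sum]
  refine Finset.sum_congr rfl fun i _ => ?_
  rw [h, TrivSqZeroExt.inl_mul_inr, smul_eq_mul]
  rfl

theorem mem_lieAlgebra_iff {B : Type u} [CommRing B] (φ : R →+* B)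
    (X : Matrix (Fin N) (Fin N) B) :
    X ∈ 𝒢.lieAlgebra φ ↔ ∀ p ∈ 𝒢.eqs, ∑ ij : Fin N × Fin N, (MvPolynomial.pderiv ij p).eval₂ φ
          (fun ij => (1 : Matrix (Fin N) (Fin N) B) ij.1 ij.2) * X ij.1 ij.2 = 0 := by
  refine forall₂_congr fun p hp => ?_
  rw [eval₂_one_add_dual, 𝒢.one_mem φ p hp, TrivSqZeroExt.inl_zero, zero_add]
  exact ⟨fun h => TrivSqZeroExt.inr_injective h, fun h => by rw [h, TrivSqZeroExt.inr_zero]⟩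

/-- The Lie algebra as a submodule of the matrices. -/
def lieSubmodule {B : Type u} [CommRing B] (φ : R →+* B) :
    Submodule B (Matrix (Fin N) (Fin N) B) where
  carrier := 𝒢.lieAlgebra φ
  zero_mem' := by simp [mem_lieAlgebra_iff]
  add_mem' {X Y} hX hY := by
    rw [mem_lieAlgebra_iff] at *
    intro p hp
    simp only [Matrix.add_apply, mul_add, Finset.sum_add_distrib, hX p hp, hY p hp, add_zero]
  smul_mem' c X hX := by
    rw [mem_lieAlgebra_iff] at *
    intro p hp
    simp only [Matrix.smul_apply, smul_eq_mul, mul_left_comm _ c, ← Finset.mul_sum, hX p hp,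
      mul_zero]

theorem mem_lieSubmodule {B : Type u} [CommRing B] (φ : R →+* B) (X : Matrix (Fin N) (Fin N) B) :
    X ∈ 𝒢.lieSubmodule φ ↔ X ∈ 𝒢.lieAlgebra φ := Iff.rfl

theorem map_mem_lieAlgebra {B C : Type u} [CommRing B] [CommRing C] (φ : R →+* B) (f : B →+* C)
    {X : Matrix (Fin N) (Fin N) B} (hX : X ∈ 𝒢.lieAlgebra φ) :
    X.map f ∈ 𝒢.lieAlgebra (f.comp φ) := by
  rw [mem_lieAlgebra_iff] at *
  intro p hp
  have := congrArg f (hX p hp)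
  rw [map_zero, map_sum] at this
  rw [← this]
  refine Finset.sum_congr rfl fun i _ => ?_
  rw [map_mul, MvPolynomial.hom_eval₂]
  congr 2
  ext ij
  simp [Matrix.one_apply, apply_ite f]

/-- Conjugating 1 + εX by the constant point g inside the group over the dual numbers gives 1 + ε
gXg⁻¹. -/
theorem conj_mem_lieAlgebra {B : Type u} [CommRing B] (φ : R →+* B) {g : GL (Fin N) B}
    (hg : g ∈ 𝒢.points φ) {X : Matrix (Fin N) (Fin N) B} (hX : X ∈ 𝒢.lieAlgebra φ) :
    g.1 * X * g⁻¹.1 ∈ 𝒢.lieAlgebra φ := by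
  rw [mem_lieAlgebra_iff_dualUnit] at *
  rw [dualUnit_conj]
  have h := 𝒢.map_mem φ (TrivSqZeroExt.inlHom B B) hg
  exact Subgroup.mul_mem _ (Subgroup.mul_mem _ h hX) (Subgroup.inv_mem _ h)

end ClosedSubgroupScheme

/-! ### Points congruent to 1 modulo a square-zero element -/

/-- The invertible matrix `1 + w Y`, where `w ^ 2 = 0`. -/
def oneAddUnit {n : Type*} [Fintype n] [DecidableEq n] {A : Type*} [CommRing A] {w : A}
    (hw : w * w = 0) (Y : Matrix n n A) : GL n A where
  val := 1 + w • Y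
  inv := 1 - w • Y
  val_inv := by
    have : (w • Y) * (w • Y) = 0 := by rw [smul_mul_smul_comm, hw, zero_smul]
    rw [add_mul, mul_sub, mul_sub, this]; simp
  inv_val := by
    have : (w • Y) * (w • Y) = 0 := by rw [smul_mul_smul_comm, hw, zero_smul]
    rw [sub_mul, mul_add, mul_add, this]; simp

section oneAddUnit

variable {n : Type*} [Fintype n] [DecidableEq n] {A : Type*} [CommRing A] {w : A} (hw : w * w = 0)

theorem oneAddUnit_val (Y : Matrix n n A) : (oneAddUnit hw Y).1 = 1 + w • Y := rfl

theorem oneAddUnit_add (Y Z : Matrix n n A) :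
    oneAddUnit hw (Y + Z) = oneAddUnit hw Y * oneAddUnit hw Z := by
  apply Units.ext
  have : (w • Y) * (w • Z) = 0 := by rw [smul_mul_smul_comm, hw, zero_smul]
  rw [Units.val_mul, oneAddUnit_val, oneAddUnit_val, oneAddUnit_val, add_mul, mul_add (w • Y), this]
  simp [add_assoc, add_comm (w • Y)]

theorem oneAddUnit_conj (g : GL n A) (Y : Matrix n n A) :
    g * oneAddUnit hw Y * g⁻¹ = oneAddUnit hw (g.1 * Y * g⁻¹.1) := by
  apply Units.ext
  simp [oneAddUnit_val, mul_add, add_mul]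

end oneAddUnit

namespace ClosedSubgroupScheme

variable {R : Type u} [CommRing R] {N : ℕ} (𝒢 : ClosedSubgroupScheme R N)

/-- If multiplication by `w` on `A` has kernel that of `A → κ`, then `1 + w Y` is a point of `𝒢`
exactly when the image of `Y` over `κ` is in the Lie algebra. -/
theorem oneAddUnit_mem_points_iff {A κ : Type u} [CommRing A] [CommRing κ] (φ : R →+* A)
    (q : A →+* κ) {w : A} (hw : w * w = 0) (hq : ∀ a, w * a = 0 ↔ q a = 0)
    (Y : Matrix (Fin N) (Fin N) A) :
    oneAddUnit hw Y ∈ 𝒢.points φ ↔ Y.map q ∈ 𝒢.lieAlgebra (q.comp φ) := by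
  rw [mem_lieAlgebra_iff, mem_points_iff]
  refine forall₂_congr fun p hp => ?_
  have h1 : (fun ij : Fin N × Fin N => (oneAddUnit hw Y).1 ij.1 ij.2)
      = fun ij => (1 : Matrix (Fin N) (Fin N) A) ij.1 ij.2 + w * Y ij.1 ij.2 := by
    ext ij
    simp [oneAddUnit_val]
  have h2 : (fun ij : Fin N × Fin N => (1 : Matrix (Fin N) (Fin N) κ) ij.1 ij.2)
      = fun ij => q ((1 : Matrix (Fin N) (Fin N) A) ij.1 ij.2) := by
    ext ij
    simp [Matrix.one_apply, apply_ite q]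
  rw [h1, MvPolynomial.eval₂_add_of_mul_eq_zero _ _ _
    (fun i j => by rw [mul_mul_mul_comm, hw, zero_mul]), 𝒢.one_mem φ p hp, zero_add, h2]
  have h3 : ∑ i : Fin N × Fin N, (MvPolynomial.pderiv i p).eval₂ φ
        (fun ij => (1 : Matrix (Fin N) (Fin N) A) ij.1 ij.2) * (w * Y i.1 i.2)
      = w * ∑ i : Fin N × Fin N, (MvPolynomial.pderiv i p).eval₂ φ
        (fun ij => (1 : Matrix (Fin N) (Fin N) A) ij.1 ij.2) * Y i.1 i.2 := by
    rw [Finset.mul_sum]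
    exact Finset.sum_congr rfl fun i _ => by ring
  -- The value of p at 1 + wY is w times the tangent form at Y, and `hq` turns its vanishing into
  -- the tangent equation over κ.
  rw [h3, hq, map_sum]
  simp only [map_mul, MvPolynomial.hom_eval₂]
  rfl

end ClosedSubgroupScheme

/-! ### Generators of bounded one-parameter groups -/

section OneParameter

variable {n : Type*} [Fintype n]

theorem hasDerivAt_mulVec_of_oneParameter {Γ : ℝ → Matrix n n ℂ} {X : Matrix n n ℂ}
    (hmul : ∀ s t, Γ (s + t) = Γ s * Γ t)
    (hder : ∀ i j, HasDerivAt (fun t => Γ t i j) (X i j) 0) (v : n → ℂ) (i : n) (t : ℝ) :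
    HasDerivAt (fun t => (Γ t *ᵥ v) i) ((Γ t *ᵥ (X *ᵥ v)) i) t := by
  have h1 : HasDerivAt (fun s : ℝ => ∑ k, (∑ j, Γ t i j * Γ s j k) * v k)
      (∑ k, (∑ j, Γ t i j * X j k) * v k) 0 :=
    HasDerivAt.fun_sum fun k _ =>
      (HasDerivAt.fun_sum fun j _ => (hder j k).const_mul (Γ t i j)).mul_const (v k)
  have h2 : (∑ k, (∑ j, Γ t i j * X j k) * v k) = (Γ t *ᵥ (X *ᵥ v)) i := by
    rw [Matrix.mulVec_mulVec]
    simp [Matrix.mulVec, dotProduct, Matrix.mul_apply]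
  have h3 : (fun s : ℝ => ∑ k, (∑ j, Γ t i j * Γ s j k) * v k)
      = fun s => (Γ (t + s) *ᵥ v) i := by
    ext s
    rw [hmul]
    simp [Matrix.mulVec, dotProduct, Matrix.mul_apply]
  rw [h2, h3] at h1
  have h4 : HasDerivAt (fun s : ℝ => (Γ (t + s) *ᵥ v) i) ((Γ t *ᵥ (X *ᵥ v)) i) (t - t) := by
    rwa [sub_self]
  have := HasDerivAt.comp_sub_const t t h4
  simpa using this

theorem bounded_mulVec {Γ : ℝ → Matrix n n ℂ} {C : ℝ} (hbd : ∀ t i j, ‖Γ t i j‖ ≤ C)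
    (v : n → ℂ) (i : n) : ∃ D, ∀ t, ‖(Γ t *ᵥ v) i‖ ≤ D := by
  refine ⟨∑ j, C * ‖v j‖, fun t => (norm_sum_le _ _).trans (Finset.sum_le_sum fun j _ => ?_)⟩
  rw [norm_mul]
  exact mul_le_mul_of_nonneg_right (hbd t i j) (norm_nonneg _)

variable [DecidableEq n]

/-- The derivative of exp(-μt) Γ(t)v vanishes, because Γ' = ΓX and Xv = μv. -/
theorem mulVec_eq_exp_of_oneParameter {Γ : ℝ → Matrix n n ℂ} {X : Matrix n n ℂ}
    (hmul : ∀ s t, Γ (s + t) = Γ s * Γ t) (h0 : Γ 0 = 1)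
    (hder : ∀ i j, HasDerivAt (fun t => Γ t i j) (X i j) 0) {v : n → ℂ} {μ : ℂ}
    (hv : X *ᵥ v = μ • v) (i : n) (t : ℝ) :
    (Γ t *ᵥ v) i = Complex.exp (μ * t) * v i := by
  have h1 : ∀ t : ℝ, HasDerivAt (fun t : ℝ => Complex.exp (-(μ * t)) * (Γ t *ᵥ v) i) 0 t := by
    intro t
    have h2 : HasDerivAt (fun t : ℝ => Complex.exp (-(μ * t)))
        (Complex.exp (-(μ * t)) * -(μ * 1)) t :=
      (((Complex.ofRealCLM.hasDerivAt (x := t)).const_mul μ).neg).cexp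
    refine (h2.mul (hasDerivAt_mulVec_of_oneParameter hmul hder v i t)).congr_deriv ?_
    rw [hv, Matrix.mulVec_smul, Pi.smul_apply, smul_eq_mul]
    ring
  have h4 := is_const_of_deriv_eq_zero (fun t => (h1 t).differentiableAt)
    (fun t => (h1 t).deriv) t 0
  simp only [h0, Matrix.one_mulVec, Complex.ofReal_zero, mul_zero, neg_zero, Complex.exp_zero,
    one_mul] at h4
  rw [← h4, ← mul_assoc, ← Complex.exp_add, add_neg_cancel, Complex.exp_zero, one_mul]

theorem eq_zero_of_forall_mul_le {a D : ℝ} (h : ∀ t : ℝ, t * a ≤ D) : a = 0 := by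
  by_contra ha
  have h1 := h ((D + 1) / a)
  rw [div_mul_cancel₀ _ ha] at h1
  linarith

/-- On an eigenvector Γ(t) acts by exp(μt), which stays bounded as t runs to both +∞ and -∞ only for
imaginary μ. -/
theorem re_eq_zero_of_oneParameter {Γ : ℝ → Matrix n n ℂ} {X : Matrix n n ℂ} {C : ℝ}
    (hmul : ∀ s t, Γ (s + t) = Γ s * Γ t) (h0 : Γ 0 = 1) (hbd : ∀ t i j, ‖Γ t i j‖ ≤ C)
    (hder : ∀ i j, HasDerivAt (fun t => Γ t i j) (X i j) 0) {v : n → ℂ} {μ : ℂ}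
    (hv : X *ᵥ v = μ • v) (hv0 : v ≠ 0) : μ.re = 0 := by
  obtain ⟨i, hi⟩ := Function.ne_iff.1 hv0
  obtain ⟨D, hD⟩ := bounded_mulVec hbd v i
  have hpos : 0 < ‖v i‖ := norm_pos_iff.2 hi
  refine eq_zero_of_forall_mul_le (D := D / ‖v i‖) fun t => ?_
  have h1 := hD t
  rw [mulVec_eq_exp_of_oneParameter hmul h0 hder hv i t, norm_mul, Complex.norm_exp,
    ← le_div_iff₀ hpos] at h1
  have h2 : (μ * t).re = t * μ.re := by simp [mul_comm]
  rw [h2] at h1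
  linarith [Real.add_one_le_exp (t * μ.re)]

/-- If X²v = 0 then Γ(t)v = v + tXv, and a bounded affine function of t is constant. This excludes
nontrivial Jordan blocks at 0. -/
theorem mulVec_eq_zero_of_oneParameter {Γ : ℝ → Matrix n n ℂ} {X : Matrix n n ℂ} {C : ℝ}
    (hmul : ∀ s t, Γ (s + t) = Γ s * Γ t) (h0 : Γ 0 = 1) (hbd : ∀ t i j, ‖Γ t i j‖ ≤ C)
    (hder : ∀ i j, HasDerivAt (fun t => Γ t i j) (X i j) 0) {v : n → ℂ}
    (hv : X *ᵥ (X *ᵥ v) = 0) : X *ᵥ v = 0 := by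
  ext i
  obtain ⟨D, hD⟩ := bounded_mulVec hbd v i
  have h1 : ∀ t : ℝ, (Γ t *ᵥ (X *ᵥ v)) i = (X *ᵥ v) i := by
    intro t
    rw [mulVec_eq_exp_of_oneParameter hmul h0 hder (μ := 0) (by rw [hv, zero_smul]) i t]
    simp
  have h2 : ∀ t : ℝ, HasDerivAt (fun t : ℝ => (Γ t *ᵥ v) i - t * (X *ᵥ v) i) 0 t := by
    intro t
    have h3 := hasDerivAt_mulVec_of_oneParameter hmul hder v i t
    rw [h1] at h3
    refine (h3.sub ((Complex.ofRealCLM.hasDerivAt (x := t)).mul_const ((X *ᵥ v) i))).congr_deriv ?_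
    simp
  have h4 : ∀ t : ℝ, (Γ t *ᵥ v) i = v i + t * (X *ᵥ v) i := by
    intro t
    have := is_const_of_deriv_eq_zero (fun t => (h2 t).differentiableAt)
      (fun t => (h2 t).deriv) t 0
    simp only [h0, Matrix.one_mulVec, Complex.ofReal_zero, zero_mul, sub_zero] at this
    rw [← this, sub_add_cancel]
  rw [Pi.zero_apply, ← norm_eq_zero]
  refine eq_zero_of_forall_mul_le (D := D + ‖v i‖) fun t => ?_
  have h5 : (t : ℂ) * (X *ᵥ v) i = (Γ t *ᵥ v) i - v i := by rw [h4]; ring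
  calc t * ‖(X *ᵥ v) i‖ ≤ |t| * ‖(X *ᵥ v) i‖ :=
        mul_le_mul_of_nonneg_right (le_abs_self t) (norm_nonneg _)
    _ = ‖(t : ℂ) * (X *ᵥ v) i‖ := by rw [norm_mul, Complex.norm_real, Real.norm_eq_abs]
    _ ≤ ‖(Γ t *ᵥ v) i‖ + ‖v i‖ := by rw [h5]; exact norm_sub_le _ _
    _ ≤ D + ‖v i‖ := by linarith [hD t]

/-- The generator of a bounded one-parameter group is zero if it is nilpotent. -/
theorem eq_zero_of_isNilpotent_of_oneParameter {Γ : ℝ → Matrix n n ℂ} {X : Matrix n n ℂ} {C : ℝ}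
    (hmul : ∀ s t, Γ (s + t) = Γ s * Γ t) (h0 : Γ 0 = 1) (hbd : ∀ t i j, ‖Γ t i j‖ ≤ C)
    (hder : ∀ i j, HasDerivAt (fun t => Γ t i j) (X i j) 0) (hX : IsNilpotent X) : X = 0 := by
  obtain ⟨k, hk⟩ := hX
  have key : ∀ k : ℕ, X ^ (k + 1) = 0 → X = 0 := by
    intro k
    induction k with
    | zero => intro h; simpa using h
    | succ k ih =>
      intro h
      apply ih
      have h1 : ∀ v, X ^ (k + 1) *ᵥ v = 0 := by
        intro v
        rw [pow_succ', ← Matrix.mulVec_mulVec]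
        apply mulVec_eq_zero_of_oneParameter hmul h0 hbd hder
        rw [Matrix.mulVec_mulVec, Matrix.mulVec_mulVec, mul_assoc, ← pow_succ', ← pow_succ', h,
          Matrix.zero_mulVec]
      ext i j
      have := congrFun (h1 (Pi.single j 1)) i
      simpa using this
  exact key k (by rw [pow_succ, hk, zero_mul])

/-- The trace form is negative definite on generators of bounded one-parameter groups. -/
theorem trace_mul_self_of_oneParameter {Γ : ℝ → Matrix n n ℂ} {X : Matrix n n ℂ} {C : ℝ}
    (hmul : ∀ s t, Γ (s + t) = Γ s * Γ t) (h0 : Γ 0 = 1) (hbd : ∀ t i j, ‖Γ t i j‖ ≤ C)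
    (hder : ∀ i j, HasDerivAt (fun t => Γ t i j) (X i j) 0) :
    (X * X).trace.im = 0 ∧ (X * X).trace.re ≤ 0 ∧ ((X * X).trace.re = 0 → X = 0) := by
  have hroot : ∀ ν ∈ (X * X).charpoly.roots, ν.im = 0 ∧ ν.re ≤ 0 := by
    intro ν hν
    obtain ⟨s, rfl⟩ : ∃ s : ℂ, ν = s * s := IsAlgClosed.exists_eq_mul_self ν
    have h1 := (Polynomial.mem_roots'.1 hν).2
    rw [Polynomial.IsRoot.def, Matrix.eval_charpoly] at h1
    -- Factoring s² - X² as (s - X)(s + X) shows that s or -s is an eigenvalue of X. So s is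
    -- imaginary and the eigenvalue s² of X² is real and nonpositive.
    have h2 : Matrix.scalar n (s * s) - X * X
        = (Matrix.scalar n s - X) * (Matrix.scalar n s - -X) := by
      have hc : Matrix.scalar n s * X = X * Matrix.scalar n s :=
        (Matrix.scalar_commute s (fun r => mul_comm _ _) X).eq
      rw [map_mul, sub_mul, mul_sub, mul_sub, mul_neg, mul_neg, hc]
      abel
    rw [h2, Matrix.det_mul] at h1
    have h3 : s.re = 0 := by
      rcases mul_eq_zero.1 h1 with h | h
      · obtain ⟨v, hv, hv'⟩ := Matrix.exists_mulVec_eq_zero_iff.2 h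
        refine re_eq_zero_of_oneParameter hmul h0 hbd hder (v := v) ?_ hv
        rw [Matrix.sub_mulVec, sub_eq_zero] at hv'
        rw [← hv']
        simp [Matrix.scalar_apply, Matrix.diagonal_const_mulVec]
      · obtain ⟨v, hv, hv'⟩ := Matrix.exists_mulVec_eq_zero_iff.2 h
        have := re_eq_zero_of_oneParameter hmul h0 hbd hder (v := v) (μ := -s) ?_ hv
        · simpa using this
        rw [Matrix.sub_mulVec, sub_eq_zero, Matrix.neg_mulVec] at hv'
        rw [neg_smul, ← neg_eq_iff_eq_neg, ← hv']
        simp [Matrix.scalar_apply, Matrix.diagonal_const_mulVec]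
    simp only [Complex.mul_im, Complex.mul_re, h3, zero_mul, mul_zero, add_zero, zero_sub]
    exact ⟨trivial, by nlinarith [mul_self_nonneg s.im]⟩
  have hsum : ∀ m : Multiset ℂ, (∀ ν ∈ m, ν.im = 0 ∧ ν.re ≤ 0) →
      m.sum.im = 0 ∧ m.sum.re ≤ 0 ∧ (m.sum.re = 0 → ∀ ν ∈ m, ν = 0) := by
    intro m
    induction m using Multiset.induction_on with
    | empty => simp
    | cons a m ih =>
      intro h
      obtain ⟨h1, h2, h3⟩ := ih fun ν hν => h ν (Multiset.mem_cons_of_mem hν)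
      obtain ⟨h4, h5⟩ := h a (Multiset.mem_cons_self a m)
      simp only [Multiset.sum_cons, Complex.add_im, Complex.add_re]
      refine ⟨by rw [h1, h4, add_zero], by linarith, fun h6 ν hν => ?_⟩
      rcases Multiset.mem_cons.1 hν with rfl | hν
      · exact Complex.ext (by simp; linarith) h4
      · exact h3 (by linarith) ν hν
  rw [Matrix.trace_eq_sum_roots_charpoly]
  obtain ⟨h1, h2, h3⟩ := hsum _ hroot
  refine ⟨h1, h2, fun h => eq_zero_of_isNilpotent_of_oneParameter hmul h0 hbd hder ?_⟩
  have h4 := h3 h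
  -- When the trace vanishes, so does every eigenvalue of X². The characteristic polynomial is then
  -- a power of the variable, and Cayley–Hamilton makes X nilpotent.
  have h5 : (X * X).charpoly = Polynomial.X ^ (X * X).charpoly.roots.card := by
    have hs := IsAlgClosed.splits (X * X).charpoly
    have := hs.eq_prod_roots_of_monic (Matrix.charpoly_monic _)
    conv_lhs => rw [this]
    have h6 : (X * X).charpoly.roots.map (fun a => Polynomial.X - Polynomial.C a)
        = (X * X).charpoly.roots.map (fun _ => (Polynomial.X : Polynomial ℂ)) :=
      Multiset.map_congr rfl fun a ha => by rw [h4 a ha, map_zero, sub_zero]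
    rw [h6, Multiset.map_const', Multiset.prod_replicate]
  have h6 := Matrix.aeval_self_charpoly (X * X)
  rw [h5, map_pow, Polynomial.aeval_X] at h6
  exact ⟨2 * (X * X).charpoly.roots.card, by rw [pow_mul, pow_two, h6]⟩

end OneParameter

/-! ### Exponentials of antihermitian matrices -/

section Exponential

variable {n : Type*} [Fintype n] [DecidableEq n]

theorem hasDerivAt_exp_entry (U : Matrix n n ℂ) (i j : n) :
    HasDerivAt (fun t : ℝ => NormedSpace.exp (t • U) i j) (U i j) 0 := by
  let _ : NormedRing (Matrix n n ℂ) := Matrix.linftyOpNormedRing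
  let _ : NormedAlgebra ℝ (Matrix n n ℂ) := Matrix.linftyOpNormedAlgebra
  have h := hasDerivAt_exp_smul_const (𝕂 := ℝ) U (0 : ℝ)
  rw [zero_smul, NormedSpace.exp_zero, one_mul] at h
  have h2 := ((Matrix.entryLinearMap ℝ ℂ i j).toContinuousLinearMap.hasFDerivAt).comp_hasDerivAt
    (0 : ℝ) h
  exact h2

theorem exp_add_smul (U : Matrix n n ℂ) (s t : ℝ) :
    NormedSpace.exp ((s + t) • U) = NormedSpace.exp (s • U) * NormedSpace.exp (t • U) := by
  rw [add_smul]
  exact Matrix.exp_add_of_commute _ _ (((Commute.refl U).smul_left s).smul_right t)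

theorem exp_mem_unitaryGroup {U : Matrix n n ℂ} (hU : Uᴴ = -U) (t : ℝ) :
    NormedSpace.exp (t • U) ∈ Matrix.unitaryGroup n ℂ := by
  rw [Matrix.mem_unitaryGroup_iff, Matrix.star_eq_conjTranspose, ← Matrix.exp_conjTranspose,
    Matrix.conjTranspose_smul, hU, star_trivial, smul_neg, ← neg_smul, ← exp_add_smul,
    add_neg_cancel, zero_smul, NormedSpace.exp_zero]

/-- The matrix iU is hermitian, so the spectral theorem diagonalizes U and reduces det exp = exp tr
to the diagonal case. -/
theorem det_exp_eq_one {U : Matrix n n ℂ} (hU : Uᴴ = -U) (htr : U.trace = 0) (t : ℝ) :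
    (NormedSpace.exp (t • U)).det = 1 := by
  have hH : (Complex.I • U).IsHermitian := by
    rw [Matrix.IsHermitian, Matrix.conjTranspose_smul, hU]
    simp
  set V : Matrix n n ℂ := hH.eigenvectorUnitary.1 with hV
  have hVV : V * star V = 1 := (Matrix.mem_unitaryGroup_iff).1 hH.eigenvectorUnitary.2
  have hVV' : star V * V = 1 := (Matrix.mem_unitaryGroup_iff').1 hH.eigenvectorUnitary.2
  have hVi : V⁻¹ = star V := Matrix.inv_eq_right_inv hVV
  have hVu : IsUnit V := IsUnit.of_mul_eq_one _ hVV
  set d : n → ℂ := fun i => -(Complex.I * (hH.eigenvalues i : ℂ))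
  have hUd : U = V * Matrix.diagonal d * V⁻¹ := by
    have h1 := hH.spectral_theorem
    have h2 : U = -(Complex.I • (Complex.I • U)) := by
      rw [smul_smul, Complex.I_mul_I]; simp
    have h3 : Complex.I • U = V * Matrix.diagonal (fun i => (hH.eigenvalues i : ℂ)) * V⁻¹ := by
      rw [hVi]
      exact h1
    have h4 : Matrix.diagonal d
        = -(Complex.I • Matrix.diagonal (fun i => (hH.eigenvalues i : ℂ))) := by
      rw [← Matrix.diagonal_smul, ← Matrix.diagonal_neg]
      rfl
    rw [h4]
    conv_lhs => rw [h2, h3]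
    simp
  have htr' : ∑ i, d i = 0 := by
    rw [← htr, hUd, Matrix.trace_mul_cycle, hVi, hVV', one_mul, Matrix.trace_diagonal]
  have h5 : t • U = V * Matrix.diagonal (t • d) * V⁻¹ := by
    conv_lhs => rw [hUd]
    rw [Matrix.diagonal_smul]
    simp
  rw [h5, Matrix.exp_conj _ _ hVu, Matrix.exp_diagonal, Matrix.det_mul, Matrix.det_mul,
    mul_right_comm, ← Matrix.det_mul, hVi, hVV, Matrix.det_one, one_mul, Matrix.det_diagonal]
  have h6 : ∀ i, NormedSpace.exp (t • d) i = Complex.exp (t * d i) := by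
    intro i
    rw [Pi.coe_exp, Complex.exp_eq_exp_ℂ]
    simp
  rw [Finset.prod_congr rfl fun i _ => h6 i, ← Complex.exp_sum, ← Finset.mul_sum, htr', mul_zero,
    Complex.exp_zero]

/-- The hypothesis says Uᵀ = -JUJ⁻¹, hence exp(tU)ᵀ = J exp(-tU) J⁻¹. -/
theorem exp_transpose_mul_mul {U J : Matrix n n ℂ} (hJ : J * J = 1) (hU : Uᵀ * J + J * U = 0)
    (t : ℝ) : (NormedSpace.exp (t • U))ᵀ * J * NormedSpace.exp (t • U) = J := by
  have hJi : J⁻¹ = J := Matrix.inv_eq_right_inv hJ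
  have h1 : (t • U)ᵀ = J * ((-t) • U) * J⁻¹ := by
    have h2 : Uᵀ = -(J * U * J) := by
      have := congrArg (· * J) (eq_neg_of_add_eq_zero_left hU)
      simpa [mul_assoc, hJ] using this
    rw [hJi, Matrix.transpose_smul, h2]
    simp
  rw [← Matrix.exp_transpose, h1, Matrix.exp_conj _ _ (IsUnit.of_mul_eq_one _ hJ), hJi]
  rw [mul_assoc, mul_assoc, mul_assoc, ← mul_assoc J J, hJ, one_mul, ← exp_add_smul,
    neg_add_cancel, zero_smul, NormedSpace.exp_zero, mul_one]

end Exponential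

/-! ### The unitary trick through the functor of points -/

/-- The algebra of bounded functions `ℝ → ℂ` that are differentiable at `0`. -/
def boundedDiffAlgebra : Subalgebra ℂ (ℝ → ℂ) where
  carrier := {f | (∃ C, ∀ t, ‖f t‖ ≤ C) ∧ DifferentiableAt ℝ f 0}
  mul_mem' := by
    rintro f g ⟨⟨C, hC⟩, hf⟩ ⟨⟨D, hD⟩, hg⟩
    refine ⟨⟨C * D, fun t => ?_⟩, hf.mul hg⟩
    rw [Pi.mul_apply, norm_mul]
    exact mul_le_mul (hC t) (hD t) (norm_nonneg _) ((norm_nonneg _).trans (hC t))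
  add_mem' := by
    rintro f g ⟨⟨C, hC⟩, hf⟩ ⟨⟨D, hD⟩, hg⟩
    exact ⟨⟨C + D, fun t => (norm_add_le _ _).trans (add_le_add (hC t) (hD t))⟩, hf.add hg⟩
  algebraMap_mem' c := ⟨⟨‖c‖, fun _ => le_rfl⟩, differentiableAt_const c⟩

/-- Evaluation at `t`. -/
def boundedDiffEval (t : ℝ) : boundedDiffAlgebra →ₐ[ℂ] ℂ :=
  (Pi.evalAlgHom ℂ (fun _ : ℝ => ℂ) t).comp boundedDiffAlgebra.val

/-- The first-order jet `f(0) + f'(0) ε`. -/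
noncomputable def boundedDiffJet : boundedDiffAlgebra →ₐ[ℂ] DualNumber ℂ where
  toFun f := TrivSqZeroExt.inl (f.1 0) + TrivSqZeroExt.inr (deriv f.1 0)
  map_one' := by
    have : deriv (1 : ℝ → ℂ) 0 = 0 := deriv_const 0 1
    ext <;> simp [this]
  map_mul' f g := by
    have : deriv (f.1 * g.1) 0 = deriv f.1 0 * g.1 0 + f.1 0 * deriv g.1 0 :=
      deriv_mul f.2.2 g.2.2
    ext
    · simp
    · simp [this, mul_comm, add_comm]
  map_zero' := by
    have : deriv (0 : ℝ → ℂ) 0 = 0 := deriv_const 0 0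
    ext <;> simp [this]
  map_add' f g := by
    have : deriv (f.1 + g.1) 0 = deriv f.1 0 + deriv g.1 0 := deriv_add f.2.2 g.2.2
    ext <;> simp [this]
  commutes' c := by
    have : deriv (algebraMap ℂ (ℝ → ℂ) c) 0 = 0 := deriv_const 0 c
    ext <;> simp [this, TrivSqZeroExt.algebraMap_eq_inl]

theorem boundedDiffJet_apply (f : boundedDiffAlgebra) :
    boundedDiffJet f = TrivSqZeroExt.inl (f.1 0) + TrivSqZeroExt.inr (deriv f.1 0) := rfl

/-- An identification of the base change of `𝒢` to `ℂ` with a functor `H` in subgroups of `GL_m`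
that is formally smooth, whose Lie algebra is stable under the conjugate transpose, and which
contains the exponentials of the antihermitian elements of its Lie algebra. -/
structure ComplexForm {R : Type} [CommRing R] {N : ℕ} (𝒢 : ClosedSubgroupScheme R N)
    (σ : R →+* ℂ) where
  /-- the size of the matrices -/
  m : ℕ
  /-- the functor -/
  H : ∀ (B : Type) [CommRing B] [Algebra ℂ B], Subgroup (GL (Fin m) B)
  /-- the isomorphism -/
  e : ∀ (B : Type) [CommRing B] [Algebra ℂ B], 𝒢.points ((algebraMap ℂ B).comp σ) ≃* H B
  natural : ∀ (B C : Type) [CommRing B] [CommRing C] [Algebra ℂ B] [Algebra ℂ C] (f : B →ₐ[ℂ] C)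
    (g : 𝒢.points ((algebraMap ℂ B).comp σ)) (h : 𝒢.points ((algebraMap ℂ C).comp σ)),
    (h : GL (Fin N) C) = Matrix.GeneralLinearGroup.map (f : B →+* C) (g : GL (Fin N) B) →
    (e C h : GL (Fin m) C) = Matrix.GeneralLinearGroup.map (f : B →+* C) (e B g : GL (Fin m) B)
  lift : ∀ (B C : Type) [CommRing B] [CommRing C] [Algebra ℂ B] [Algebra ℂ C] (f : B →ₐ[ℂ] C),
    Function.Surjective f → (∀ x y, f x = 0 → f y = 0 → x * y = 0) →
    ∀ h ∈ H C, ∃ h' ∈ H B, Matrix.GeneralLinearGroup.map (f : B →+* C) h' = h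
  star_mem : ∀ Y : Matrix (Fin m) (Fin m) ℂ, dualUnit Y ∈ H (DualNumber ℂ) →
    dualUnit Yᴴ ∈ H (DualNumber ℂ)
  exp_mem : ∀ U : Matrix (Fin m) (Fin m) ℂ, Uᴴ = -U → dualUnit U ∈ H (DualNumber ℂ) →
    ∃ h ∈ H boundedDiffAlgebra, ∀ t i j, (h.1 i j).1 t = NormedSpace.exp (t • U) i j

theorem generalLinearGroup_ext {n : Type*} [Fintype n] [DecidableEq n] {B : Type*} [CommRing B]
    {g h : GL n B} (H : ∀ i j, g.1 i j = h.1 i j) : g = h :=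
  Units.ext (Matrix.ext H)

namespace ComplexForm

variable {R : Type} [CommRing R] {N : ℕ} {𝒢 : ClosedSubgroupScheme R N} {σ : R →+* ℂ}
  (E : ComplexForm 𝒢 σ)

theorem algebraMap_comp_comp {B C : Type} [CommRing B] [CommRing C] [Algebra ℂ B] [Algebra ℂ C]
    (f : B →ₐ[ℂ] C) : (f : B →+* C).comp ((algebraMap ℂ B).comp σ) = (algebraMap ℂ C).comp σ := by
  rw [← RingHom.comp_assoc, AlgHom.comp_algebraMap]

/-- Functoriality of the points over `ℂ`-algebras. -/
def mapPoints {B C : Type} [CommRing B] [CommRing C] [Algebra ℂ B] [Algebra ℂ C]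
    (f : B →ₐ[ℂ] C) (g : 𝒢.points ((algebraMap ℂ B).comp σ)) :
    𝒢.points ((algebraMap ℂ C).comp σ) :=
  ⟨Matrix.GeneralLinearGroup.map (f : B →+* C) g.1, by
    rw [← algebraMap_comp_comp f]
    exact 𝒢.map_mem _ _ g.2⟩

theorem e_mapPoints {B C : Type} [CommRing B] [CommRing C] [Algebra ℂ B] [Algebra ℂ C]
    (f : B →ₐ[ℂ] C) (g : 𝒢.points ((algebraMap ℂ B).comp σ)) :
    (E.e C (mapPoints f g)).1 = Matrix.GeneralLinearGroup.map (f : B →+* C) (E.e B g).1 :=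
  E.natural B C f g _ rfl

theorem natural_symm {B C : Type} [CommRing B] [CommRing C] [Algebra ℂ B] [Algebra ℂ C]
    (f : B →ₐ[ℂ] C) (h : E.H B) (h' : E.H C)
    (hh : h'.1 = Matrix.GeneralLinearGroup.map (f : B →+* C) h.1) :
    ((E.e C).symm h').1 = Matrix.GeneralLinearGroup.map (f : B →+* C) ((E.e B).symm h).1 := by
  have h1 := E.e_mapPoints f ((E.e B).symm h)
  rw [MulEquiv.apply_symm_apply, ← hh] at h1
  rw [← Subtype.ext h1, MulEquiv.symm_apply_apply]
  rfl

theorem exists_lift (E : ComplexForm 𝒢 σ) {B C : Type} [CommRing B] [CommRing C] [Algebra ℂ B] [Algebra ℂ C]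
    (f : B →ₐ[ℂ] C) (hf : Function.Surjective f) (hf' : ∀ x y, f x = 0 → f y = 0 → x * y = 0)
    (g : 𝒢.points ((algebraMap ℂ C).comp σ)) :
    ∃ g' : 𝒢.points ((algebraMap ℂ B).comp σ), mapPoints f g' = g := by
  obtain ⟨h', hh', hh⟩ := E.lift B C f hf hf' (E.e C g).1 (E.e C g).2
  refine ⟨(E.e B).symm ⟨h', hh'⟩, ?_⟩
  apply (E.e C).injective
  apply Subtype.ext
  rw [E.e_mapPoints, MulEquiv.apply_symm_apply, hh]

/-- `X` and `Y` correspond to each other under the isomorphism of Lie algebras. -/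
def LieRel (X : Matrix (Fin N) (Fin N) ℂ) (Y : Matrix (Fin E.m) (Fin E.m) ℂ) : Prop :=
  ∃ g : 𝒢.points ((algebraMap ℂ (DualNumber ℂ)).comp σ),
    g.1 = dualUnit X ∧ (E.e _ g).1 = dualUnit Y

variable {E}

theorem LieRel.mem_left {X Y} (h : E.LieRel X Y) : X ∈ 𝒢.lieAlgebra σ := by
  obtain ⟨g, hg, -⟩ := h
  rw [ClosedSubgroupScheme.mem_lieAlgebra_iff_dualUnit, ← hg]
  exact g.2

theorem LieRel.mem_right {X Y} (h : E.LieRel X Y) : dualUnit Y ∈ E.H (DualNumber ℂ) := by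
  obtain ⟨g, -, hg⟩ := h
  rw [← hg]
  exact Subtype.property _

theorem LieRel.add {X Y X' Y'} (h : E.LieRel X Y) (h' : E.LieRel X' Y') :
    E.LieRel (X + X') (Y + Y') := by
  obtain ⟨g, h1, h2⟩ := h
  obtain ⟨g', h1', h2'⟩ := h'
  refine ⟨g * g', ?_, ?_⟩
  · rw [dualUnit_add, ← h1, ← h1']; rfl
  · rw [dualUnit_add, ← h2, ← h2', map_mul]; rfl

theorem map_dualUnit_smul {n : Type*} [Fintype n] [DecidableEq n] (c : ℂ) (X : Matrix n n ℂ) :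
    Matrix.GeneralLinearGroup.map
      ((TrivSqZeroExt.map (c • LinearMap.id : ℂ →ₗ[ℂ] ℂ) : DualNumber ℂ →ₐ[ℂ] DualNumber ℂ) :
        DualNumber ℂ →+* DualNumber ℂ) (dualUnit X) = dualUnit (c • X) := by
  apply generalLinearGroup_ext
  intro i j
  ext <;> simp [dualUnit_apply, mul_comm]

/-- The substitution ε ↦ cε is a ℂ-algebra endomorphism of the dual numbers, so naturality of the
isomorphism makes the correspondence of Lie algebras ℂ-homogeneous. -/
theorem LieRel.smul {X Y} (c : ℂ) (h : E.LieRel X Y) : E.LieRel (c • X) (c • Y) := by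
  obtain ⟨g, h1, h2⟩ := h
  refine ⟨mapPoints (TrivSqZeroExt.map (c • LinearMap.id : ℂ →ₗ[ℂ] ℂ)) g, ?_, ?_⟩
  · rw [← map_dualUnit_smul, ← h1]; rfl
  · rw [e_mapPoints, h2, map_dualUnit_smul]

theorem map_fst_eq_one_iff {n : Type*} [Fintype n] [DecidableEq n] (g : GL n (DualNumber ℂ)) :
    Matrix.GeneralLinearGroup.map
      ((TrivSqZeroExt.fstHom ℂ ℂ ℂ : DualNumber ℂ →ₐ[ℂ] ℂ) : DualNumber ℂ →+* ℂ) g = 1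
      ↔ ∃ X, g = dualUnit X := by
  constructor
  · intro h
    apply exists_eq_dualUnit
    intro i j
    have := congrArg (fun g : GL n ℂ => g.1 i j) h
    exact this
  · rintro ⟨X, rfl⟩
    exact generalLinearGroup_ext fun i j => fst_dualUnit_apply X i j

/-- Naturality for ε ↦ 0 makes the inverse isomorphism preserve the kernel of reduction, which
consists of the matrices 1 + εX. -/
theorem exists_lieRel_left {Y} (hY : dualUnit Y ∈ E.H (DualNumber ℂ)) : ∃ X, E.LieRel X Y := by
  have h1 := E.natural_symm (TrivSqZeroExt.fstHom ℂ ℂ ℂ) ⟨_, hY⟩ 1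
    ((map_fst_eq_one_iff _).2 ⟨Y, rfl⟩).symm
  rw [map_one] at h1
  obtain ⟨X, hX⟩ := (map_fst_eq_one_iff _).1 h1.symm
  exact ⟨X, _, hX, by rw [MulEquiv.apply_symm_apply]⟩

theorem exists_lieRel_right (E : ComplexForm 𝒢 σ) {X} (hX : X ∈ 𝒢.lieAlgebra σ) :
    ∃ Y, E.LieRel X Y := by
  have h1 := E.natural _ _ (TrivSqZeroExt.fstHom ℂ ℂ ℂ) ⟨dualUnit X, hX⟩ 1
    ((map_fst_eq_one_iff _).2 ⟨X, rfl⟩).symm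
  rw [map_one] at h1
  obtain ⟨Y, hY⟩ := (map_fst_eq_one_iff _).1 h1.symm
  exact ⟨Y, _, rfl, hY⟩

/-- The trace form is negative definite on the elements corresponding to antihermitian matrices. -/
theorem LieRel.trace_mul_self {X U} (h : E.LieRel X U) (hU : Uᴴ = -U) :
    (X * X).trace.im = 0 ∧ (X * X).trace.re ≤ 0 ∧ ((X * X).trace.re = 0 → X = 0) := by
  obtain ⟨u, hu, hexp⟩ := E.exp_mem U hU h.mem_right
  -- The whole curve exp(tU) is one point over the algebra of bounded functions. Its image in 𝒢 has
  -- entries in the same algebra, so boundedness and differentiability are transported without any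
  -- formula for the isomorphism.
  set γ := (E.e boundedDiffAlgebra).symm ⟨u, hu⟩
  have hev : ∀ t, (E.e ℂ (mapPoints (boundedDiffEval t) γ)).1.1 = NormedSpace.exp (t • U) := by
    intro t
    rw [e_mapPoints, MulEquiv.apply_symm_apply]
    ext i j
    exact hexp t i j
  have hmul : ∀ s t, mapPoints (boundedDiffEval (s + t)) γ
      = mapPoints (boundedDiffEval s) γ * mapPoints (boundedDiffEval t) γ := by
    intro s t
    apply (E.e ℂ).injective
    apply Subtype.ext
    apply Units.ext
    rw [map_mul, hev, exp_add_smul, ← hev, ← hev]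
    rfl
  have h0 : mapPoints (boundedDiffEval 0) γ = 1 := by
    apply (E.e ℂ).injective
    apply Subtype.ext
    apply Units.ext
    rw [map_one, hev, zero_smul, NormedSpace.exp_zero]
    rfl
  -- The first-order jet at 0 is a ring homomorphism to the dual numbers, so by naturality the
  -- tangent vector of γ is the X matched with U.
  have hjet : (mapPoints boundedDiffJet γ).1 = dualUnit X := by
    have h1 : (E.e _ (mapPoints boundedDiffJet γ)).1 = dualUnit U := by
      rw [e_mapPoints, MulEquiv.apply_symm_apply]
      apply generalLinearGroup_ext
      intro i j
      have h2 : (u.1 i j).1 = fun t : ℝ => NormedSpace.exp (t • U) i j := by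
        ext t
        exact hexp t i j
      have h3 := boundedDiffJet_apply (u.1 i j)
      have h4 : (u.1 i j).1 0 = (1 : Matrix (Fin E.m) (Fin E.m) ℂ) i j := by
        rw [hexp, zero_smul, NormedSpace.exp_zero]
      rw [h4, h2, (hasDerivAt_exp_entry U i j).deriv] at h3
      exact h3
    obtain ⟨g, hg1, hg2⟩ := h
    rw [← hg1]
    congr 1
    exact (E.e _).injective (Subtype.ext (h1.trans hg2.symm))
  have hbd : ∃ C, ∀ (t : ℝ) (i j : Fin N), ‖(γ.1.1 i j).1 t‖ ≤ C := by
    choose C hC using fun i j => (γ.1.1 i j).2.1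
    refine ⟨∑ i, ∑ j, |C i j|, fun t i j => (hC i j t).trans ((le_abs_self _).trans ?_)⟩
    exact (Finset.single_le_sum (f := fun j => |C i j|) (fun _ _ => abs_nonneg _)
      (Finset.mem_univ j)).trans (Finset.single_le_sum (f := fun i => ∑ j, |C i j|)
        (fun _ _ => Finset.sum_nonneg fun _ _ => abs_nonneg _) (Finset.mem_univ i))
  obtain ⟨C, hC⟩ := hbd
  refine trace_mul_self_of_oneParameter (C := C)
    (Γ := fun t => (mapPoints (boundedDiffEval t) γ).1.1) ?_ ?_ hC ?_
  · intro s t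
    rw [hmul]
    rfl
  · rw [h0]
    rfl
  · intro i j
    have h1 : boundedDiffJet (γ.1.1 i j) = (dualUnit X).1 i j := by
      rw [← hjet]
      rfl
    have h2 := congrArg TrivSqZeroExt.snd h1
    rw [snd_dualUnit_apply, boundedDiffJet_apply] at h2
    have h3 : deriv (γ.1.1 i j).1 0 = X i j := by simpa using h2
    rw [← h3]
    exact (γ.1.1 i j).2.2.hasDerivAt

/-- The trace form is nondegenerate on the complex Lie algebra. -/
theorem eq_zero_of_trace_mul_eq_zero (E : ComplexForm 𝒢 σ) {X} (hX : X ∈ 𝒢.lieAlgebra σ)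
    (h : ∀ Z ∈ 𝒢.lieAlgebra σ, (X * Z).trace = 0) : X = 0 := by
  obtain ⟨Y, hY⟩ := E.exists_lieRel_right hX
  obtain ⟨X', hX'⟩ := exists_lieRel_left (E.star_mem Y hY.mem_right)
  -- With X' matched to Y*, the elements X₁ and X₂ correspond to the antihermitian matrices (Y -
  -- Y*)/2 and -i(Y + Y*)/2, and X = X₁ + iX₂.
  have h1 := (hY.smul (1 / 2)).add (hX'.smul (-(1 / 2)))
  have h2 := (hY.smul (-(Complex.I / 2))).add (hX'.smul (-(Complex.I / 2)))
  set X₁ := (1 / 2 : ℂ) • X + (-(1 / 2) : ℂ) • X'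
  set X₂ := (-(Complex.I / 2)) • X + (-(Complex.I / 2)) • X'
  have t1 := h1.trace_mul_self (by
    simp only [Matrix.conjTranspose_add, Matrix.conjTranspose_smul,
      Matrix.conjTranspose_conjTranspose]
    simp)
  have t2 := h2.trace_mul_self (by
    simp only [Matrix.conjTranspose_add, Matrix.conjTranspose_smul,
      Matrix.conjTranspose_conjTranspose]
    simp [add_comm, neg_div])
  have hsum : X = X₁ + Complex.I • X₂ := by
    simp only [X₁, X₂, smul_add, smul_smul]
    have : Complex.I * -(Complex.I / 2) = 1 / 2 := by
      linear_combination (-1 / 2 : ℂ) * Complex.I_mul_I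
    rw [this]
    module
  have e1 := h X₁ h1.mem_left
  have e2 := h X₂ h2.mem_left
  rw [hsum, add_mul, Matrix.smul_mul, Matrix.trace_add, Matrix.trace_smul, smul_eq_mul] at e1 e2
  rw [Matrix.trace_mul_comm X₁ X₂] at e2
  -- Combining tr(XX₁) = 0 and tr(XX₂) = 0 cancels the mixed terms. Two real nonpositive numbers
  -- remain with sum 0.
  have e3 : (X₁ * X₁).trace + (X₂ * X₂).trace = 0 := by
    linear_combination e1 - Complex.I * e2 + (X₂ * X₂).trace * Complex.I_mul_I
  have e4 := congrArg Complex.re e3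
  rw [Complex.add_re, Complex.zero_re] at e4
  have z1 : X₁ = 0 := t1.2.2 (by linarith [t1.2.1, t2.2.1])
  have z2 : X₂ = 0 := t2.2.2 (by linarith [t1.2.1, t2.2.1])
  rw [hsum, z1, z2, smul_zero, add_zero]

end ComplexForm

/-! ### Orthogonal and special linear groups: formal smoothness, Lie algebras and exponentials -/

section LorentzForm

theorem lorentzForm_mul_self (n : ℕ) (B : Type v) [CommRing B] :
    lorentzForm n B * lorentzForm n B = 1 := by
  rw [lorentzForm, Matrix.diagonal_mul_diagonal, ← Matrix.diagonal_one]
  congr 1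
  ext i
  split_ifs <;> simp

theorem lorentzForm_transpose (n : ℕ) (B : Type v) [CommRing B] :
    (lorentzForm n B)ᵀ = lorentzForm n B :=
  Matrix.diagonal_transpose _

theorem lorentzForm_conjTranspose (n : ℕ) : (lorentzForm n ℂ)ᴴ = lorentzForm n ℂ := by
  rw [lorentzForm, Matrix.diagonal_conjTranspose]
  congr 1
  ext i
  rw [Pi.star_apply]
  split_ifs <;> simp

theorem lorentzForm_map (n : ℕ) {B C : Type*} [CommRing B] [CommRing C] (f : B →+* C) :
    (lorentzForm n B).map f = lorentzForm n C := by
  rw [lorentzForm, Matrix.diagonal_map (map_zero f), lorentzForm]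
  congr 1
  ext i
  split_ifs <;> simp

theorem det_lorentzForm_mul_self (n : ℕ) (B : Type v) [CommRing B] :
    (lorentzForm n B).det * (lorentzForm n B).det = 1 := by
  rw [← Matrix.det_mul, lorentzForm_mul_self, Matrix.det_one]

theorem mem_lorentzSO_iff {n : ℕ} {B : Type v} [CommRing B] (g : GL (Fin (n + 1)) B) :
    g ∈ lorentzSO n B ↔ g.1ᵀ * lorentzForm n B * g.1 = lorentzForm n B ∧ g.1.det = 1 := Iff.rfl

end LorentzForm

section SquareZero

theorem mul_apply_eq_zero_of_square_zero {B C : Type*} [CommRing B] [CommRing C] {f : B →+* C}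
    (hf : ∀ x y, f x = 0 → f y = 0 → x * y = 0) {l m n : Type*} [Fintype m]
    {X : Matrix l m B} {Y : Matrix m n B} (hX : X.map f = 0) (hY : Y.map f = 0) : X * Y = 0 := by
  ext i j
  rw [Matrix.mul_apply]
  exact Finset.sum_eq_zero fun k _ =>
    hf _ _ (congrFun (congrFun hX i) k) (congrFun (congrFun hY k) j)

theorem exists_map_eq_of_surjective {B C : Type*} [CommRing B] [CommRing C] {f : B →+* C}
    (hf : Function.Surjective f) {m n : Type*} (X : Matrix m n C) : ∃ Y : Matrix m n B,
    Y.map f = X := by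
  choose s hs using hf
  exact ⟨X.map s, by ext i j; exact hs _⟩

/-- `SO(n,1)` is formally smooth where `2` is invertible. -/
theorem exists_lift_lorentzSO {n : ℕ} {B C : Type*} [CommRing B] [CommRing C] {f : B →+* C}
    (hs : Function.Surjective f) (hf : ∀ x y, f x = 0 → f y = 0 → x * y = 0)
    {c : B} (hc : 2 * c = 1) {h : GL (Fin (n + 1)) C} (hh : h ∈ lorentzSO n C) :
    ∃ h' ∈ lorentzSO n B, Matrix.GeneralLinearGroup.map f h' = h := by
  obtain ⟨h1, h2⟩ := (mem_lorentzSO_iff h).1 hh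
  obtain ⟨G, hG⟩ := exists_map_eq_of_surjective hs h.1
  set J := lorentzForm n B with hJ
  have hJJ : J * J = 1 := lorentzForm_mul_self n B
  set T := Gᵀ * J * G - J with hT
  have hTf : T.map f = 0 := by
    rw [hT, Matrix.map_sub f (map_sub f), Matrix.map_mul, Matrix.map_mul, Matrix.transpose_map, hG,
      lorentzForm_map, h1, sub_self]
  have hTt : Tᵀ = T := by
    simp [hT, Matrix.transpose_mul, hJ, lorentzForm_transpose, Matrix.mul_assoc]
  have hTJT : ∀ X : Matrix (Fin (n + 1)) (Fin (n + 1)) B, T * X * T = 0 := by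
    intro X
    apply mul_apply_eq_zero_of_square_zero hf _ hTf
    rw [Matrix.map_mul, hTf, Matrix.zero_mul]
  -- One Newton step: T is the symmetric error of an arbitrary lift G and has entries in the
  -- square-zero ideal, so the factor 1 - ½JT removes T exactly.
  set G' := G * (1 - c • (J * T)) with hG'
  have hGJ : Gᵀ * J * G = J + T := by rw [hT]; abel
  have hG't : G'ᵀ = (1 - c • (T * J)) * Gᵀ := by
    rw [hG', Matrix.transpose_mul, Matrix.transpose_sub, Matrix.transpose_smul,
      Matrix.transpose_mul, Matrix.transpose_one, hTt, hJ, lorentzForm_transpose]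
  have hmain : G'ᵀ * J * G' = J := by
    have : G'ᵀ * J * G' = (1 - c • (T * J)) * (J + T) * (1 - c • (J * T)) := by
      rw [hG't, hG', ← hGJ]
      simp only [Matrix.mul_assoc]
    rw [this]
    have e1 : T * J * J = T := by rw [Matrix.mul_assoc, hJJ, Matrix.mul_one]
    have e2 : J * (J * T) = T := by rw [← Matrix.mul_assoc, hJJ, Matrix.one_mul]
    have e3 : T * J * T = 0 := hTJT J
    have e4 : T * (J * T) = 0 := by rw [← Matrix.mul_assoc, hTJT J]
    have e5 : T * T = 0 := by simpa using hTJT 1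
    have e6 : (1 - c • (T * J)) * (J + T) = J + T - c • T := by
      rw [Matrix.sub_mul, Matrix.one_mul, Matrix.smul_mul, Matrix.mul_add, e1, e3, add_zero]
    rw [e6, Matrix.mul_sub, Matrix.mul_one, Matrix.mul_smul, Matrix.sub_mul, Matrix.add_mul,
      Matrix.smul_mul, e2, e4]
    have e7 : c • T + c • T = T := by rw [← add_smul, ← two_mul, hc, one_smul]
    simp only [add_zero, smul_zero, sub_zero]
    rw [sub_sub, e7, add_sub_cancel_right]
  have hG'f : G'.map f = h.1 := by
    rw [hG', Matrix.map_mul, hG, Matrix.map_sub f (map_sub f), Matrix.map_one f (map_zero f)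
      (map_one f)]
    have : (c • (J * T)).map f = 0 := by
      ext i j
      have := congrFun (congrFun (show (J * T).map f = 0 by
        rw [Matrix.map_mul, hTf, Matrix.mul_zero]) i) j
      rw [Matrix.map_apply] at this
      rw [Matrix.map_apply, Matrix.smul_apply, smul_eq_mul, map_mul, this]
      exact mul_zero _
    rw [this, sub_zero, Matrix.mul_one]
  have hdf : f (G'.det - 1) = 0 := by
    rw [map_sub, map_one, RingHom.map_det, RingHom.mapMatrix_apply, hG'f, h2, sub_self]
  have hd2 : G'.det * G'.det = 1 := by
    have h3 := congrArg Matrix.det hmain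
    rw [Matrix.det_mul, Matrix.det_mul, Matrix.det_transpose] at h3
    have h4 := det_lorentzForm_mul_self n B
    rw [← hJ] at h4
    linear_combination J.det * h3 + (1 - G'.det * G'.det) * h4
  -- With d = det G', both d² = 1 and (d - 1)² = 0 hold. Subtracting gives 2(d - 1) = 0, and 2 is
  -- invertible.
  have hd : G'.det = 1 := by
    have h3 := hf _ _ hdf hdf
    linear_combination (-c) * h3 + c * hd2 + (1 - G'.det) * hc
  refine ⟨Matrix.GeneralLinearGroup.mk'' G' (by rw [hd]; exact isUnit_one),
    (mem_lorentzSO_iff _).2 ⟨hmain, hd⟩, Units.ext hG'f⟩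

/-- The special linear group as a subgroup of `GL_m`. -/
def specialLinearSubgroup (m : ℕ) (B : Type v) [CommRing B] : Subgroup (GL (Fin m) B) :=
  (Matrix.GeneralLinearGroup.det (n := Fin m) (R := B)).ker

theorem mem_specialLinearSubgroup_iff {m : ℕ} {B : Type v} [CommRing B] (g : GL (Fin m) B) :
    g ∈ specialLinearSubgroup m B ↔ g.1.det = 1 := by
  rw [specialLinearSubgroup, MonoidHom.mem_ker, Units.ext_iff]
  rfl

/-- If a lift has determinant 1 + x with x² = 0, multiplying its first row by 1 - x corrects the
determinant without changing the reduction. -/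
theorem exists_lift_specialLinearSubgroup {m : ℕ} {B C : Type*} [CommRing B] [CommRing C]
    {f : B →+* C} (hs : Function.Surjective f) (hf : ∀ x y, f x = 0 → f y = 0 → x * y = 0)
    {h : GL (Fin (m + 1)) C} (hh : h ∈ specialLinearSubgroup (m + 1) C) :
    ∃ h' ∈ specialLinearSubgroup (m + 1) B, Matrix.GeneralLinearGroup.map f h' = h := by
  rw [mem_specialLinearSubgroup_iff] at hh
  obtain ⟨G, hG⟩ := exists_map_eq_of_surjective hs h.1
  set x := G.det - 1 with hx
  have hxf : f x = 0 := by
    rw [hx, map_sub, map_one, RingHom.map_det, RingHom.mapMatrix_apply, hG, hh, sub_self]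
  set D : Matrix (Fin (m + 1)) (Fin (m + 1)) B := Matrix.diagonal (Function.update 1 0 (1 - x))
  have hD : D.det = 1 - x := by
    rw [Matrix.det_diagonal, Finset.prod_update_of_mem (Finset.mem_univ _)]
    simp
  have hDf : D.map f = 1 := by
    rw [Matrix.diagonal_map (map_zero f), ← Matrix.diagonal_one]
    congr 1
    ext i
    by_cases hi : i = 0
    · subst hi
      simp [hxf]
    · simp [hi]
  have hd : (D * G).det = 1 := by
    rw [Matrix.det_mul, hD]
    linear_combination (-1 : B) * hf x x hxf hxf + (1 - x) * hx
  refine ⟨Matrix.GeneralLinearGroup.mk'' (D * G) (by rw [hd]; exact isUnit_one),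
    (mem_specialLinearSubgroup_iff _).2 hd, Units.ext ?_⟩
  change (D * G).map f = h.1
  rw [Matrix.map_mul, hDf, hG, Matrix.one_mul]

end SquareZero

section Dual

variable {n : Type*} {B : Type*} [CommRing B]

theorem eps_mul_eps : (DualNumber.eps : DualNumber B) * DualNumber.eps = 0 := by
  simp

theorem oneAddDual_eq_smul [DecidableEq n] (X : Matrix n n B) :
    oneAddDual X = 1 + (DualNumber.eps : DualNumber B) • X.map (TrivSqZeroExt.inlHom B B) := by
  rw [oneAddDual_eq]
  congr 1
  ext i j <;> simp

theorem eps_smul_map_eq_zero_iff (X : Matrix n n B) :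
    (DualNumber.eps : DualNumber B) • X.map (TrivSqZeroExt.inlHom B B) = 0 ↔ X = 0 := by
  constructor
  · intro h
    ext i j
    have := congrArg TrivSqZeroExt.snd (congrFun (congrFun h i) j)
    simpa using this
  · rintro rfl
    simp

variable [Fintype n] [DecidableEq n]

theorem det_dualUnit (X : Matrix n n B) :
    (dualUnit X).1.det = 1 + TrivSqZeroExt.inr X.trace := by
  change (oneAddDual X).det = _
  rw [oneAddDual_eq_smul, Matrix.det_one_add_smul, pow_two, eps_mul_eps, mul_zero, add_zero]
  congr 1
  have : (X.map (TrivSqZeroExt.inlHom B B)).trace = TrivSqZeroExt.inl X.trace := by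
    have := AddMonoidHom.map_trace (TrivSqZeroExt.inlHom B B).toAddMonoidHom X
    exact this.symm
  rw [this]
  ext <;> simp

theorem det_dualUnit_eq_one_iff (X : Matrix n n B) : (dualUnit X).1.det = 1 ↔ X.trace = 0 := by
  rw [det_dualUnit, add_eq_left]
  exact ⟨fun h => TrivSqZeroExt.inr_injective h, fun h => by rw [h, TrivSqZeroExt.inr_zero]⟩

theorem one_add_smul_mul_mul_one_add_smul {e : B} (he : e * e = 0) (P J Q : Matrix n n B) :
    (1 + e • P) * J * (1 + e • Q) = J + e • (P * J + J * Q) := by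
  simp only [Matrix.add_mul, Matrix.mul_add, Matrix.smul_mul, Matrix.mul_smul, smul_smul, he,
    zero_smul, Matrix.one_mul, Matrix.mul_one, smul_add, add_zero, add_assoc]

theorem dualUnit_mem_lorentzSO_iff {m : ℕ} (Y : Matrix (Fin (m + 1)) (Fin (m + 1)) B) :
    dualUnit Y ∈ lorentzSO m (DualNumber B) ↔
      Yᵀ * lorentzForm m B + lorentzForm m B * Y = 0 ∧ Y.trace = 0 := by
  rw [mem_lorentzSO_iff, det_dualUnit_eq_one_iff]
  refine and_congr_left fun _ => ?_
  change (oneAddDual Y)ᵀ * _ * oneAddDual Y = _ ↔ _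
  rw [← eps_smul_map_eq_zero_iff, ← lorentzForm_map m (TrivSqZeroExt.inlHom B B),
    oneAddDual_eq_smul, Matrix.map_add _ (map_add _)]
  rw [Matrix.transpose_add, Matrix.transpose_one, Matrix.transpose_smul]
  rw [one_add_smul_mul_mul_one_add_smul eps_mul_eps, add_eq_left, Matrix.map_mul, Matrix.map_mul,
    Matrix.transpose_map]

end Dual

/-- Take the conjugate transpose of the relation and multiply by J on both sides; J is real and
diagonal with J² = 1. -/
theorem conjTranspose_mem_lorentz {n : ℕ} {Y : Matrix (Fin (n + 1)) (Fin (n + 1)) ℂ}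
    (hY : Yᵀ * lorentzForm n ℂ + lorentzForm n ℂ * Y = 0) :
    Yᴴᵀ * lorentzForm n ℂ + lorentzForm n ℂ * Yᴴ = 0 := by
  have h1 := congrArg Matrix.conjTranspose hY
  rw [Matrix.conjTranspose_add, Matrix.conjTranspose_mul, Matrix.conjTranspose_mul,
    lorentzForm_conjTranspose, Matrix.conjTranspose_zero] at h1
  have h2 := congrArg (fun X => lorentzForm n ℂ * X * lorentzForm n ℂ) h1
  simp only [Matrix.mul_add, Matrix.add_mul, ← Matrix.mul_assoc, lorentzForm_mul_self,
    Matrix.one_mul, Matrix.mul_zero, Matrix.zero_mul] at h2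
  rw [Matrix.mul_assoc, Matrix.mul_assoc, lorentzForm_mul_self, Matrix.mul_one] at h2
  exact h2

/-- The one-parameter group `exp (t U)` as a matrix of bounded functions. -/
noncomputable def expBoundedDiff {n : Type*} [Fintype n] [DecidableEq n] {U : Matrix n n ℂ}
    (hU : Uᴴ = -U) : Matrix n n boundedDiffAlgebra :=
  Matrix.of fun i j => ⟨fun t => NormedSpace.exp (t • U) i j,
    ⟨1, fun t => entry_norm_bound_of_unitary (exp_mem_unitaryGroup hU t) i j⟩,
    (hasDerivAt_exp_entry U i j).differentiableAt⟩

theorem boundedDiffAlgebra_matrix_ext {m n : Type*} {X Y : Matrix m n boundedDiffAlgebra}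
    (h : ∀ t, X.map (boundedDiffEval t) = Y.map (boundedDiffEval t)) : X = Y := by
  ext i j t
  exact congrFun (congrFun (h t) i) j

theorem expBoundedDiff_map {n : Type*} [Fintype n] [DecidableEq n] {U : Matrix n n ℂ}
    (hU : Uᴴ = -U) (t : ℝ) :
    (expBoundedDiff hU).map (boundedDiffEval t) = NormedSpace.exp (t • U) := rfl

theorem det_expBoundedDiff {n : Type*} [Fintype n] [DecidableEq n] {U : Matrix n n ℂ}
    (hU : Uᴴ = -U) (htr : U.trace = 0) : (expBoundedDiff hU).det = 1 := by
  apply Subtype.ext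
  ext t
  have h1 := AlgHom.map_det (boundedDiffEval t) (expBoundedDiff hU)
  have h2 : (boundedDiffEval t).mapMatrix (expBoundedDiff hU) = NormedSpace.exp (t • U) := rfl
  rw [h2, det_exp_eq_one hU htr] at h1
  exact h1

theorem expBoundedDiff_lorentz {n : ℕ} {U : Matrix (Fin (n + 1)) (Fin (n + 1)) ℂ}
    (hU : Uᴴ = -U) (hJ : Uᵀ * lorentzForm n ℂ + lorentzForm n ℂ * U = 0) :
    (expBoundedDiff hU)ᵀ * lorentzForm n boundedDiffAlgebra * expBoundedDiff hU
      = lorentzForm n boundedDiffAlgebra := by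
  apply boundedDiffAlgebra_matrix_ext
  intro t
  have h1 := lorentzForm_map n (boundedDiffEval t : boundedDiffAlgebra →+* ℂ)
  have h2 : (lorentzForm n boundedDiffAlgebra).map (boundedDiffEval t) = lorentzForm n ℂ := h1
  rw [Matrix.map_mul, Matrix.map_mul, Matrix.transpose_map, expBoundedDiff_map, h2]
  exact exp_transpose_mul_mul (lorentzForm_mul_self n ℂ) hJ t

namespace ClosedSubgroupScheme

variable {R : Type} [CommRing R] {N : ℕ} {𝒢 : ClosedSubgroupScheme R N} {σ : R →+* ℝ}

theorem algebraMap_comp_ofReal (σ : R →+* ℝ) (B : Type) [CommRing B] [Algebra ℂ B] :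
    (algebraMap ℂ B).comp (Complex.ofRealHom.comp σ) = (algebraMap ℝ B).comp σ := by
  rw [← RingHom.comp_assoc]
  rfl

/-- A ℂ-algebra is in particular an ℝ-algebra, so the natural isomorphisms over ℝ restrict to
ℂ-algebras with `lorentzSO` itself as the model. -/
theorem IsRealFormSO.nonempty_complexForm {n : ℕ} (h : 𝒢.IsRealFormSO σ n) :
    Nonempty (ComplexForm 𝒢 (Complex.ofRealHom.comp σ)) := by
  obtain ⟨e, he⟩ := h
  refine ⟨{
    m := n + 1
    H := fun B _ _ => lorentzSO n B
    e := fun B _ _ =>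
      (MulEquiv.subgroupCongr (by rw [algebraMap_comp_ofReal])).trans (e B)
    natural := ?_
    lift := ?_
    star_mem := ?_
    exp_mem := ?_ }⟩
  · intro B C _ _ _ _ f g h hgh
    exact he B C (f.restrictScalars ℝ) _ _ hgh
  · intro B C _ _ _ _ f hs hf h hh
    refine exists_lift_lorentzSO (f := (f : B →+* C)) hs hf (c := algebraMap ℂ B (1 / 2)) ?_ hh
    rw [← map_ofNat (algebraMap ℂ B) 2, ← map_mul]
    norm_num
  · intro Y hY
    rw [dualUnit_mem_lorentzSO_iff] at *
    refine ⟨conjTranspose_mem_lorentz hY.1, ?_⟩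
    rw [Matrix.trace_conjTranspose, hY.2, star_zero]
  · intro U hU hU'
    obtain ⟨h1, h2⟩ := (dualUnit_mem_lorentzSO_iff U).1 hU'
    have hd := det_expBoundedDiff hU h2
    exact ⟨Matrix.GeneralLinearGroup.mk'' (expBoundedDiff hU) (by rw [hd]; exact isUnit_one),
      (mem_lorentzSO_iff _).2 ⟨expBoundedDiff_lorentz hU h1, hd⟩, fun t i j => rfl⟩

end ClosedSubgroupScheme

/-! ### Over ℂ-algebras SU(n,1) becomes SL_{n+1} -/

theorem mem_lorentzSU_iff {n : ℕ} {B : Type v} [CommRing B] (g : GL (Fin (n + 1)) (Complexified B)) :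
    g ∈ lorentzSU n B ↔ (g.1.map (starRingEnd (Complexified B)))ᵀ * lorentzForm n (Complexified B)
      * g.1 = lorentzForm n (Complexified B) ∧ g.1.det = 1 := Iff.rfl

section Complexified

variable {B : Type} [CommRing B] [Algebra ℂ B]

/-- The map `a + b i ↦ a + b u`, where `u ^ 2 = -1`. -/
def Complexified.eval {u : B} (hu : u * u = -1) : Complexified B →+* B where
  toFun z := z.re + u * z.im
  map_one' := by rw [QuadraticAlgebra.re_one, QuadraticAlgebra.im_one, mul_zero, add_zero]
  map_zero' := by simp
  map_mul' x y := by
    simp only [QuadraticAlgebra.re_mul, QuadraticAlgebra.im_mul]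
    linear_combination (-x.im * y.im) * hu
  map_add' x y := by simp; ring

theorem algebraMap_I_mul_self : algebraMap ℂ B Complex.I * algebraMap ℂ B Complex.I = -1 := by
  rw [← map_mul, Complex.I_mul_I, map_neg, map_one]

theorem neg_algebraMap_I_mul_self :
    (-algebraMap ℂ B Complex.I) * (-algebraMap ℂ B Complex.I) = -1 := by
  rw [neg_mul_neg, algebraMap_I_mul_self]

/-- The map `B ⊗ ℂ → B` induced by the structure of a `ℂ`-algebra on `B`. -/
def Complexified.evalI (B : Type) [CommRing B] [Algebra ℂ B] : Complexified B →+* B :=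
  Complexified.eval algebraMap_I_mul_self

/-- The conjugate of `Complexified.evalI`. -/
def Complexified.evalNegI (B : Type) [CommRing B] [Algebra ℂ B] : Complexified B →+* B :=
  Complexified.eval neg_algebraMap_I_mul_self

theorem Complexified.evalI_apply (z : Complexified B) :
    Complexified.evalI B z = z.re + algebraMap ℂ B Complex.I * z.im := rfl

theorem Complexified.evalNegI_apply (z : Complexified B) :
    Complexified.evalNegI B z = z.re + -algebraMap ℂ B Complex.I * z.im := rfl

theorem Complexified.evalI_star (z : Complexified B) :
    Complexified.evalI B (starRingEnd _ z) = Complexified.evalNegI B z := by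
  rw [evalI_apply, evalNegI_apply, starRingEnd_apply, QuadraticAlgebra.re_star,
    QuadraticAlgebra.im_star]
  ring

theorem Complexified.evalNegI_star (z : Complexified B) :
    Complexified.evalNegI B (starRingEnd _ z) = Complexified.evalI B z := by
  rw [evalI_apply, evalNegI_apply, starRingEnd_apply, QuadraticAlgebra.re_star,
    QuadraticAlgebra.im_star]
  ring

theorem algebraMap_half : 2 * algebraMap ℂ B (1 / 2) = 1 := by
  rw [← map_ofNat (algebraMap ℂ B) 2, ← map_mul]
  norm_num

/-- When B contains 1/2 and a square root of -1, the two evaluations identify B[i] with B × B, and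
conjugation exchanges the factors. This is the injective half; `Complexified.exists_eval` is the
surjective half. -/
theorem Complexified.ext_eval {z w : Complexified B}
    (h1 : Complexified.evalI B z = Complexified.evalI B w)
    (h2 : Complexified.evalNegI B z = Complexified.evalNegI B w) : z = w := by
  rw [evalI_apply, evalI_apply] at h1
  rw [evalNegI_apply, evalNegI_apply] at h2
  have hc := algebraMap_half (B := B)
  have hI := algebraMap_I_mul_self (B := B)
  set c := algebraMap ℂ B (1 / 2)
  set u := algebraMap ℂ B Complex.I
  apply QuadraticAlgebra.ext
  · linear_combination c * h1 + c * h2 + (w.re - z.re) * hc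
  · linear_combination (-(u * c)) * h1 + u * c * h2 + (2 * c * (z.im - w.im)) * hI
      + (w.im - z.im) * hc

theorem Complexified.exists_eval (a b : B) :
    ∃ z : Complexified B, Complexified.evalI B z = a ∧ Complexified.evalNegI B z = b := by
  have hc := algebraMap_half (B := B)
  have hI := algebraMap_I_mul_self (B := B)
  refine ⟨⟨algebraMap ℂ B (1 / 2) * (a + b),
    -(algebraMap ℂ B Complex.I * algebraMap ℂ B (1 / 2) * (a - b))⟩, ?_, ?_⟩
  · rw [evalI_apply]
    linear_combination a * hc - algebraMap ℂ B (1 / 2) * (a - b) * hI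
  · rw [evalNegI_apply]
    linear_combination b * hc + algebraMap ℂ B (1 / 2) * (a - b) * hI

theorem Complexified.evalI_map {C : Type} [CommRing C] [Algebra ℂ C] (f : B →ₐ[ℂ] C)
    (z : Complexified B) :
    Complexified.evalI C (Complexified.map (f : B →+* C) z) = f (Complexified.evalI B z) := by
  rw [evalI_apply, evalI_apply, map_add, map_mul, AlgHom.commutes]
  rfl

theorem Complexified.matrix_ext {m n : Type*} {X Y : Matrix m n (Complexified B)}
    (h1 : X.map (Complexified.evalI B) = Y.map (Complexified.evalI B))
    (h2 : X.map (Complexified.evalNegI B) = Y.map (Complexified.evalNegI B)) : X = Y := by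
  ext1 i j
  exact Complexified.ext_eval (congrFun (congrFun h1 i) j) (congrFun (congrFun h2 i) j)

theorem Complexified.map_star_map_evalI {m n : Type*} (X : Matrix m n (Complexified B)) :
    (X.map (starRingEnd _)).map (Complexified.evalI B) = X.map (Complexified.evalNegI B) := by
  ext i j
  exact Complexified.evalI_star _

theorem Complexified.map_star_map_evalNegI {m n : Type*} (X : Matrix m n (Complexified B)) :
    (X.map (starRingEnd _)).map (Complexified.evalNegI B) = X.map (Complexified.evalI B) := by
  ext i j
  exact Complexified.evalNegI_star _

/-- The map from `SU(n,1)(B)` to `SL_{n+1}(B)`, for a `ℂ`-algebra `B`. -/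
def lorentzSUToSL (n : ℕ) (B : Type) [CommRing B] [Algebra ℂ B] :
    lorentzSU n B →* specialLinearSubgroup (n + 1) B :=
  ((Matrix.GeneralLinearGroup.map (Complexified.evalI B)).comp (lorentzSU n B).subtype).codRestrict
    (specialLinearSubgroup (n + 1) B) (by
      intro g
      rw [mem_specialLinearSubgroup_iff]
      have h := RingHom.map_det (Complexified.evalI B) g.1.1
      rw [((mem_lorentzSU_iff _).1 g.2).2, map_one] at h
      exact h.symm)

theorem lorentzSUToSL_apply {n : ℕ} (g : lorentzSU n B) :
    (lorentzSUToSL n B g).1 = Matrix.GeneralLinearGroup.map (Complexified.evalI B) g.1 := rfl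

/-- Write g as a pair (a, b) under B[i] = B × B. The unitary condition becomes bᵀJa = J, which
determines b = (Ja⁻¹J)ᵀ, so a is free subject only to det a = 1. -/
theorem lorentzSUToSL_bijective (n : ℕ) : Function.Bijective (lorentzSUToSL n B) := by
  have hJJ := lorentzForm_mul_self n B
  have hJt := lorentzForm_transpose n B
  constructor
  · rw [injective_iff_map_eq_one]
    intro g hg
    have h1 : g.1.1.map (Complexified.evalI B) = 1 :=
      congrArg (fun h : specialLinearSubgroup (n + 1) B => h.1.1) hg
    have h2 := congrArg (fun X => X.map (Complexified.evalI B)) ((mem_lorentzSU_iff _).1 g.2).1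
    simp only [Matrix.map_mul, Matrix.transpose_map, Complexified.map_star_map_evalI,
      lorentzForm_map, h1, Matrix.mul_one] at h2
    have h3 := congrArg (fun X => (X * lorentzForm n B)ᵀ) h2
    simp only [Matrix.mul_assoc, hJJ, Matrix.mul_one, Matrix.transpose_transpose,
      Matrix.transpose_one] at h3
    apply Subtype.ext
    apply Units.ext
    apply Complexified.matrix_ext
    · rw [h1]
      exact (Matrix.map_one _ (map_zero _) (map_one _)).symm
    · rw [h3]
      exact (Matrix.map_one _ (map_zero _) (map_one _)).symm
  · intro h
    set J := lorentzForm n B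
    choose s hs1 hs2 using Complexified.exists_eval (B := B)
    set b : Matrix (Fin (n + 1)) (Fin (n + 1)) B := (J * h.1⁻¹.1 * J)ᵀ with hb
    have hdet := (mem_specialLinearSubgroup_iff h.1).1 h.2
    have hdet' := (mem_specialLinearSubgroup_iff h.1⁻¹).1 (inv_mem h.2)
    have hdb : b.det = 1 := by
      rw [hb, Matrix.det_transpose, Matrix.det_mul, Matrix.det_mul, hdet', mul_one,
        det_lorentzForm_mul_self]
    set G : Matrix (Fin (n + 1)) (Fin (n + 1)) (Complexified B) :=
      Matrix.of fun i j => s (h.1.1 i j) (b i j)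
    have hG1 : G.map (Complexified.evalI B) = h.1.1 := by ext i j; exact hs1 _ _
    have hG2 : G.map (Complexified.evalNegI B) = b := by ext i j; exact hs2 _ _
    have hGd : G.det = 1 := by
      apply Complexified.ext_eval
      · rw [RingHom.map_det, RingHom.mapMatrix_apply, hG1, hdet, map_one]
      · rw [RingHom.map_det, RingHom.mapMatrix_apply, hG2, hdb, map_one]
    have hinv : h.1⁻¹.1 * h.1.1 = 1 := Units.inv_mul _
    have hinv' : h.1.1 * h.1⁻¹.1 = 1 := Units.mul_inv _
    have key : bᵀ * J * h.1.1 = J := by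
      rw [hb, Matrix.transpose_transpose]
      simp only [Matrix.mul_assoc]
      rw [← Matrix.mul_assoc J J, hJJ, Matrix.one_mul, hinv, Matrix.mul_one]
    have hGJ : (G.map (starRingEnd (Complexified B)))ᵀ * lorentzForm n (Complexified B) * G
        = lorentzForm n (Complexified B) := by
      apply Complexified.matrix_ext
      · simp only [Matrix.map_mul, Matrix.transpose_map, Complexified.map_star_map_evalI,
          lorentzForm_map, hG1, hG2]
        exact key
      · simp only [Matrix.map_mul, Matrix.transpose_map, Complexified.map_star_map_evalNegI,
          lorentzForm_map, hG1, hG2]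
        have := congrArg Matrix.transpose key
        rw [Matrix.transpose_mul, Matrix.transpose_mul, Matrix.transpose_transpose, hJt,
          ← Matrix.mul_assoc] at this
        exact this
    exact ⟨⟨Matrix.GeneralLinearGroup.mk'' G (by rw [hGd]; exact isUnit_one),
      (mem_lorentzSU_iff _).2 ⟨hGJ, hGd⟩⟩, Subtype.ext (Units.ext hG1)⟩

end Complexified

namespace ClosedSubgroupScheme

variable {R : Type} [CommRing R] {N : ℕ} {𝒢 : ClosedSubgroupScheme R N} {σ : R →+* ℝ}

theorem IsRealFormSU.nonempty_complexForm {n : ℕ} (h : 𝒢.IsRealFormSU σ n) :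
    Nonempty (ComplexForm 𝒢 (Complex.ofRealHom.comp σ)) := by
  obtain ⟨e, he⟩ := h
  refine ⟨{
    m := n + 1
    H := fun B _ _ => specialLinearSubgroup (n + 1) B
    e := fun B _ _ =>
      ((MulEquiv.subgroupCongr (by rw [algebraMap_comp_ofReal])).trans (e B)).trans
        (MulEquiv.ofBijective _ (lorentzSUToSL_bijective n))
    natural := ?_
    lift := ?_
    star_mem := ?_
    exp_mem := ?_ }⟩
  · intro B C _ _ _ _ f g h hgh
    have h1 := he B C (f.restrictScalars ℝ)
      (MulEquiv.subgroupCongr (by rw [algebraMap_comp_ofReal]) g)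
      (MulEquiv.subgroupCongr (by rw [algebraMap_comp_ofReal]) h) hgh
    simp only [MulEquiv.trans_apply, MulEquiv.ofBijective_apply, lorentzSUToSL_apply, h1]
    apply generalLinearGroup_ext
    intro i j
    exact Complexified.evalI_map f _
  · intro B C _ _ _ _ f hs hf h hh
    exact exists_lift_specialLinearSubgroup (f := (f : B →+* C)) hs hf hh
  · intro Y hY
    rw [mem_specialLinearSubgroup_iff, det_dualUnit_eq_one_iff] at *
    rw [Matrix.trace_conjTranspose, hY, star_zero]
  · intro U hU hU'
    rw [mem_specialLinearSubgroup_iff, det_dualUnit_eq_one_iff] at hU'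
    have hd := det_expBoundedDiff hU hU'
    exact ⟨Matrix.GeneralLinearGroup.mk'' (expBoundedDiff hU) (by rw [hd]; exact isUnit_one),
      (mem_specialLinearSubgroup_iff _).2 hd, fun t i j => rfl⟩

end ClosedSubgroupScheme

/-! ### Descent of ideal membership and of Jacobian relations from ℂ to a domain -/

section Descent

variable {R : Type} [CommRing R]

/-- A linear retraction of a field extension, over the fraction field of a domain. -/
theorem exists_additive_retraction [IsDomain R] {σ : R →+* ℂ} (hσ : Function.Injective σ) :
    ∃ l : ℂ →+ FractionRing R, l 1 = 1 ∧
      ∀ r z, l (σ r * z) = algebraMap R (FractionRing R) r * l z := by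
  let τ : FractionRing R →+* ℂ := IsFractionRing.lift hσ
  let _ : Algebra (FractionRing R) ℂ := τ.toAlgebra
  obtain ⟨l, hl⟩ := LinearMap.exists_leftInverse_of_injective
    (Algebra.linearMap (FractionRing R) ℂ) (LinearMap.ker_eq_bot.2 τ.injective)
  refine ⟨l.toAddMonoidHom, ?_, fun r z => ?_⟩
  · have := LinearMap.congr_fun hl 1
    simpa using this
  · have h1 : σ r * z = (algebraMap R (FractionRing R) r) • z := by
      rw [Algebra.smul_def]
      congr 1
      exact (IsFractionRing.lift_algebraMap hσ r).symm
    rw [h1]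
    exact l.map_smul _ _

/-- Meant for a retraction l of ℂ onto the fraction field. Such an l is not multiplicative, but it
carries down relations that are linear over the base ring. -/
theorem exists_coeffwise {ι A B : Type*} [CommRing A] [CommRing B] (l : A →+ B) :
    ∃ L : MvPolynomial ι A →+ MvPolynomial ι B, ∀ m p, (L p).coeff m = l (p.coeff m) := by
  classical
  have hc : ∀ (p : MvPolynomial ι A) (m : ι →₀ ℕ),
      (∑ k ∈ p.support, MvPolynomial.monomial k (l (p.coeff k))).coeff m = l (p.coeff m) := by
    intro p m
    rw [MvPolynomial.coeff_sum]
    simp only [MvPolynomial.coeff_monomial]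
    rw [Finset.sum_ite_eq' p.support m]
    split_ifs with h
    · rfl
    · rw [MvPolynomial.notMem_support_iff.1 h, map_zero]
  refine ⟨AddMonoidHom.mk' (fun p => ∑ k ∈ p.support, MvPolynomial.monomial k (l (p.coeff k)))
    fun p q => ?_, fun m p => hc p m⟩
  ext m
  rw [MvPolynomial.coeff_add, hc, hc, hc, MvPolynomial.coeff_add, map_add]

theorem map_mul_of_coeffwise {ι A B : Type*} [CommRing A] [CommRing B] {σ : R →+* A} {τ : R →+* B}
    {l : A →+ B} (hl : ∀ r z, l (σ r * z) = τ r * l z)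
    {L : MvPolynomial ι A →+ MvPolynomial ι B} (hL : ∀ m p, (L p).coeff m = l (p.coeff m))
    (p : MvPolynomial ι R) (q : MvPolynomial ι A) :
    L (MvPolynomial.map σ p * q) = MvPolynomial.map τ p * L q := by
  classical
  ext m
  rw [hL, MvPolynomial.coeff_mul, MvPolynomial.coeff_mul, map_sum]
  refine Finset.sum_congr rfl fun x _ => ?_
  rw [MvPolynomial.coeff_map, MvPolynomial.coeff_map, hl, hL]

/-- If z = ∑ aᵢ σ(pᵢ) with pᵢ in J, then L z = ∑ τ(pᵢ) L(aᵢ). The induction runs over all multiples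
of z because L is only additive. -/
theorem mem_map_of_coeffwise {ι A B : Type*} [CommRing A] [CommRing B] {σ : R →+* A} {τ : R →+* B}
    {l : A →+ B} (hl : ∀ r z, l (σ r * z) = τ r * l z)
    {L : MvPolynomial ι A →+ MvPolynomial ι B} (hL : ∀ m p, (L p).coeff m = l (p.coeff m))
    {J : Ideal (MvPolynomial ι R)} {z : MvPolynomial ι A}
    (hz : z ∈ J.map (MvPolynomial.map σ)) : L z ∈ J.map (MvPolynomial.map τ) := by
  have key : ∀ a : MvPolynomial ι A, L (a * z) ∈ J.map (MvPolynomial.map τ) := by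
    refine Submodule.span_induction (p := fun z _ => ∀ a, L (a * z) ∈ J.map (MvPolynomial.map τ))
      ?_ ?_ ?_ ?_ hz
    · rintro _ ⟨p, hp, rfl⟩ a
      rw [mul_comm, map_mul_of_coeffwise hl hL]
      exact Ideal.mul_mem_right _ _ (Ideal.mem_map_of_mem _ hp)
    · intro a
      rw [mul_zero, map_zero]
      exact zero_mem _
    · intro x y _ _ hx hy a
      rw [mul_add, map_add]
      exact add_mem (hx a) (hy a)
    · intro b x _ hx a
      rw [smul_eq_mul, ← mul_assoc]
      exact hx _
  simpa using key 1

/-- Membership in an ideal extended to the fraction field, after clearing denominators. -/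
theorem exists_smul_mem_of_mem_map [IsDomain R] {ι : Type*} {J : Ideal (MvPolynomial ι R)}
    {z : MvPolynomial ι (FractionRing R)}
    (hz : z ∈ J.map (MvPolynomial.map (algebraMap R (FractionRing R)))) :
    ∃ b : R, b ≠ 0 ∧ ∃ y ∈ J, MvPolynomial.map (algebraMap R (FractionRing R)) y
      = MvPolynomial.C (algebraMap R (FractionRing R) b) * z := by
  let _ : Algebra (MvPolynomial ι R) (MvPolynomial ι (FractionRing R)) :=
    MvPolynomial.algebraMvPolynomial
  have := (IsLocalization.mem_map_algebraMap_iff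
    ((nonZeroDivisors R).map (MvPolynomial.C (σ := ι))) (MvPolynomial ι (FractionRing R))
    (I := J) (z := z)).1 hz
  obtain ⟨⟨⟨y, hy⟩, ⟨_, b, hb, rfl⟩⟩, h⟩ := this
  refine ⟨b, nonZeroDivisors.ne_zero hb, y, hy, ?_⟩
  have h2 : z * MvPolynomial.map (algebraMap R (FractionRing R)) (MvPolynomial.C b)
      = MvPolynomial.map (algebraMap R (FractionRing R)) y := h
  rw [← h2, MvPolynomial.map_C, mul_comm]

/-- If the affine scheme defined by `S` is formally smooth over `ℂ` then, after inverting one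
nonzero element of the domain `R`, it satisfies a Jacobian condition that lifts points. -/
theorem exists_jacobian_relation [IsDomain R] {σ : R →+* ℂ} (hσ : Function.Injective σ)
    {ι : Type} [Fintype ι] (S : Finset (MvPolynomial ι R)) (y : ι → MvPolynomial ι ℂ)
    (hy : ∀ v, y v - MvPolynomial.X v ∈ (Ideal.span (S : Set _)).map (MvPolynomial.map σ))
    (hy' : ∀ p ∈ S, p.eval₂ (MvPolynomial.C.comp σ) y
      ∈ ((Ideal.span (S : Set _)) ^ 2).map (MvPolynomial.map σ)) :
    ∃ f : R, f ≠ 0 ∧ ∃ δ : ι → MvPolynomial ι R, (∀ v, δ v ∈ Ideal.span (S : Set _)) ∧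
      ∀ p ∈ S, MvPolynomial.C f * p + ∑ v, MvPolynomial.pderiv v p * δ v
        ∈ (Ideal.span (S : Set _)) ^ 2 := by
  set I := Ideal.span (S : Set (MvPolynomial ι R)) with hI
  set K := FractionRing R
  obtain ⟨l, hl1, hl⟩ := exists_additive_retraction hσ
  obtain ⟨L, hL⟩ := exists_coeffwise (ι := ι) l
  have hLmap : ∀ p, L (MvPolynomial.map σ p) = MvPolynomial.map (algebraMap R K) p := by
    intro p
    ext m
    have := hl (p.coeff m) 1
    rw [mul_one, hl1, mul_one] at this
    rw [hL, MvPolynomial.coeff_map, MvPolynomial.coeff_map, this]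
  -- the linearised relation over `ℂ`
  have h1 : ∀ p ∈ S, MvPolynomial.map σ p
      + ∑ v, MvPolynomial.map σ (MvPolynomial.pderiv v p) * (y v - MvPolynomial.X v)
      ∈ (I ^ 2).map (MvPolynomial.map σ) := by
    intro p hp
    set Q := (I ^ 2).map (MvPolynomial.map σ)
    have hmk : ∀ (p : MvPolynomial ι R) (x : ι → MvPolynomial ι ℂ),
        Ideal.Quotient.mk Q (p.eval₂ (MvPolynomial.C.comp σ) x)
          = p.eval₂ ((Ideal.Quotient.mk Q).comp (MvPolynomial.C.comp σ))
            (fun v => Ideal.Quotient.mk Q (x v)) := fun p x => MvPolynomial.hom_eval₂ _ _ _ _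
    have hX : ∀ p : MvPolynomial ι R, p.eval₂ (MvPolynomial.C.comp σ) MvPolynomial.X
        = MvPolynomial.map σ p := fun p => by
      rw [← MvPolynomial.eval₂_map, MvPolynomial.eval₂_eta]
    -- Modulo the extension of I² the displacements y - X have vanishing products, so evaluation at
    -- y agrees with its first-order expansion at X.
    have h2 := MvPolynomial.eval₂_add_of_mul_eq_zero
      ((Ideal.Quotient.mk Q).comp (MvPolynomial.C.comp σ))
      (fun v => Ideal.Quotient.mk Q (MvPolynomial.X v))
      (fun v => Ideal.Quotient.mk Q (y v - MvPolynomial.X v)) (fun v w => by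
        rw [← map_mul, Ideal.Quotient.eq_zero_iff_mem]
        change _ ∈ (I ^ 2).map (MvPolynomial.map σ)
        rw [pow_two, Ideal.map_mul]
        exact Ideal.mul_mem_mul (hy v) (hy w)) p
    simp only [← map_add, add_sub_cancel, ← hmk, hX, ← map_mul, ← map_sum] at h2
    rw [Ideal.Quotient.eq_zero_iff_mem.2 (hy' p hp)] at h2
    exact Ideal.Quotient.eq_zero_iff_mem.1 h2.symm
  -- descent to the fraction field
  set d : ι → MvPolynomial ι K := fun v => L (y v - MvPolynomial.X v) with hd
  have h2 : ∀ v, d v ∈ I.map (MvPolynomial.map (algebraMap R K)) := fun v =>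
    mem_map_of_coeffwise hl hL (hy v)
  have h3 : ∀ p ∈ S, MvPolynomial.map (algebraMap R K) p
      + ∑ v, MvPolynomial.map (algebraMap R K) (MvPolynomial.pderiv v p) * d v
      ∈ (I ^ 2).map (MvPolynomial.map (algebraMap R K)) := by
    intro p hp
    have := mem_map_of_coeffwise hl hL (h1 p hp)
    rw [map_add, map_sum, hLmap] at this
    simpa only [map_mul_of_coeffwise hl hL] using this
  -- clearing denominators
  choose b hb e heI he using fun v => exists_smul_mem_of_mem_map (h2 v)
  classical
  set c := ∏ v, b v with hc
  have hc0 : c ≠ 0 := Finset.prod_ne_zero_iff.2 fun v _ => hb v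
  -- Each entry is scaled by the denominators of the other entries, so that all acquire the same
  -- factor c.
  set e' : ι → MvPolynomial ι R := fun v => MvPolynomial.C (∏ w ∈ Finset.univ.erase v, b w) * e v
    with he'
  have he'I : ∀ v, e' v ∈ I := fun v => Ideal.mul_mem_left _ _ (heI v)
  have he'map : ∀ v, MvPolynomial.map (algebraMap R K) (e' v)
      = MvPolynomial.C (algebraMap R K c) * d v := by
    intro v
    rw [he', map_mul, MvPolynomial.map_C, he, ← mul_assoc, ← map_mul, ← map_mul, hc,
      Finset.prod_erase_mul _ _ (Finset.mem_univ v)]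
  have h4 : ∀ p ∈ S, ∃ t : R, t ≠ 0 ∧ MvPolynomial.C t * (MvPolynomial.C c * p
      + ∑ v, MvPolynomial.pderiv v p * e' v) ∈ I ^ 2 := by
    intro p hp
    obtain ⟨t, ht, z, hz, hzt⟩ := exists_smul_mem_of_mem_map (h3 p hp)
    refine ⟨t, ht, ?_⟩
    have : MvPolynomial.C t * (MvPolynomial.C c * p + ∑ v, MvPolynomial.pderiv v p * e' v)
        = MvPolynomial.C c * z := by
      apply MvPolynomial.map_injective _ (IsFractionRing.injective R K)
      rw [map_mul, map_mul, hzt, map_add, map_mul, map_sum]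
      simp only [map_mul, he'map, MvPolynomial.map_C]
      rw [mul_left_comm, mul_add (MvPolynomial.C (algebraMap R K c)), Finset.mul_sum]
      congr 2
      exact Finset.sum_congr rfl fun v _ => by ring
    rw [this]
    exact Ideal.mul_mem_left _ _ hz
  choose! t ht htI using h4
  refine ⟨(∏ p ∈ S, t p) * c, mul_ne_zero (Finset.prod_ne_zero_iff.2 ht) hc0,
    fun v => MvPolynomial.C (∏ p ∈ S, t p) * e' v, fun v => Ideal.mul_mem_left _ _ (he'I v), ?_⟩
  intro p hp
  have : MvPolynomial.C ((∏ p ∈ S, t p) * c) * p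
      + ∑ v, MvPolynomial.pderiv v p * (MvPolynomial.C (∏ p ∈ S, t p) * e' v)
      = MvPolynomial.C (∏ q ∈ S.erase p, t q) * (MvPolynomial.C (t p)
        * (MvPolynomial.C c * p + ∑ v, MvPolynomial.pderiv v p * e' v)) := by
    rw [← mul_assoc (MvPolynomial.C (∏ q ∈ S.erase p, t q)), ← map_mul,
      Finset.prod_erase_mul _ _ hp, mul_add, Finset.mul_sum, map_mul, mul_assoc]
    congr 1
    exact Finset.sum_congr rfl fun v _ => by ring
  rw [this]
  exact Ideal.mul_mem_left _ _ (htI p hp)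

/-- Lifting of points along square-zero extensions from a Jacobian relation. -/
theorem exists_lift_of_jacobian_relation {ι : Type} [Fintype ι] {S : Set (MvPolynomial ι R)}
    {f : R} {δ : ι → MvPolynomial ι R} (hδ : ∀ v, δ v ∈ Ideal.span S)
    (hS : ∀ p ∈ S, MvPolynomial.C f * p + ∑ v, MvPolynomial.pderiv v p * δ v ∈ Ideal.span S ^ 2)
    {A A' : Type*} [CommRing A] [CommRing A'] {q : A →+* A'} (hq : Function.Surjective q)
    (hq' : ∀ x y, q x = 0 → q y = 0 → x * y = 0) {φ : R →+* A} (hf : IsUnit (φ f)) {x : ι → A'}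
    (hx : ∀ p ∈ S, p.eval₂ (q.comp φ) x = 0) :
    ∃ x' : ι → A, (∀ v, q (x' v) = x v) ∧ ∀ p ∈ S, p.eval₂ φ x' = 0 := by
  choose z hz using fun v => hq (x v)
  obtain ⟨u, hu⟩ := hf.exists_right_inv
  have hI : ∀ p ∈ Ideal.span S, q (p.eval₂ φ z) = 0 := by
    have h1 : Ideal.span S ≤ RingHom.ker (q.comp (MvPolynomial.eval₂Hom φ z)) := by
      rw [Ideal.span_le]
      intro p hp
      have h2 := hx p hp
      have h3 := MvPolynomial.hom_eval₂ p φ q z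
      have h4 : (fun v => q (z v)) = x := funext hz
      rw [h4, h2] at h3
      exact h3
    exact fun p hp => h1 hp
  have hI2 : ∀ p ∈ Ideal.span S ^ 2, p.eval₂ φ z = 0 := by
    have h1 : Ideal.span S ^ 2 ≤ RingHom.ker (MvPolynomial.eval₂Hom φ z) := by
      rw [pow_two, Ideal.mul_le]
      intro a ha b hb
      rw [RingHom.mem_ker, map_mul]
      exact hq' _ _ (hI a ha) (hI b hb)
    exact fun p hp => h1 hp
  -- Newton correction of an arbitrary lift z, with u inverse to f: p(z + uδ(z)) = u (f p + ∑ ∂ᵥp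
  -- δᵥ)(z). The bracket lies in the square of the ideal, which vanishes at z.
  refine ⟨fun v => z v + u * (δ v).eval₂ φ z, fun v => ?_, fun p hp => ?_⟩
  · rw [map_add, map_mul, hI _ (hδ v), mul_zero, add_zero, hz]
  · rw [MvPolynomial.eval₂_add_of_mul_eq_zero φ z (fun v => u * (δ v).eval₂ φ z)
      (fun i j => by
        rw [mul_mul_mul_comm, hq' _ _ (hI _ (hδ i)) (hI _ (hδ j)), mul_zero])]
    have h1 := hI2 _ (hS p hp)
    rw [MvPolynomial.eval₂_add, MvPolynomial.eval₂_mul, MvPolynomial.eval₂_C,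
      MvPolynomial.eval₂_sum] at h1
    simp only [MvPolynomial.eval₂_mul] at h1
    have h2 : ∑ v, (MvPolynomial.pderiv v p).eval₂ φ z * (u * (δ v).eval₂ φ z)
        = u * ∑ v, (MvPolynomial.pderiv v p).eval₂ φ z * (δ v).eval₂ φ z := by
      rw [Finset.mul_sum]
      exact Finset.sum_congr rfl fun v _ => by ring
    rw [h2]
    linear_combination u * h1 - p.eval₂ φ z * hu

end Descent

/-! ### Smoothness after inverting one element -/

namespace ClosedSubgroupScheme

variable {R : Type} [CommRing R] {N : ℕ} (𝒢 : ClosedSubgroupScheme R N)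

/-- Finitely many equations suffice. -/
theorem exists_finset_eqs [IsNoetherianRing R] :
    ∃ s : Finset (MvPolynomial (Fin N × Fin N) R), (s : Set _) ⊆ 𝒢.eqs ∧
      ∀ (B : Type) [CommRing B] (φ : R →+* B) (x : Fin N × Fin N → B),
        (∀ p ∈ s, p.eval₂ φ x = 0) → ∀ p ∈ 𝒢.eqs, p.eval₂ φ x = 0 := by
  obtain ⟨s, hs, hspan⟩ := (Submodule.fg_span_iff_fg_span_finset_subset
    (R := MvPolynomial (Fin N × Fin N) R) 𝒢.eqs).1 (IsNoetherian.noetherian _)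
  refine ⟨s, hs, fun B _ φ x hx p hp => ?_⟩
  have h1 : Ideal.span (s : Set (MvPolynomial (Fin N × Fin N) R))
      ≤ RingHom.ker (MvPolynomial.eval₂Hom φ x) := Ideal.span_le.2 hx
  have h2 : p ∈ Submodule.span (MvPolynomial (Fin N × Fin N) R) 𝒢.eqs := Submodule.subset_span hp
  rw [hspan] at h2
  exact h1 h2

end ClosedSubgroupScheme

section Smooth

variable {R : Type} [CommRing R] {N : ℕ}

/-- The generic matrix in the variables indexed by `some`. -/
noncomputable def genericMatrix (R : Type) [CommRing R] (N : ℕ) :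
    Matrix (Fin N) (Fin N) (MvPolynomial (Option (Fin N × Fin N)) R) :=
  Matrix.of fun i j => MvPolynomial.X (some (i, j))

/-- The equation `z det = 1`. -/
noncomputable def detEquation (R : Type) [CommRing R] (N : ℕ) :
    MvPolynomial (Option (Fin N × Fin N)) R :=
  MvPolynomial.X none * (genericMatrix R N).det - 1

theorem eval₂_detEquation {B : Type*} [CommRing B] (φ : R →+* B)
    (x : Option (Fin N × Fin N) → B) :
    (detEquation R N).eval₂ φ x = x none * (Matrix.of fun i j => x (some (i, j))).det - 1 := by
  have h1 : (genericMatrix R N).det.eval₂ φ x = (Matrix.of fun i j => x (some (i, j))).det := by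
    have := RingHom.map_det (MvPolynomial.eval₂Hom φ x) (genericMatrix R N)
    rw [MvPolynomial.coe_eval₂Hom] at this
    rw [this]
    congr 1
    ext i j
    simp [genericMatrix]
  rw [detEquation, MvPolynomial.eval₂_sub, MvPolynomial.eval₂_mul, MvPolynomial.eval₂_X, h1,
    MvPolynomial.eval₂_one]

variable {𝒢 : ClosedSubgroupScheme R N} {σ : R →+* ℂ}

/-- Smoothness of the scheme after inverting one nonzero element. -/
theorem ComplexForm.exists_smooth [IsDomain R] [IsNoetherianRing R] (E : ComplexForm 𝒢 σ)
    (hσ : Function.Injective σ) :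
    ∃ f : R, f ≠ 0 ∧ ∀ (A A' : Type) [CommRing A] [CommRing A'] (q : A →+* A') (φ : R →+* A),
      Function.Surjective q → (∀ x y, q x = 0 → q y = 0 → x * y = 0) → IsUnit (φ f) →
      ∀ g ∈ 𝒢.points (q.comp φ), ∃ g' ∈ 𝒢.points φ, Matrix.GeneralLinearGroup.map q g' = g := by
  classical
  obtain ⟨s, hs, hs'⟩ := 𝒢.exists_finset_eqs
  set ι := Option (Fin N × Fin N)
  -- The extra variable `none` stands for 1/det, so that points of 𝒢 become the zeros of finitely
  -- many polynomials in an affine space.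
  set S : Finset (MvPolynomial ι R) :=
    insert (detEquation R N) (s.image (MvPolynomial.rename some)) with hS
  set I := Ideal.span (S : Set (MvPolynomial ι R))
  set Q := I.map (MvPolynomial.map σ)
  have hQ2 : (I ^ 2).map (MvPolynomial.map σ) = Q ^ 2 := Ideal.map_pow _ _ _
  have hSI : ∀ p ∈ S, MvPolynomial.map σ p ∈ Q := fun p hp =>
    Ideal.mem_map_of_mem _ (Ideal.subset_span hp)
  have hzero : ∀ (B : Type) [CommRing B] (φ : R →+* B) (x : ι → B),
      (∀ p ∈ S, p.eval₂ φ x = 0) ↔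
        (x none * (Matrix.of fun i j => x (some (i, j))).det = 1 ∧
          ∀ p ∈ 𝒢.eqs, p.eval₂ φ (fun ij => x (some ij)) = 0) := by
    intro B _ φ x
    have hren : ∀ p : MvPolynomial (Fin N × Fin N) R,
        (MvPolynomial.rename some p).eval₂ φ x = p.eval₂ φ (fun ij => x (some ij)) :=
      fun p => MvPolynomial.eval₂_rename _ _ _ _
    constructor
    · intro h
      refine ⟨?_, hs' B φ _ fun p hp => ?_⟩
      · have h1 := h _ (Finset.mem_insert_self _ _)
        rw [eval₂_detEquation, sub_eq_zero] at h1
        exact h1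
      · rw [← hren]
        exact h _ (Finset.mem_insert_of_mem (Finset.mem_image_of_mem _ hp))
    · rintro ⟨h1, h2⟩ p hp
      rcases Finset.mem_insert.1 hp with rfl | hp
      · rw [eval₂_detEquation, h1, sub_self]
      · obtain ⟨p', hp', rfl⟩ := Finset.mem_image.1 hp
        rw [hren]
        exact h2 p' (hs hp')
  -- the universal lifting problem over `ℂ`
  have huniv : ∃ y : ι → MvPolynomial ι ℂ, (∀ v, y v - MvPolynomial.X v ∈ Q) ∧
      ∀ p ∈ S, p.eval₂ (MvPolynomial.C.comp σ) y ∈ Q ^ 2 := by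
    have hmk : ∀ (J : Ideal (MvPolynomial ι ℂ)) (p : MvPolynomial ι R) (x : ι → MvPolynomial ι ℂ),
        Ideal.Quotient.mk J (p.eval₂ (MvPolynomial.C.comp σ) x)
          = p.eval₂ ((algebraMap ℂ (MvPolynomial ι ℂ ⧸ J)).comp σ)
            (fun v => Ideal.Quotient.mk J (x v)) := fun J p x => MvPolynomial.hom_eval₂ _ _ _ _
    have hx : ∀ p ∈ S, p.eval₂ ((algebraMap ℂ (MvPolynomial ι ℂ ⧸ Q)).comp σ)
        (fun v => Ideal.Quotient.mk Q (MvPolynomial.X v)) = 0 := by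
      intro p hp
      rw [← hmk, ← MvPolynomial.eval₂_map, MvPolynomial.eval₂_eta]
      exact Ideal.Quotient.eq_zero_iff_mem.2 (hSI p hp)
    obtain ⟨hx1, hx2⟩ := (hzero _ _ _).1 hx
    -- This is the tautological point over the coordinate ring ℂ[x]/Q. The coordinates of a lift to
    -- ℂ[x]/Q² provide y.
    set M : Matrix (Fin N) (Fin N) (MvPolynomial ι ℂ ⧸ Q) :=
      Matrix.of fun i j => Ideal.Quotient.mk Q (MvPolynomial.X (some (i, j)))
    let g : 𝒢.points ((algebraMap ℂ (MvPolynomial ι ℂ ⧸ Q)).comp σ) :=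
      ⟨Matrix.GeneralLinearGroup.mk'' M (IsUnit.of_mul_eq_one_right _ hx1), hx2⟩
    have hle : Q ^ 2 ≤ Q := Ideal.pow_le_self two_ne_zero
    obtain ⟨g', hg'⟩ := E.exists_lift (Ideal.Quotient.factorₐ ℂ hle)
      (Ideal.Quotient.factor_surjective hle) (by
        intro x y hx hy
        obtain ⟨x, rfl⟩ := Ideal.Quotient.mk_surjective x
        obtain ⟨y, rfl⟩ := Ideal.Quotient.mk_surjective y
        have hx' : x ∈ Q := Ideal.Quotient.eq_zero_iff_mem.1 hx
        have hy' : y ∈ Q := Ideal.Quotient.eq_zero_iff_mem.1 hy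
        rw [← map_mul, Ideal.Quotient.eq_zero_iff_mem, pow_two]
        exact Ideal.mul_mem_mul hx' hy') g
    have hgg : ∀ i j, Ideal.Quotient.factor hle (g'.1.1 i j)
        = Ideal.Quotient.mk Q (MvPolynomial.X (some (i, j))) := fun i j =>
      congrArg (fun h : 𝒢.points ((algebraMap ℂ (MvPolynomial ι ℂ ⧸ Q)).comp σ) => h.1.1 i j) hg'
    choose z hz using fun i j => Ideal.Quotient.mk_surjective (g'.1.1 i j)
    obtain ⟨w, hw⟩ := Ideal.Quotient.mk_surjective (g'.1⁻¹.1.det)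
    have hdet : g'.1⁻¹.1.det * g'.1.1.det = 1 := by
      rw [← Matrix.det_mul, Units.inv_mul, Matrix.det_one]
    have hfac : ∀ x, Ideal.Quotient.factor hle (Ideal.Quotient.mk (Q ^ 2) x)
        = Ideal.Quotient.mk Q x := fun x => rfl
    refine ⟨fun v => v.elim w fun ij => z ij.1 ij.2, ?_, fun p hp => ?_⟩
    · intro v
      rw [← Ideal.Quotient.eq_zero_iff_mem, map_sub, sub_eq_zero]
      rcases v with _ | ⟨i, j⟩
      · change Ideal.Quotient.mk Q w = _
        have h1 := congrArg (Ideal.Quotient.factor hle) hdet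
        have h2 : (g'.1.1.map (Ideal.Quotient.factor hle)) = M := by
          ext i j
          exact hgg i j
        rw [map_mul, RingHom.map_det _ g'.1.1, RingHom.mapMatrix_apply, h2, map_one, ← hw,
          hfac] at h1
        have h3 : M.det * Ideal.Quotient.mk Q (MvPolynomial.X none) = 1 := by
          rw [mul_comm]
          exact hx1
        exact left_inv_eq_right_inv h1 h3
      · change Ideal.Quotient.mk Q (z i j) = _
        rw [← hfac, hz, hgg]
    · rw [← Ideal.Quotient.eq_zero_iff_mem, hmk]
      revert p
      rw [hzero]
      have hM : (Matrix.of fun i j => Ideal.Quotient.mk (Q ^ 2) (z i j)) = g'.1.1 := by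
        ext i j
        exact hz i j
      refine ⟨?_, ?_⟩
      · change Ideal.Quotient.mk (Q ^ 2) w
          * (Matrix.of fun i j => Ideal.Quotient.mk (Q ^ 2) (z i j)).det = 1
        rw [hM, hw, hdet]
      · have h1 := g'.2
        rw [𝒢.mem_points_iff] at h1
        simp only [← hz] at h1
        exact h1
  obtain ⟨y, hy, hy'⟩ := huniv
  obtain ⟨f, hf, δ, hδ, hrel⟩ := exists_jacobian_relation hσ S y hy (by rwa [hQ2])
  refine ⟨f, hf, fun A A' _ _ q φ hq hq' hfu g hg => ?_⟩
  obtain ⟨x', hx', hx''⟩ := exists_lift_of_jacobian_relation hδ hrel hq hq' hfu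
    (x := fun v => v.elim g⁻¹.1.det fun ij => g.1 ij.1 ij.2) ((hzero A' (q.comp φ) _).2 ⟨by
      change g⁻¹.1.det * g.1.det = 1
      rw [← Matrix.det_mul, Units.inv_mul, Matrix.det_one], hg⟩)
  obtain ⟨h1, h2⟩ := (hzero A φ x').1 hx''
  refine ⟨Matrix.GeneralLinearGroup.mk'' (Matrix.of fun i j => x' (some (i, j)))
    (IsUnit.of_mul_eq_one_right _ h1), h2, ?_⟩
  exact generalLinearGroup_ext fun i j => hx' (some (i, j))

end Smooth

/-! ### The self-adjoint projection onto the Lie algebra -/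

/-- The projection onto a subspace of matrices on which the trace form is nondegenerate, along its
orthogonal complement. -/
theorem exists_trace_projector {k n : Type*} [Field k] [Fintype n] [DecidableEq n]
    (W : Submodule k (Matrix n n k))
    (hW : ∀ X ∈ W, (∀ Z ∈ W, (X * Z).trace = 0) → X = 0) :
    ∃ T : Matrix n n k →ₗ[k] Matrix n n k, (∀ A, T A ∈ W) ∧ (∀ X ∈ W, T X = X) ∧
      ∀ A C, (T A * C).trace = (A * T C).trace := by
  let b : LinearMap.BilinForm k (Matrix n n k) := LinearMap.mk₂ k (fun X Y => (X * Y).trace)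
    (fun X X' Y => by rw [Matrix.add_mul, Matrix.trace_add])
    (fun c X Y => by rw [Matrix.smul_mul, Matrix.trace_smul])
    (fun X Y Y' => by rw [Matrix.mul_add, Matrix.trace_add])
    (fun c X Y => by rw [Matrix.mul_smul, Matrix.trace_smul])
  have hb : ∀ X Y, b X Y = (X * Y).trace := fun X Y => rfl
  have hrefl : b.IsRefl := fun X Y h => by
    rw [hb] at h ⊢
    rw [Matrix.trace_mul_comm, h]
  have horth : ∀ X, X ∈ b.orthogonal W ↔ ∀ Z ∈ W, (Z * X).trace = 0 := fun X => Iff.rfl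
  have hdisj : Disjoint W (b.orthogonal W) := by
    rw [Submodule.disjoint_def]
    intro X hX hX'
    exact hW X hX fun Z hZ => by rw [Matrix.trace_mul_comm]; exact (horth X).1 hX' Z hZ
  have hc : IsCompl W (b.orthogonal W) := b.isCompl_orthogonal_of_restrict_nondegenerate hrefl
    (b.nondegenerate_restrict_of_disjoint_orthogonal hrefl hdisj)
  have hmem := Submodule.projection_apply_mem hc
  have hsub : ∀ A, A - Submodule.projection _ _ hc A ∈ b.orthogonal W := by
    intro A
    rw [← Submodule.projection_apply_eq_zero_iff hc, map_sub, sub_eq_zero]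
    exact ((Submodule.projection_eq_self_iff hc _).2 (hmem A)).symm
  refine ⟨Submodule.projection _ _ hc, hmem, fun X hX =>
    (Submodule.projection_eq_self_iff hc _).2 hX, fun A C => ?_⟩
  set p := Submodule.projection _ _ hc
  have h1 := (horth _).1 (hsub C) (p A) (hmem A)
  have h2 := (horth _).1 (hsub A) (p C) (hmem C)
  rw [Matrix.mul_sub, Matrix.trace_sub, sub_eq_zero] at h1 h2
  rw [h1, Matrix.trace_mul_comm (p A), ← h2, Matrix.trace_mul_comm]

section Coordinates

variable {n B : Type*} [Fintype n] [CommRing B]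

/-- The linear endomorphism of the space of matrices given by a matrix of coefficients. -/
def coordinateMap (P : n × n → n × n → B) : Matrix n n B →ₗ[B] Matrix n n B where
  toFun A := Matrix.of fun i j => ∑ w, P (i, j) w * A w.1 w.2
  map_add' A A' := by
    ext i j
    simp [mul_add, Finset.sum_add_distrib]
  map_smul' c A := by
    ext i j
    simp [mul_left_comm _ c, Finset.mul_sum]

theorem coordinateMap_apply (P : n × n → n × n → B) (A : Matrix n n B) (v : n × n) :
    coordinateMap P A v.1 v.2 = ∑ w, P v w * A w.1 w.2 := rfl

theorem trace_mul_eq_sum_prod (A C : Matrix n n B) :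
    (A * C).trace = ∑ v : n × n, A v.1 v.2 * C v.2 v.1 := by
  rw [Fintype.sum_prod_type]
  rfl

/-- The trace form pairs entry (i, j) of one matrix with entry (j, i) of the other, so
self-adjointness is a linear symmetry of the coefficients and can be descended. -/
theorem trace_coordinateMap_mul {P : n × n → n × n → B} (hP : ∀ v w, P v w = P w.swap v.swap)
    (A C : Matrix n n B) : (coordinateMap P A * C).trace = (A * coordinateMap P C).trace := by
  rw [trace_mul_eq_sum_prod, trace_mul_eq_sum_prod]
  have h1 : ∀ v : n × n, coordinateMap P A v.1 v.2 * C v.2 v.1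
      = ∑ w : n × n, A w.1 w.2 * (P w.swap v.swap * C v.swap.1 v.swap.2) := by
    intro v
    rw [coordinateMap_apply, Finset.sum_mul]
    refine Finset.sum_congr rfl fun w _ => ?_
    rw [hP v w, Prod.fst_swap, Prod.snd_swap]
    ring
  have h2 : ∀ w : n × n, A w.1 w.2 * coordinateMap P C w.2 w.1
      = ∑ v : n × n, A w.1 w.2 * (P w.swap v.swap * C v.swap.1 v.swap.2) := by
    intro w
    rw [← Finset.mul_sum]
    congr 1
    exact (Equiv.sum_comp (Equiv.prodComm n n) fun v => P w.swap v * C v.1 v.2).symm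
  rw [Finset.sum_congr rfl fun v _ => h1 v, Finset.sum_congr rfl fun w _ => h2 w,
    Finset.sum_comm]

theorem exists_coordinateMap_eq [DecidableEq n] (T : Matrix n n B →ₗ[B] Matrix n n B)
    (hT : ∀ A C, (T A * C).trace = (A * T C).trace) :
    ∃ P : n × n → n × n → B, T = coordinateMap P ∧ ∀ v w, P v w = P w.swap v.swap := by
  have hs : ∀ (A : Matrix n n B) (v : n × n),
      (A * Matrix.single v.2 v.1 1).trace = A v.1 v.2 := by
    intro A v
    rw [Matrix.trace_mul_single]
    simp
  refine ⟨fun v w => T (Matrix.single w.1 w.2 1) v.1 v.2, ?_, fun v w => ?_⟩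
  · apply LinearMap.ext
    intro A
    ext i j
    conv_lhs => rw [Matrix.matrix_eq_sum_single A]
    rw [coordinateMap_apply _ _ (i, j), Fintype.sum_prod_type, map_sum, Matrix.sum_apply]
    refine Finset.sum_congr rfl fun k _ => ?_
    rw [map_sum, Matrix.sum_apply]
    refine Finset.sum_congr rfl fun l _ => ?_
    have : Matrix.single k l (A k l) = A k l • Matrix.single k l (1 : B) := by
      rw [Matrix.smul_single, smul_eq_mul, mul_one]
    rw [this, map_smul, Matrix.smul_apply, smul_eq_mul, mul_comm]
  · have h1 := hT (Matrix.single w.1 w.2 1) (Matrix.single v.2 v.1 1)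
    rw [hs, Matrix.trace_mul_comm] at h1
    exact h1.trans (hs _ w.swap)

end Coordinates

namespace ClosedSubgroupScheme

variable {R : Type} [CommRing R] {N : ℕ} (𝒢 : ClosedSubgroupScheme R N)

/-- The coefficients of the linearisation at `1` of an equation. -/
noncomputable def tangentCoeff (p : MvPolynomial (Fin N × Fin N) R) (v : Fin N × Fin N) : R :=
  MvPolynomial.eval (fun ij => (1 : Matrix (Fin N) (Fin N) R) ij.1 ij.2) (MvPolynomial.pderiv v p)

theorem eval₂_pderiv_one {B : Type*} [CommRing B] (φ : R →+* B)
    (p : MvPolynomial (Fin N × Fin N) R) (v : Fin N × Fin N) :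
    (MvPolynomial.pderiv v p).eval₂ φ (fun ij => (1 : Matrix (Fin N) (Fin N) B) ij.1 ij.2)
      = φ (tangentCoeff p v) := by
  have h1 : (fun ij : Fin N × Fin N => (1 : Matrix (Fin N) (Fin N) B) ij.1 ij.2)
      = fun ij => φ ((1 : Matrix (Fin N) (Fin N) R) ij.1 ij.2) := by
    ext ij
    simp [Matrix.one_apply, apply_ite φ]
  rw [h1, tangentCoeff, MvPolynomial.eval, MvPolynomial.coe_eval₂Hom, MvPolynomial.hom_eval₂,
    RingHom.comp_id]

theorem mem_lieAlgebra_iff_tangentCoeff {B : Type} [CommRing B] (φ : R →+* B)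
    (X : Matrix (Fin N) (Fin N) B) :
    X ∈ 𝒢.lieAlgebra φ ↔ ∀ p ∈ 𝒢.eqs, ∑ v, φ (tangentCoeff p v) * X v.1 v.2 = 0 := by
  rw [mem_lieAlgebra_iff]
  simp only [eval₂_pderiv_one]

/-- Finitely many generators of the ideal have the same zeros over the dual numbers, hence their
linearisations suffice over every base. Finiteness allows a common denominator later. -/
theorem exists_finset_tangentCoeff [IsNoetherianRing R] :
    ∃ s : Finset (MvPolynomial (Fin N × Fin N) R), (s : Set _) ⊆ 𝒢.eqs ∧
      ∀ (B : Type) [CommRing B] (φ : R →+* B) (X : Matrix (Fin N) (Fin N) B),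
        X ∈ 𝒢.lieAlgebra φ ↔ ∀ p ∈ s, ∑ v, φ (tangentCoeff p v) * X v.1 v.2 = 0 := by
  obtain ⟨s, hs, hs'⟩ := 𝒢.exists_finset_eqs
  refine ⟨s, hs, fun B _ φ X => ⟨fun h p hp =>
    (𝒢.mem_lieAlgebra_iff_tangentCoeff φ X).1 h p (hs hp), fun h => ?_⟩⟩
  refine hs' (DualNumber B) ((TrivSqZeroExt.inlHom B B).comp φ) _ fun p hp => ?_
  rw [eval₂_one_add_dual, 𝒢.one_mem φ p (hs hp), TrivSqZeroExt.inl_zero, zero_add]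
  simp only [eval₂_pderiv_one]
  rw [h p hp, TrivSqZeroExt.inr_zero]

end ClosedSubgroupScheme

/-- After inverting one nonzero element, the Lie algebra is the image of a projection that is
self-adjoint for the trace form. -/
theorem ComplexForm.exists_lie_projector {R : Type} [CommRing R] {N : ℕ}
    {𝒢 : ClosedSubgroupScheme R N} {σ : R →+* ℂ} [IsDomain R] [IsNoetherianRing R]
    (E : ComplexForm 𝒢 σ) (hσ : Function.Injective σ) :
    ∃ f : R, f ≠ 0 ∧ ∀ (B : Type) [CommRing B] (φ : R →+* B), IsUnit (φ f) →
      ∃ T : Matrix (Fin N) (Fin N) B →ₗ[B] Matrix (Fin N) (Fin N) B,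
        (∀ A, T A ∈ 𝒢.lieAlgebra φ) ∧ (∀ X ∈ 𝒢.lieAlgebra φ, T X = X) ∧
        ∀ A C, (T A * C).trace = (A * T C).trace := by
  classical
  obtain ⟨s, hs, hs'⟩ := 𝒢.exists_finset_tangentCoeff
  obtain ⟨T, hT1, hT2, hT3⟩ := exists_trace_projector (𝒢.lieSubmodule σ)
    fun X hX h => E.eq_zero_of_trace_mul_eq_zero hX h
  obtain ⟨P, rfl, hP⟩ := exists_coordinateMap_eq T hT3
  set d := fun (p : MvPolynomial (Fin N × Fin N) R) (v : Fin N × Fin N) =>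
    ClosedSubgroupScheme.tangentCoeff p v
  have hPd : ∀ p ∈ s, ∀ w, ∑ v, σ (d p v) * P v w = 0 := by
    intro p hp w
    have h1 := (hs' ℂ σ _).1 (hT1 (Matrix.single w.1 w.2 1)) p hp
    rw [← h1]
    refine Finset.sum_congr rfl fun v _ => ?_
    rw [coordinateMap_apply]
    congr 1
    rw [Finset.sum_eq_single w]
    · simp
    · rintro ⟨i, j⟩ _ hij
      rw [Matrix.single_apply_of_ne, mul_zero]
      rintro ⟨rfl, rfl⟩
      exact hij rfl
    · simp
  -- rows of `1 - P` are combinations of the equations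
  have hrow : ∀ v, ∃ c : s → ℂ, ∀ w, (if v = w then 1 else 0) = P v w + ∑ p, c p * σ (d p w) := by
    intro v
    let L : s → Matrix (Fin N) (Fin N) ℂ →ₗ[ℂ] ℂ := fun p =>
      ∑ w, σ (d p w) • Matrix.entryLinearMap ℂ ℂ w.1 w.2
    let K : Matrix (Fin N) (Fin N) ℂ →ₗ[ℂ] ℂ :=
      Matrix.entryLinearMap ℂ ℂ v.1 v.2 ∘ₗ (LinearMap.id - coordinateMap P)
    have hL : ∀ p A, L p A = ∑ w, σ (d p w) * A w.1 w.2 := by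
      intro p A
      simp [L, LinearMap.sum_apply]
    -- The projection fixes the common kernel of the tangent functionals, so a row of 1 - P vanishes
    -- there and therefore lies in their span.
    have hKL : ⨅ p, LinearMap.ker (L p) ≤ LinearMap.ker K := by
      intro X hX
      rw [Submodule.mem_iInf] at hX
      have h1 : X ∈ 𝒢.lieAlgebra σ := (hs' ℂ σ X).2 fun p hp => by
        have := hX ⟨p, hp⟩
        rw [LinearMap.mem_ker, hL] at this
        exact this
      rw [LinearMap.mem_ker]
      simp [K, hT2 X h1]
    obtain ⟨c, hc⟩ := (Submodule.mem_span_range_iff_exists_fun ℂ).1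
      (FiniteDimensional.mem_span_of_iInf_ker_le_ker hKL)
    refine ⟨c, fun w => ?_⟩
    have h1 := LinearMap.congr_fun hc (Matrix.single w.1 w.2 1)
    have hsum : ∀ g : Fin N × Fin N → ℂ,
        ∑ w', g w' * (Matrix.single w.1 w.2 (1 : ℂ)) w'.1 w'.2 = g w := by
      intro g
      rw [Finset.sum_eq_single w]
      · simp
      · rintro ⟨i, j⟩ _ hij
        rw [Matrix.single_apply_of_ne, mul_zero]
        rintro ⟨rfl, rfl⟩
        exact hij rfl
      · simp
    rw [LinearMap.sum_apply] at h1
    simp only [LinearMap.smul_apply, hL, hsum, smul_eq_mul] at h1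
    have h2 : K (Matrix.single w.1 w.2 1) = (if v = w then 1 else 0) - P v w := by
      change Matrix.single w.1 w.2 (1 : ℂ) v.1 v.2 - coordinateMap P _ v.1 v.2 = _
      rw [coordinateMap_apply, hsum, Matrix.single_apply]
      congr 2
      rw [Prod.ext_iff, eq_comm (a := w.1), eq_comm (a := w.2)]
    rw [h1, h2]
    ring
  choose c hc using hrow
  -- descent
  obtain ⟨l, hl1, hl⟩ := exists_additive_retraction hσ
  have hl' : ∀ z r, l (z * σ r) = l z * algebraMap R (FractionRing R) r := fun z r => by
    rw [mul_comm, hl, mul_comm]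
  -- Here b is a common denominator of the retracted coefficients. P' and c' are b times those
  -- coefficients, so the projection over B will be P' divided by b.
  obtain ⟨⟨b, hb⟩, hint⟩ := IsLocalization.exist_integer_multiples_of_finite (nonZeroDivisors R)
    (S := FractionRing R)
    (Sum.elim (fun vw : (Fin N × Fin N) × (Fin N × Fin N) => l (P vw.1 vw.2))
      (fun vp : (Fin N × Fin N) × s => l (c vp.1 vp.2)))
  choose P' hP' using fun v w => hint (Sum.inl (v, w))
  choose c' hc' using fun v p => hint (Sum.inr (v, p))
  simp only [Sum.elim_inl, Sum.elim_inr, Algebra.smul_def] at hP' hc'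
  have hinj := IsFractionRing.injective R (FractionRing R)
  -- The identities `e1`, `e2`, `e3` say that P' maps into the Lie algebra, that b - P' is a
  -- combination of the tangent equations, and that P' is self-adjoint. They are linear in P and c,
  -- so they survive the retraction. Idempotency, which is quadratic, need not be descended: it
  -- follows from the first two.
  have e1 : ∀ p ∈ s, ∀ w, ∑ v, d p v * P' v w = 0 := by
    intro p hp w
    apply hinj
    have h1 := congrArg l (hPd p hp w)
    rw [map_zero, map_sum] at h1
    simp only [hl] at h1
    rw [map_sum, map_zero]
    simp only [map_mul, hP']
    rw [← mul_zero (algebraMap R (FractionRing R) b), ← h1, Finset.mul_sum]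
    exact Finset.sum_congr rfl fun v _ => by ring
  have e2 : ∀ v w, (if v = w then b else 0) = P' v w + ∑ p, c' v p * d p w := by
    intro v w
    apply hinj
    have h1 := congrArg l (hc v w)
    rw [map_add, map_sum, apply_ite l, hl1, map_zero] at h1
    simp only [hl'] at h1
    rw [map_add, map_sum]
    simp only [map_mul, hP', hc']
    have h2 : algebraMap R (FractionRing R) (if v = w then b else 0)
        = algebraMap R (FractionRing R) b * (if v = w then 1 else 0) := by
      split_ifs <;> simp
    rw [h2, h1, mul_add, Finset.mul_sum]
    congr 1
    exact Finset.sum_congr rfl fun p _ => by ring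
  have e3 : ∀ v w, P' v w = P' w.swap v.swap := by
    intro v w
    apply hinj
    rw [hP', hP', hP v w]
  refine ⟨b, nonZeroDivisors.ne_zero hb, fun B _ φ hφ => ?_⟩
  obtain ⟨u, hu⟩ := hφ.exists_left_inv
  refine ⟨u • coordinateMap fun v w => φ (P' v w), fun A => ?_, fun X hX => ?_, fun A C => ?_⟩
  · rw [LinearMap.smul_apply]
    apply (𝒢.lieSubmodule φ).smul_mem
    refine (hs' B φ _).2 fun p hp => ?_
    simp only [coordinateMap_apply, Finset.mul_sum]
    rw [Finset.sum_comm]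
    refine Finset.sum_eq_zero fun w _ => ?_
    have h1 := congrArg φ (e1 p hp w)
    rw [map_sum, map_zero] at h1
    simp only [map_mul] at h1
    simp only [← mul_assoc]
    rw [← Finset.sum_mul, h1, zero_mul]
  · have h1 := (hs' B φ X).1 hX
    have h2 : ∀ v : Fin N × Fin N,
        coordinateMap (fun v w => φ (P' v w)) X v.1 v.2 = φ b * X v.1 v.2 := by
      intro v
      have h3 : ∀ w, φ (P' v w) = (if v = w then φ b else 0) - ∑ p, φ (c' v p) * φ (d p w) := by
        intro w
        have := congrArg φ (e2 v w)
        rw [apply_ite φ, map_zero, map_add, map_sum] at this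
        simp only [map_mul] at this
        rw [this, add_sub_cancel_right]
      rw [coordinateMap_apply]
      simp only [h3, sub_mul, Finset.sum_sub_distrib, ite_mul, zero_mul, Finset.sum_ite_eq,
        Finset.mem_univ, if_true, Finset.sum_mul]
      rw [Finset.sum_comm, sub_eq_self]
      refine Finset.sum_eq_zero fun p _ => ?_
      simp only [mul_assoc]
      rw [← Finset.mul_sum, h1 p.1 p.2, mul_zero]
    ext i j
    rw [LinearMap.smul_apply, Matrix.smul_apply, h2 (i, j), smul_eq_mul, ← mul_assoc, hu, one_mul]
  · rw [LinearMap.smul_apply, LinearMap.smul_apply, Matrix.smul_mul, Matrix.mul_smul,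
      Matrix.trace_smul, Matrix.trace_smul, trace_coordinateMap_mul]
    intro v w
    rw [e3 v w]

/-! ### Weights of representations of finite abelian groups -/

section Weights

variable {𝔞 : Type*} [AddCommGroup 𝔞] {V : Type*} [AddCommGroup V] [Module ℂ V]

theorem Representation.add_apply (T : Representation ℂ (Multiplicative 𝔞) V) (a b : 𝔞) (v : V) :
    T (Multiplicative.ofAdd (a + b)) v
      = T (Multiplicative.ofAdd a) (T (Multiplicative.ofAdd b) v) := by
  rw [ofAdd_add, map_mul]
  rfl

variable [Fintype 𝔞]

/-- If `a` acts nontrivially, then it acts nontrivially on some weight vector. -/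
theorem exists_weight_of_ne_one (T : Representation ℂ (Multiplicative 𝔞) V) {a : 𝔞}
    (ha : T (Multiplicative.ofAdd a) ≠ 1) :
    ∃ χ : AddChar 𝔞 ℂ, χ a ≠ 1 ∧
      ∃ v : V, v ≠ 0 ∧ ∀ b, T (Multiplicative.ofAdd b) v = χ b • v := by
  classical
  by_contra hcon
  push Not at hcon
  apply ha
  -- Up to the factor |𝔞| this projects onto the χ-weight space, and these projections sum to |𝔞|
  -- times the identity. If a fixes every weight vector, it therefore acts trivially.
  set e : AddChar 𝔞 ℂ → V → V := fun χ v => ∑ b, χ (-b) • T (Multiplicative.ofAdd b) v with he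
  have hwt : ∀ χ v c, T (Multiplicative.ofAdd c) (e χ v) = χ c • e χ v := by
    intro χ v c
    rw [he]
    simp only [map_sum, map_smul, Finset.smul_sum, ← Representation.add_apply]
    rw [← Equiv.sum_comp (Equiv.addLeft c)
      (fun b => χ c • χ (-b) • T (Multiplicative.ofAdd b) v)]
    refine Finset.sum_congr rfl fun b _ => ?_
    rw [smul_smul, Equiv.coe_addLeft, ← AddChar.map_add_eq_mul]
    congr 2
    rw [neg_add, add_neg_cancel_left]
  have hfix : ∀ χ v, T (Multiplicative.ofAdd a) (e χ v) = e χ v := by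
    intro χ v
    by_cases h1 : χ a = 1
    · rw [hwt, h1, one_smul]
    · have h2 : e χ v = 0 := by
        by_contra h3
        obtain ⟨b, hb⟩ := hcon χ h1 (e χ v) h3
        exact hb (hwt χ v b)
      rw [h2, map_zero]
  have hsum : ∀ v, ∑ χ, e χ v = (Fintype.card 𝔞 : ℂ) • v := by
    intro v
    rw [he]
    simp only
    rw [Finset.sum_comm]
    simp only [← Finset.sum_smul, AddChar.sum_apply_eq_ite, neg_eq_zero]
    rw [Finset.sum_eq_single 0]
    · rw [if_pos rfl, ofAdd_zero, map_one]
      rfl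
    · intro b _ hb
      rw [if_neg hb, zero_smul]
    · simp
  apply LinearMap.ext
  intro v
  have h1 := congrArg (T (Multiplicative.ofAdd a)) (hsum v)
  rw [map_sum, Finset.sum_congr rfl fun χ _ => hfix χ v, hsum, map_smul] at h1
  have h2 : (Fintype.card 𝔞 : ℂ) ≠ 0 := Nat.cast_ne_zero.2 Fintype.card_ne_zero
  exact (smul_right_injective V h2 h1).symm

/-- The number of distinct weights is at most the dimension. -/
theorem card_le_finrank_of_weights [FiniteDimensional ℂ V]
    (T : Representation ℂ (Multiplicative 𝔞) V) {I : Type*} [Finite I] (χ : I → AddChar 𝔞 ℂ)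
    (hχ : Function.Injective χ) (v : I → V) (hv : ∀ i, v i ≠ 0)
    (hw : ∀ i b, T (Multiplicative.ofAdd b) (v i) = χ i b • v i) :
    Nat.card I ≤ Module.finrank ℂ V := by
  classical
  have _ := Fintype.ofFinite I
  have hli : LinearIndependent ℂ v := by
    rw [Fintype.linearIndependent_iff]
    intro c hc j
    -- Applying the unnormalised projection for χ j to the relation isolates c j, by orthogonality
    -- of characters.
    have h1 : ∑ b, χ j (-b) • T (Multiplicative.ofAdd b) (∑ i, c i • v i) = 0 := by
      rw [hc]
      simp
    have h2 : ∀ i, ∑ b, (χ j (-b) * χ i b) = if i = j then (Fintype.card 𝔞 : ℂ) else 0 := by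
      intro i
      have h3 : ∀ b, χ j (-b) * χ i b = (χ i - χ j) b := by
        intro b
        rw [AddChar.sub_apply, mul_comm]
      simp only [h3, AddChar.sum_eq_ite, sub_eq_zero, hχ.eq_iff]
    have h4 : ∑ b, χ j (-b) • T (Multiplicative.ofAdd b) (∑ i, c i • v i)
        = ∑ i, (c i * ∑ b, (χ j (-b) * χ i b)) • v i := by
      simp only [map_sum, map_smul, hw, Finset.smul_sum, Finset.mul_sum, Finset.sum_smul]
      rw [Finset.sum_comm]
      refine Finset.sum_congr rfl fun i _ => Finset.sum_congr rfl fun b _ => ?_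
      rw [smul_smul, smul_smul]
      congr 1
      ring
    rw [h4] at h1
    simp only [h2, mul_ite, mul_zero, ite_smul, zero_smul, Finset.sum_ite_eq', Finset.mem_univ,
      if_true] at h1
    have h5 := (smul_eq_zero.1 h1).resolve_right (hv j)
    exact (mul_eq_zero.1 h5).resolve_right (Nat.cast_ne_zero.2 Fintype.card_ne_zero)
  rw [Nat.card_eq_fintype_card]
  exact hli.fintype_card_le_finrank

end Weights

/-! ### Characters of matrix spaces given by the trace form -/

section TraceCharacter

variable {n B : Type*} [Fintype n] [CommRing B]

/-- The additive character `Y ↦ ψ (tr (X Y))` of the space of matrices. -/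
def traceChar (ψ : AddChar B ℂ) (X : Matrix n n B) : AddChar (Matrix n n B) ℂ :=
  ψ.compAddMonoidHom
    ((Matrix.traceAddMonoidHom n B).comp (AddMonoidHom.mulLeft X))

theorem traceChar_apply (ψ : AddChar B ℂ) (X Y : Matrix n n B) :
    traceChar ψ X Y = ψ (X * Y).trace := rfl

/-- Testing on c times a matrix unit isolates one entry of the difference, and primitivity of ψ
detects it. -/
theorem traceChar_injective [DecidableEq n] {ψ : AddChar B ℂ}
    (hψ : ∀ b : B, b ≠ 0 → ∃ c, ψ (b * c) ≠ 1) :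
    Function.Injective (traceChar ψ : Matrix n n B → AddChar (Matrix n n B) ℂ) := by
  intro X X' h
  by_contra hne
  have h1 : ∃ i j, X i j - X' i j ≠ 0 := by
    by_contra h2
    push Not at h2
    exact hne (Matrix.ext fun i j => sub_eq_zero.1 (h2 i j))
  obtain ⟨i, j, hij⟩ := h1
  obtain ⟨c, hc⟩ := hψ _ hij
  apply hc
  have h2 : ∀ Z : Matrix n n B, (Z * Matrix.single j i c).trace = Z i j * c := by
    intro Z
    rw [Matrix.trace_mul_single]
    rfl
  have h3 := DFunLike.congr_fun h (Matrix.single j i c)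
  rw [traceChar_apply, traceChar_apply, h2, h2] at h3
  rw [sub_mul, AddChar.map_sub_eq_div, h3, div_self (ψ.val_isUnit _).ne_zero]

/-- An injective map between finite sets of equal size: a finite abelian group has as many complex
characters as elements. -/
theorem traceChar_surjective [DecidableEq n] [Finite B] {ψ : AddChar B ℂ}
    (hψ : ∀ b : B, b ≠ 0 → ∃ c, ψ (b * c) ≠ 1) :
    Function.Surjective (traceChar ψ : Matrix n n B → AddChar (Matrix n n B) ℂ) := by
  have _ := Fintype.ofFinite (Matrix n n B)
  exact ((Fintype.bijective_iff_injective_and_card _).2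
    ⟨traceChar_injective hψ,
      AddChar.card_eq.symm⟩).2

end TraceCharacter

/-! ### The orbit of a weight under conjugation -/

section OneAddUnit

variable {n : Type*} [Fintype n] [DecidableEq n] {A B : Type*} [CommRing A] [CommRing B]
  {q : A →+* B} {w : A}

/-- The annihilator of w is the kernel of q, so wY depends only on Y modulo that kernel. Hence any
set-theoretic lift may be used to define the exponential on matrices over B. -/
theorem oneAddUnit_congr (hw : w * w = 0) (hq : ∀ a, w * a = 0 ↔ q a = 0) {Y Y' : Matrix n n A}
    (h : Y.map q = Y'.map q) : oneAddUnit hw Y = oneAddUnit hw Y' := by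
  apply generalLinearGroup_ext
  intro i j
  have h1 : q (Y i j - Y' i j) = 0 := by
    rw [map_sub, sub_eq_zero]
    exact congrFun (congrFun h i) j
  have h2 := (hq _).2 h1
  rw [mul_sub, sub_eq_zero] at h2
  simp [oneAddUnit_val, h2]

theorem map_eq_of_oneAddUnit_eq (hw : w * w = 0) (hq : ∀ a, w * a = 0 ↔ q a = 0)
    {Y Y' : Matrix n n A} (h : oneAddUnit hw Y = oneAddUnit hw Y') : Y.map q = Y'.map q := by
  ext i j
  have h1 := congrArg (fun g : GL n A => g.1 i j) h
  simp only [oneAddUnit_val, Matrix.add_apply, Matrix.smul_apply, smul_eq_mul, add_right_inj] at h1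
  rw [Matrix.map_apply, Matrix.map_apply, ← sub_eq_zero, ← map_sub, ← hq, mul_sub, h1, sub_self]

end OneAddUnit

namespace ClosedSubgroupScheme

variable {R : Type} [CommRing R] {N : ℕ} (𝒢 : ClosedSubgroupScheme R N)
  {A B : Type} [CommRing A] [CommRing B] (φ : R →+* A) {q : A →+* B} {w : A}

/-- The homomorphism `Y ↦ 1 + w Y` from the Lie algebra to the points. -/
noncomputable def lieExp (hs : Function.Surjective q) (hw : w * w = 0)
    (hq : ∀ a, w * a = 0 ↔ q a = 0) :
    Multiplicative (𝒢.lieSubmodule (q.comp φ)) →* 𝒢.points φ :=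
  MonoidHom.mk' (fun Y => ⟨oneAddUnit hw (Y.toAdd.1.map (Function.surjInv hs)), by
    rw [𝒢.oneAddUnit_mem_points_iff φ q hw hq, Matrix.map_map]
    have h : (q ∘ Function.surjInv hs) = id := funext fun b => Function.surjInv_eq hs b
    rw [h, Matrix.map_id]
    exact Y.toAdd.2⟩) (by
    intro Y Z
    apply Subtype.ext
    change oneAddUnit hw _ = oneAddUnit hw _ * oneAddUnit hw _
    rw [← oneAddUnit_add]
    apply oneAddUnit_congr hw hq
    ext i j
    simp [Function.surjInv_eq hs])

theorem lieExp_val (hs : Function.Surjective q) (hw : w * w = 0)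
    (hq : ∀ a, w * a = 0 ↔ q a = 0) (Y : 𝒢.lieSubmodule (q.comp φ)) {Z : Matrix _ _ A}
    (hZ : Z.map q = Y.1) :
    (𝒢.lieExp φ hs hw hq (Multiplicative.ofAdd Y)).1 = oneAddUnit hw Z := by
  change oneAddUnit hw _ = _
  apply oneAddUnit_congr hw hq
  rw [hZ]
  ext i j
  simp [Function.surjInv_eq hs]

/-- The orbit of `X` under conjugation by the image of `𝒢(A)` in `𝒢(B)`. -/
def conjOrbit (q : A →+* B) (X : Matrix (Fin N) (Fin N) B) : Set (Matrix (Fin N) (Fin N) B) :=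
  {Z | ∃ g ∈ 𝒢.points φ, Z = g.1.map q * X * g⁻¹.1.map q}

/-- The dimension of a representation of `𝒢(A)` in which `1 + w Y` acts nontrivially is at least
the size of the orbit of some `X` in the Lie algebra with `ψ (tr (X Y)) ≠ 1`. -/
theorem exists_card_conjOrbit_le [Finite A] (hs : Function.Surjective q) (hw : w * w = 0)
    (hq : ∀ a, w * a = 0 ↔ q a = 0)
    {T : Matrix (Fin N) (Fin N) B →ₗ[B] Matrix (Fin N) (Fin N) B}
    (hT1 : ∀ A, T A ∈ 𝒢.lieAlgebra (q.comp φ)) (hT2 : ∀ X ∈ 𝒢.lieAlgebra (q.comp φ), T X = X)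
    (hT3 : ∀ A C, (T A * C).trace = (A * T C).trace)
    {ψ : AddChar B ℂ} (hψ : ∀ b : B, b ≠ 0 → ∃ c, ψ (b * c) ≠ 1)
    {V : Type v} [AddCommGroup V] [Module ℂ V] [FiniteDimensional ℂ V]
    (ρ : Representation ℂ (𝒢.points φ) V) {Y : Matrix (Fin N) (Fin N) A} {g : 𝒢.points φ}
    (hgY : g.1 = oneAddUnit hw Y) (hρ : ρ g ≠ 1) :
    ∃ X ∈ 𝒢.lieAlgebra (q.comp φ), ψ (X * Y.map q).trace ≠ 1 ∧
      Nat.card (𝒢.conjOrbit φ q X) ≤ Module.finrank ℂ V := by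
  have _ : Finite B := Finite.of_surjective q hs
  have _ := Fintype.ofFinite (𝒢.lieSubmodule (q.comp φ))
  have hY : Y.map q ∈ 𝒢.lieSubmodule (q.comp φ) := by
    rw [mem_lieSubmodule, ← 𝒢.oneAddUnit_mem_points_iff φ q hw hq, ← hgY]
    exact g.2
  set τ : Representation ℂ (Multiplicative (𝒢.lieSubmodule (q.comp φ))) V :=
    ρ.comp (𝒢.lieExp φ hs hw hq) with hτ
  have hτa : ∀ a, τ a = ρ (𝒢.lieExp φ hs hw hq a) := fun a => rfl
  have hτY : τ (Multiplicative.ofAdd ⟨Y.map q, hY⟩) ≠ 1 := by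
    rw [hτa]
    have : 𝒢.lieExp φ hs hw hq (Multiplicative.ofAdd ⟨Y.map q, hY⟩) = g :=
      Subtype.ext ((𝒢.lieExp_val φ hs hw hq _ rfl).trans hgY.symm)
    rwa [this]
  obtain ⟨χ, hχ, v, hv0, hv⟩ := exists_weight_of_ne_one τ hτY
  -- the character is given by the trace form
  let T' : Matrix (Fin N) (Fin N) B →+ 𝒢.lieSubmodule (q.comp φ) :=
    (T.toAddMonoidHom).codRestrict (𝒢.lieSubmodule (q.comp φ)).toAddSubgroup hT1
  -- Composing with T extends χ to all matrices, where every character is a trace character.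
  -- Self-adjointness of T then moves the representing matrix X₀ to T X₀, inside the Lie algebra.
  obtain ⟨X₀, hX₀⟩ := traceChar_surjective hψ (χ.compAddMonoidHom T')
  have hX : ∀ Z : 𝒢.lieSubmodule (q.comp φ), χ Z = ψ (T X₀ * Z.1).trace := by
    intro Z
    have h1 := DFunLike.congr_fun hX₀ Z.1
    rw [traceChar_apply, AddChar.compAddMonoidHom_apply] at h1
    have h2 : T' Z.1 = Z := Subtype.ext (hT2 Z.1 Z.2)
    rw [h2] at h1
    rw [← h1, hT3, hT2 Z.1 Z.2]
  set X := T X₀ with hXdef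
  refine ⟨X, hT1 X₀, by rw [← hX ⟨Y.map q, hY⟩]; exact hχ, ?_⟩
  choose γ hγ hγX using fun Z : 𝒢.conjOrbit φ q X => Z.2
  have horb : ∀ Z : 𝒢.conjOrbit φ q X, Z.1 ∈ 𝒢.lieAlgebra (q.comp φ) := by
    intro Z
    rw [hγX Z]
    exact 𝒢.conj_mem_lieAlgebra (q.comp φ) (𝒢.map_mem φ q (hγ Z)) (hT1 X₀)
  set Χ : 𝒢.conjOrbit φ q X → AddChar (𝒢.lieSubmodule (q.comp φ)) ℂ := fun Z =>
    (traceChar ψ Z.1).compAddMonoidHom (𝒢.lieSubmodule (q.comp φ)).subtype.toAddMonoidHom with hΧ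
  have hΧa : ∀ Z a, Χ Z a = ψ (Z.1 * a.1).trace := fun Z a => rfl
  -- For Z = γXγ⁻¹ the translate ρ(γ)v is a weight vector of weight Y ↦ ψ(tr(ZY)).
  refine card_le_finrank_of_weights τ Χ ?_ (fun Z => ρ ⟨γ Z, hγ Z⟩ v) ?_ ?_
  · intro Z Z' h
    apply Subtype.ext
    apply traceChar_injective hψ
    ext C
    have h1 := DFunLike.congr_fun h ⟨T C, hT1 C⟩
    rw [hΧa, hΧa] at h1
    -- For Z in the Lie algebra, tr(ZC) = tr(Z · T C). The restriction of its trace character to the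
    -- Lie algebra thus determines the character on all matrices, hence Z.
    rw [traceChar_apply, traceChar_apply, ← hT2 _ (horb Z), ← hT2 _ (horb Z'), hT3, hT3]
    exact h1
  · intro Z h
    apply hv0
    have h1 := congrArg (ρ (⟨γ Z, hγ Z⟩ : 𝒢.points φ)⁻¹) h
    rw [map_zero, ← Module.End.mul_apply, ← map_mul, inv_mul_cancel, map_one] at h1
    exact h1
  · intro Z a
    set c : 𝒢.points φ := ⟨γ Z, hγ Z⟩
    have hc' : (c⁻¹.1.1).map q * (c.1.1).map q = 1 := by
      rw [← Matrix.map_mul]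
      have : c⁻¹.1.1 * c.1.1 = 1 := Units.inv_mul c.1
      rw [this, Matrix.map_one _ (map_zero q) (map_one q)]
    have hmem : (c⁻¹.1.1).map q * a.1 * (c.1.1).map q ∈ 𝒢.lieSubmodule (q.comp φ) := by
      have h1 := 𝒢.conj_mem_lieAlgebra (q.comp φ) (𝒢.map_mem φ q (c⁻¹).2) a.2
      have h2 : ((Matrix.GeneralLinearGroup.map q c⁻¹.1)⁻¹).1 = (c.1.1).map q := by
        rw [← map_inv]
        have : (c⁻¹.1)⁻¹ = c.1 := inv_inv c.1
        rw [this]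
        rfl
      rw [h2] at h1
      exact h1
    -- Moving c past 1 + wa replaces a by c⁻¹ac; cyclicity of the trace then turns the weight X into
    -- cXc⁻¹.
    have hconj : 𝒢.lieExp φ hs hw hq (Multiplicative.ofAdd a) * c
        = c * 𝒢.lieExp φ hs hw hq (Multiplicative.ofAdd ⟨_, hmem⟩) := by
      obtain ⟨L, hL⟩ := exists_map_eq_of_surjective hs a.1
      have h1 := oneAddUnit_conj hw c⁻¹.1 L
      have h2 : (c⁻¹.1)⁻¹ = c.1 := inv_inv c.1
      rw [h2] at h1
      have h3 := 𝒢.lieExp_val φ hs hw hq ⟨_, hmem⟩ (Z := c⁻¹.1.1 * L * c.1.1)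
        (by rw [Matrix.map_mul, Matrix.map_mul, hL])
      apply Subtype.ext
      rw [Subgroup.coe_mul, Subgroup.coe_mul, h3, 𝒢.lieExp_val φ hs hw hq a hL, ← h1]
      change _ = c.1 * (c.1⁻¹ * _ * _)
      group
    rw [hτa, ← Module.End.mul_apply, ← map_mul, hconj, map_mul, Module.End.mul_apply, ← hτa, hv,
      map_smul, hX, hΧa, hγX Z]
    congr 2
    change (X * ((c⁻¹.1.1).map q * a.1 * (c.1.1).map q)).trace
      = ((c.1.1).map q * X * (c⁻¹.1.1).map q * a.1).trace
    rw [← Matrix.mul_assoc, Matrix.trace_mul_comm]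
    simp only [Matrix.mul_assoc]

end ClosedSubgroupScheme

/-! ### Arithmetic of O / 𝔭^j in a Dedekind domain -/

theorem Ideal.Quotient.pow_mul_self_eq_zero {O : Type*} [CommRing O] {𝔭 : Ideal O} {ϖ : O} (h1 : ϖ ∈ 𝔭) 
    {l k : ℕ} {𝔮 : Ideal O} (h𝔮 : 𝔮 = 𝔭 ^ (l + k)) (hkl : k ≤ l) :
    Ideal.Quotient.mk 𝔮 (ϖ ^ l) * Ideal.Quotient.mk 𝔮 (ϖ ^ l) = 0 := by
  rw [← map_mul, Ideal.Quotient.eq_zero_iff_mem, h𝔮, ← pow_add]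
  exact Ideal.pow_le_pow_right (by omega) (Ideal.pow_mem_pow h1 _)

section Uniformizer

variable {O : Type*} [CommRing O] [IsDedekindDomain O] {𝔭 : Ideal O}

theorem Ideal.exists_mem_notMem_sq (hp : 𝔭.IsPrime) (h0 : 𝔭 ≠ ⊥) : ∃ ϖ ∈ 𝔭, ϖ ∉ 𝔭 ^ 2 := by
  have h1 : 𝔭 ^ 2 < 𝔭 := by
    have := Ideal.pow_right_strictAnti 𝔭 h0 hp.ne_top (show 1 < 2 by norm_num)
    simpa using this
  obtain ⟨x, hx, hx'⟩ := SetLike.exists_of_lt h1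
  exact ⟨x, hx, hx'⟩

/-- Write (ϖ) = 𝔭𝔞 with 𝔭 not dividing 𝔞. Then 𝔭^l cancels, and 𝔞^l is prime to 𝔭. -/
theorem Ideal.pow_mul_mem_pow_add_iff (hp : 𝔭.IsPrime) (h0 : 𝔭 ≠ ⊥) {ϖ : O} (h1 : ϖ ∈ 𝔭)
    (h2 : ϖ ∉ 𝔭 ^ 2) (l k : ℕ) (x : O) : ϖ ^ l * x ∈ 𝔭 ^ (l + k) ↔ x ∈ 𝔭 ^ k := by
  have hprime : Prime 𝔭 := Ideal.prime_of_isPrime h0 hp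
  obtain ⟨𝔞, h𝔞⟩ := Ideal.dvd_span_singleton.2 h1
  have hna : ¬ 𝔭 ∣ 𝔞 := by
    rintro ⟨𝔟, rfl⟩
    apply h2
    rw [← Ideal.dvd_span_singleton, h𝔞, ← mul_assoc, pow_two]
    exact dvd_mul_right _ _
  rw [← Ideal.dvd_span_singleton, ← Ideal.dvd_span_singleton, ← Ideal.span_singleton_mul_span_singleton,
    ← Ideal.span_singleton_pow, h𝔞, mul_pow, pow_add, mul_assoc,
    mul_dvd_mul_iff_left (pow_ne_zero l (by simpa using h0))]
  refine ⟨fun h => hprime.pow_dvd_of_dvd_mul_left k (fun h' => hna (hprime.dvd_of_dvd_pow h')) h,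
    fun h => h.mul_left _⟩

/-- The ideal (ϖ^l) + 𝔭^(l+k) divides a power of 𝔭, so it equals some 𝔭^i. Here i ≤ l, since
otherwise ϖ^l would lie in 𝔭^(l+1); so it contains 𝔭^l. -/
theorem Ideal.exists_sub_pow_mul_mem (hp : 𝔭.IsPrime) (h0 : 𝔭 ≠ ⊥) {ϖ : O} (h1 : ϖ ∈ 𝔭)
    (h2 : ϖ ∉ 𝔭 ^ 2) (l k : ℕ) {x : O} (hx : x ∈ 𝔭 ^ l) : ∃ y, x - ϖ ^ l * y ∈ 𝔭 ^ (l + k) := by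
  have hprime : Prime 𝔭 := Ideal.prime_of_isPrime h0 hp
  have h3 : Ideal.span {ϖ ^ l} ⊔ 𝔭 ^ (l + k) ∣ 𝔭 ^ (l + k) := Ideal.dvd_iff_le.2 le_sup_right
  obtain ⟨i, hi, hi'⟩ := (dvd_prime_pow hprime _).1 h3
  rw [associated_iff_eq] at hi'
  have hil : i ≤ l := by
    by_contra hcon
    push Not at hcon
    have h4 : ϖ ^ l ∈ 𝔭 ^ i := by
      rw [← hi']
      exact Ideal.mem_sup_left (Ideal.mem_span_singleton_self _)
    have h5 : ϖ ^ l * 1 ∈ 𝔭 ^ (l + 1) := by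
      rw [mul_one]
      exact Ideal.pow_le_pow_right hcon h4
    rw [Ideal.pow_mul_mem_pow_add_iff hp h0 h1 h2, pow_one] at h5
    exact hp.ne_top ((Ideal.eq_top_iff_one _).2 h5)
  have h4 : x ∈ Ideal.span {ϖ ^ l} ⊔ 𝔭 ^ (l + k) := by
    rw [hi']
    exact Ideal.pow_le_pow_right hil hx
  obtain ⟨a, ha, b, hb, rfl⟩ := Submodule.mem_sup.1 h4
  obtain ⟨y, rfl⟩ := Ideal.mem_span_singleton'.1 ha
  exact ⟨y, by rw [mul_comm, add_sub_cancel_left]; exact hb⟩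

/-- The ideal (x) + 𝔭^(k+1) is a power of 𝔭 with exponent at most k, so it contains ϖ^k. In other
words, every nonzero ideal of O/𝔭^(k+1) contains the class of ϖ^k. -/
theorem Ideal.exists_mul_sub_mem_of_notMem (hp : 𝔭.IsPrime) (h0 : 𝔭 ≠ ⊥) {ϖ : O} (h1 : ϖ ∈ 𝔭)
    (k : ℕ) {x : O} (hx : x ∉ 𝔭 ^ (k + 1)) : ∃ y, x * y - ϖ ^ k ∈ 𝔭 ^ (k + 1) := by
  have hprime : Prime 𝔭 := Ideal.prime_of_isPrime h0 hp
  have h3 : Ideal.span {x} ⊔ 𝔭 ^ (k + 1) ∣ 𝔭 ^ (k + 1) := Ideal.dvd_iff_le.2 le_sup_right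
  obtain ⟨i, hi, hi'⟩ := (dvd_prime_pow hprime _).1 h3
  rw [associated_iff_eq] at hi'
  have hik : i ≤ k := by
    by_contra hcon
    push Not at hcon
    apply hx
    rw [← le_antisymm hi hcon, ← hi']
    exact Ideal.mem_sup_left (Ideal.mem_span_singleton_self _)
  have h4 : ϖ ^ k ∈ Ideal.span {x} ⊔ 𝔭 ^ (k + 1) := by
    rw [hi']
    exact Ideal.pow_le_pow_right hik (Ideal.pow_mem_pow h1 k)
  obtain ⟨a, ha, b, hb, hab⟩ := Submodule.mem_sup.1 h4
  obtain ⟨y, rfl⟩ := Ideal.mem_span_singleton'.1 ha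
  refine ⟨y, ?_⟩
  rw [← hab, mul_comm, sub_add_cancel_left]
  exact neg_mem hb

/-- The finite ring `O / 𝔭 ^ (k + 1)` has a primitive additive character. -/
theorem exists_primitive_addChar (hp : 𝔭.IsPrime) (h0 : 𝔭 ≠ ⊥) (k : ℕ)
    [Finite (O ⧸ 𝔭 ^ (k + 1))] :
    ∃ ψ : AddChar (O ⧸ 𝔭 ^ (k + 1)) ℂ, ∀ b, b ≠ 0 → ∃ c, ψ (b * c) ≠ 1 := by
  obtain ⟨ϖ, h1, h2⟩ := Ideal.exists_mem_notMem_sq hp h0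
  have h3 : Ideal.Quotient.mk (𝔭 ^ (k + 1)) (ϖ ^ k) ≠ 0 := by
    rw [Ne, Ideal.Quotient.eq_zero_iff_mem, ← mul_one (ϖ ^ k),
      Ideal.pow_mul_mem_pow_add_iff hp h0 h1 h2, pow_one]
    exact fun h => hp.ne_top ((Ideal.eq_top_iff_one _).2 h)
  -- Nontriviality at the single element ϖ^k is enough, because every nonzero b has ϖ^k among its
  -- multiples.
  obtain ⟨ψ, hψ⟩ := AddChar.exists_apply_ne_zero.2 h3
  refine ⟨ψ, fun b hb => ?_⟩
  obtain ⟨x, rfl⟩ := Ideal.Quotient.mk_surjective b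
  rw [Ne, Ideal.Quotient.eq_zero_iff_mem] at hb
  obtain ⟨y, hy⟩ := Ideal.exists_mul_sub_mem_of_notMem hp h0 h1 k hb
  refine ⟨Ideal.Quotient.mk _ y, ?_⟩
  rw [← map_mul, Ideal.Quotient.eq.2 hy]
  exact hψ

/-- Multiplication by `ϖ ^ l` on `O / 𝔭 ^ (l + k)`. -/
theorem Ideal.Quotient.pow_mul_eq_zero_iff (hp : 𝔭.IsPrime) (h0 : 𝔭 ≠ ⊥) {ϖ : O} (h1 : ϖ ∈ 𝔭)
    (h2 : ϖ ∉ 𝔭 ^ 2) {l k : ℕ} {𝔮 𝔨 : Ideal O} (h𝔮 : 𝔮 = 𝔭 ^ (l + k)) (h𝔨 : 𝔨 = 𝔭 ^ k)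
    (hle : 𝔮 ≤ 𝔨) (a : O ⧸ 𝔮) :
    Ideal.Quotient.mk 𝔮 (ϖ ^ l) * a = 0 ↔ Ideal.Quotient.factor hle a = 0 := by
  obtain ⟨x, rfl⟩ := Ideal.Quotient.mk_surjective a
  rw [← map_mul, Ideal.Quotient.factor_mk, Ideal.Quotient.eq_zero_iff_mem,
    Ideal.Quotient.eq_zero_iff_mem, h𝔮, h𝔨, Ideal.pow_mul_mem_pow_add_iff hp h0 h1 h2]

/-- The ideals enter through equations so that an exponent bracketed in another way can be used
directly. -/
theorem Ideal.Quotient.exists_eq_pow_mul (hp : 𝔭.IsPrime) (h0 : 𝔭 ≠ ⊥) {ϖ : O} (h1 : ϖ ∈ 𝔭)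
    (h2 : ϖ ∉ 𝔭 ^ 2) {l k : ℕ} {𝔮 𝔩 : Ideal O} (h𝔮 : 𝔮 = 𝔭 ^ (l + k)) (h𝔩 : 𝔩 = 𝔭 ^ l)
    (hle : 𝔮 ≤ 𝔩) {a : O ⧸ 𝔮} (ha : Ideal.Quotient.factor hle a = 0) :
    ∃ b, a = Ideal.Quotient.mk 𝔮 (ϖ ^ l) * b := by
  obtain ⟨x, rfl⟩ := Ideal.Quotient.mk_surjective a
  rw [Ideal.Quotient.factor_mk, Ideal.Quotient.eq_zero_iff_mem, h𝔩] at ha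
  obtain ⟨y, hy⟩ := Ideal.exists_sub_pow_mul_mem hp h0 h1 h2 l k ha
  refine ⟨Ideal.Quotient.mk _ y, ?_⟩
  rw [← map_mul, Ideal.Quotient.eq, h𝔮]
  exact hy

end Uniformizer

/-! ### Counting points, centralizers and orbits -/

section Counting

/-- For centralizers, where no surjectivity of reduction is available; an upper bound is all that is
needed there. -/
theorem Subgroup.card_le_card_ker_mul {G H : Type*} [Group G] [Group H] (f : G →* H) [Finite H] :
    Nat.card G ≤ Nat.card f.ker * Nat.card H := by
  rw [← f.ker.card_mul_index, Subgroup.index_ker]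
  exact Nat.mul_le_mul_left _ (Subgroup.card_le_card_group _)

theorem Subgroup.card_eq_card_ker_mul {G H : Type*} [Group G] [Group H] (f : G →* H)
    (hf : Function.Surjective f) : Nat.card G = Nat.card f.ker * Nat.card H := by
  rw [← f.ker.card_mul_index, Subgroup.index_ker, MonoidHom.range_eq_top.2 hf, Subgroup.card_top]

theorem exists_eq_oneAddUnit {n : Type*} [Fintype n] [DecidableEq n] {A A' : Type*} [CommRing A]
    [CommRing A'] {q : A →+* A'} {w : A} (hw : w * w = 0) (hker : ∀ a, q a = 0 → ∃ b, a = w * b)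
    {g : GL n A} (hg : Matrix.GeneralLinearGroup.map q g = 1) : ∃ Y, g = oneAddUnit hw Y := by
  have h1 : ∀ i j, ∃ b, (g.1 - 1) i j = w * b := by
    intro i j
    apply hker
    have h2 := congrArg (fun h : GL n A' => h.1 i j) hg
    have h3 : q (g.1 i j) = (1 : Matrix n n A') i j := h2
    rw [Matrix.sub_apply, map_sub, h3, Matrix.one_apply, Matrix.one_apply]
    split_ifs <;> simp
  choose Y hY using h1
  refine ⟨Matrix.of Y, generalLinearGroup_ext fun i j => ?_⟩
  rw [oneAddUnit_val, Matrix.add_apply, Matrix.smul_apply, Matrix.of_apply, smul_eq_mul, ← hY,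
    Matrix.sub_apply, add_sub_cancel]

namespace ClosedSubgroupScheme

variable {R : Type} [CommRing R] {N : ℕ} (𝒢 : ClosedSubgroupScheme R N)

/-- The centralizer in the points, as a subgroup. -/
def centralizerSubgroup {B : Type} [CommRing B] (φ : R →+* B) (X : Matrix (Fin N) (Fin N) B) :
    Subgroup (GL (Fin N) B) where
  carrier := 𝒢.groupCentralizer φ X
  one_mem' := ⟨Subgroup.one_mem _, by simp⟩
  mul_mem' := by
    rintro g h ⟨hg, hg'⟩ ⟨hh, hh'⟩
    refine ⟨Subgroup.mul_mem _ hg hh, ?_⟩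
    rw [Units.val_mul, mul_assoc, hh', ← mul_assoc, hg', mul_assoc]
  inv_mem' := by
    rintro g ⟨hg, hg'⟩
    refine ⟨Subgroup.inv_mem _ hg, ?_⟩
    have h1 : g⁻¹.1 * (g.1 * X) * g⁻¹.1 = g⁻¹.1 * (X * g.1) * g⁻¹.1 := by rw [hg']
    have h2 : g⁻¹.1 * g.1 = 1 := Units.inv_mul g
    have h3 : g.1 * g⁻¹.1 = 1 := Units.mul_inv g
    rw [← mul_assoc, h2, one_mul, mul_assoc, mul_assoc, h3, mul_one] at h1
    exact h1.symm

theorem mem_centralizerSubgroup {B : Type} [CommRing B] (φ : R →+* B)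
    (X : Matrix (Fin N) (Fin N) B) (g : GL (Fin N) B) :
    g ∈ 𝒢.centralizerSubgroup φ X ↔ g ∈ 𝒢.points φ ∧ g.1 * X = X * g.1 := Iff.rfl

/-- Functoriality of the points. -/
def mapHom {A B : Type} [CommRing A] [CommRing B] (φ : R →+* A) (q : A →+* B) :
    𝒢.points φ →* 𝒢.points (q.comp φ) :=
  ((Matrix.GeneralLinearGroup.map q).comp (𝒢.points φ).subtype).codRestrict _
    fun g => 𝒢.map_mem φ q g.2

/-- Functoriality of the centralizers. -/
def mapCentralizerHom {A B : Type} [CommRing A] [CommRing B] (φ : R →+* A) (q : A →+* B)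
    (X : Matrix (Fin N) (Fin N) A) :
    𝒢.centralizerSubgroup φ X →* 𝒢.centralizerSubgroup (q.comp φ) (X.map q) :=
  ((Matrix.GeneralLinearGroup.map q).comp (𝒢.centralizerSubgroup φ X).subtype).codRestrict _
    fun g => ⟨𝒢.map_mem φ q g.2.1, by
      have h := congrArg (fun Z => Z.map q) g.2.2
      simp only [Matrix.map_mul] at h
      exact h⟩

section Reduction

variable {A A' κ : Type} [CommRing A] [CommRing A'] [CommRing κ] (φ : R →+* A) {p : A →+* A'}
  {q : A →+* κ} {w : A}

/-- The kernel of a reduction map is the Lie algebra over the residue ring. -/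
theorem card_ker_mapHom (hs : Function.Surjective q) (hw : w * w = 0)
    (hq : ∀ a, w * a = 0 ↔ q a = 0) (hpw : p w = 0) (hker : ∀ a, p a = 0 → ∃ b, a = w * b) :
    Nat.card (𝒢.mapHom φ p).ker = Nat.card (𝒢.lieAlgebra (q.comp φ)) := by
  symm
  refine Nat.card_congr (Equiv.ofBijective (fun X => ⟨⟨oneAddUnit hw
    (X.1.map (Function.surjInv hs)), ?_⟩, ?_⟩) ⟨?_, ?_⟩)
  · rw [𝒢.oneAddUnit_mem_points_iff φ q hw hq, Matrix.map_map]
    have h : (q ∘ Function.surjInv hs) = id := funext fun b => Function.surjInv_eq hs b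
    rw [h, Matrix.map_id]
    exact X.2
  · rw [MonoidHom.mem_ker]
    apply Subtype.ext
    apply generalLinearGroup_ext
    intro i j
    change p ((1 + w • X.1.map (Function.surjInv hs)) i j) = (1 : Matrix (Fin N) (Fin N) A') i j
    rw [Matrix.add_apply, Matrix.smul_apply, smul_eq_mul, map_add, map_mul, hpw, zero_mul,
      add_zero, Matrix.one_apply, Matrix.one_apply]
    split_ifs <;> simp
  · intro X X' h
    have h1 := map_eq_of_oneAddUnit_eq (q := q) hw hq
      (congrArg (fun g : (𝒢.mapHom φ p).ker => g.1.1) h)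
    rw [Matrix.map_map, Matrix.map_map] at h1
    have h2 : (q ∘ Function.surjInv hs) = id := funext fun b => Function.surjInv_eq hs b
    rw [h2, Matrix.map_id, Matrix.map_id] at h1
    exact Subtype.ext h1
  · rintro ⟨⟨g, hg⟩, hg'⟩
    have h1 : Matrix.GeneralLinearGroup.map p g = 1 := congrArg Subtype.val hg'
    obtain ⟨Y, rfl⟩ := exists_eq_oneAddUnit hw hker h1
    refine ⟨⟨Y.map q, (𝒢.oneAddUnit_mem_points_iff φ q hw hq Y).1 hg⟩, ?_⟩
    apply Subtype.ext
    apply Subtype.ext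
    apply oneAddUnit_congr hw hq
    ext i j
    simp [Function.surjInv_eq hs]

/-- A kernel element 1 + wY commutes with X exactly when w(YX - XY) = 0, that is, when the images of
Y and X under q commute. -/
theorem card_ker_mapCentralizerHom_le [Finite κ] (hw : w * w = 0)
    (hq : ∀ a, w * a = 0 ↔ q a = 0) (hker : ∀ a, p a = 0 → ∃ b, a = w * b)
    (X : Matrix (Fin N) (Fin N) A) :
    Nat.card (𝒢.mapCentralizerHom φ p X).ker
      ≤ Nat.card (𝒢.lieCentralizer (q.comp φ) (X.map q)) := by
  have h1 : ∀ g : (𝒢.mapCentralizerHom φ p X).ker, ∃ Y, g.1.1 = oneAddUnit hw Y := fun g =>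
    exists_eq_oneAddUnit hw hker (congrArg Subtype.val g.2)
  choose Y hY using h1
  have hmem : ∀ g, (Y g).map q ∈ 𝒢.lieCentralizer (q.comp φ) (X.map q) := by
    intro g
    refine ⟨(𝒢.oneAddUnit_mem_points_iff φ q hw hq (Y g)).1 (by rw [← hY g]; exact g.1.2.1), ?_⟩
    have h2 := g.1.2.2
    rw [hY g, oneAddUnit_val, add_mul, mul_add, one_mul, mul_one, add_right_inj, Matrix.smul_mul,
      Matrix.mul_smul] at h2
    rw [← Matrix.map_mul, ← Matrix.map_mul]
    ext i j
    rw [Matrix.map_apply, Matrix.map_apply, ← sub_eq_zero, ← map_sub, ← hq, mul_sub, sub_eq_zero]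
    exact congrFun (congrFun h2 i) j
  refine Nat.card_le_card_of_injective (fun g => (⟨_, hmem g⟩ : 𝒢.lieCentralizer _ _)) ?_
  intro g g' h
  apply Subtype.ext
  apply Subtype.ext
  rw [hY g, hY g']
  exact oneAddUnit_congr hw hq (congrArg Subtype.val h)

end Reduction

/-- Orbit-stabilizer for the conjugation action on matrices. -/
theorem card_points_eq_conjOrbit_mul {A B : Type} [CommRing A] [CommRing B] (φ : R →+* A)
    (q : A →+* B) (hsurj : Function.Surjective (𝒢.mapHom φ q)) (X : Matrix (Fin N) (Fin N) B) :
    Nat.card (𝒢.points (q.comp φ))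
      = Nat.card (𝒢.conjOrbit φ q X) * Nat.card (𝒢.centralizerSubgroup (q.comp φ) X) := by
  rw [← Nat.card_prod]
  symm
  have horb : ∀ Z : 𝒢.conjOrbit φ q X, ∃ g ∈ 𝒢.points (q.comp φ), Z.1 = g.1 * X * g⁻¹.1 := by
    rintro ⟨Z, g, hg, rfl⟩
    exact ⟨_, 𝒢.map_mem φ q hg, rfl⟩
  choose γ hγ hγX using horb
  have hconj : ∀ (Z : 𝒢.conjOrbit φ q X) (g : GL (Fin N) B), g ∈ 𝒢.points (q.comp φ) →
      (g.1 * X * g⁻¹.1 = Z.1 ↔ (γ Z)⁻¹ * g ∈ 𝒢.centralizerSubgroup (q.comp φ) X) := by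
    intro Z g hg
    have i1 : (γ Z)⁻¹.1 * (γ Z).1 = 1 := Units.inv_mul _
    have i2 : (γ Z).1 * (γ Z)⁻¹.1 = 1 := Units.mul_inv _
    have i3 : g⁻¹.1 * g.1 = 1 := Units.inv_mul _
    have i4 : g.1 * g⁻¹.1 = 1 := Units.mul_inv _
    rw [mem_centralizerSubgroup, Units.val_mul]
    constructor
    · intro h
      refine ⟨Subgroup.mul_mem _ (Subgroup.inv_mem _ (hγ Z)) hg, ?_⟩
      rw [hγX Z] at h
      calc (γ Z)⁻¹.1 * g.1 * X = (γ Z)⁻¹.1 * (g.1 * X * g⁻¹.1) * g.1 := by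
            simp only [mul_assoc, i3, mul_one]
        _ = ((γ Z)⁻¹.1 * (γ Z).1) * X * ((γ Z)⁻¹.1 * g.1) := by
            rw [h]; simp only [mul_assoc]
        _ = X * ((γ Z)⁻¹.1 * g.1) := by rw [i1, one_mul]
    · rintro ⟨-, h⟩
      rw [hγX Z]
      calc g.1 * X * g⁻¹.1 = (γ Z).1 * ((γ Z)⁻¹.1 * g.1 * X) * g⁻¹.1 := by
            simp only [← mul_assoc, i2, one_mul]
        _ = (γ Z).1 * X * (γ Z)⁻¹.1 * (g.1 * g⁻¹.1) := by
            rw [h]; simp only [mul_assoc]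
        _ = (γ Z).1 * X * (γ Z)⁻¹.1 := by rw [i4, mul_one]
  -- After choosing γ Z carrying X to Z, each point is uniquely γ Z times an element of the
  -- centralizer.
  refine Nat.card_congr (Equiv.ofBijective
    (fun Zc => ⟨γ Zc.1 * Zc.2.1, Subgroup.mul_mem _ (hγ Zc.1) Zc.2.2.1⟩) ⟨?_, ?_⟩)
  · rintro ⟨Z, c⟩ ⟨Z', c'⟩ h
    have h1 : γ Z * c.1 = γ Z' * c'.1 := congrArg Subtype.val h
    have h2 := (hconj Z (γ Z * c.1) (Subgroup.mul_mem _ (hγ Z) c.2.1)).2 (by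
      rw [inv_mul_cancel_left]; exact c.2)
    have h3 := (hconj Z' (γ Z' * c'.1) (Subgroup.mul_mem _ (hγ Z') c'.2.1)).2 (by
      rw [inv_mul_cancel_left]; exact c'.2)
    have h4 : Z = Z' := Subtype.ext (by rw [← h2, ← h3, h1])
    subst h4
    rw [mul_right_inj] at h1
    rw [Subtype.ext h1]
  · rintro ⟨g, hg⟩
    -- The orbit is taken under points over A only, so a point over B has to be lifted before its
    -- conjugate of X is known to lie in the orbit.
    obtain ⟨⟨g₀, hg₀⟩, hgg⟩ := hsurj ⟨g, hg⟩
    have hgg' : Matrix.GeneralLinearGroup.map q g₀ = g := congrArg Subtype.val hgg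
    let Z : 𝒢.conjOrbit φ q X := ⟨g.1 * X * g⁻¹.1, g₀, hg₀, by rw [← hgg']; rfl⟩
    exact ⟨⟨Z, ⟨(γ Z)⁻¹ * g, (hconj Z g hg).1 rfl⟩⟩, Subtype.ext (mul_inv_cancel_left _ _)⟩

end ClosedSubgroupScheme

end Counting

/-! ### Reductions of the localization and elements invertible at almost all primes -/

section AwayFrom

theorem AwayFrom.toQuotient_algebraMap {O : Type*} [CommRing O] {𝔡₁ 𝔮 : Ideal O}
    (h : IsCoprime 𝔡₁ 𝔮) (a : O) :
    AwayFrom.toQuotient h (algebraMap O (AwayFrom 𝔡₁) a) = Ideal.Quotient.mk 𝔮 a :=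
  IsLocalization.lift_eq _ _

theorem AwayFrom.factor_comp_toQuotient {O : Type*} [CommRing O] {𝔡₁ 𝔮 𝔮' : Ideal O}
    (h : IsCoprime 𝔡₁ 𝔮) (h' : IsCoprime 𝔡₁ 𝔮') (hle : 𝔮 ≤ 𝔮') :
    (Ideal.Quotient.factor hle).comp (AwayFrom.toQuotient h) = AwayFrom.toQuotient h' := by
  apply IsLocalization.ringHom_ext (awaySubmonoid 𝔡₁)
  ext a
  rw [RingHom.comp_apply, RingHom.comp_apply, RingHom.comp_apply, AwayFrom.toQuotient_algebraMap,
    AwayFrom.toQuotient_algebraMap, Ideal.Quotient.factor_mk]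

theorem awaySubmonoid_le_nonZeroDivisors {O : Type*} [CommRing O] [IsDomain O] {𝔡₁ : Ideal O}
    (h𝔡₁ : 𝔡₁ ≠ ⊥) : awaySubmonoid 𝔡₁ ≤ nonZeroDivisors O := by
  intro a ha
  refine mem_nonZeroDivisors_of_ne_zero ?_
  rintro rfl
  exact h𝔡₁ (le_bot_iff.1 (ha ⊥ Ideal.isPrime_bot (zero_mem _)))

theorem AwayFrom.toReal_injective {F : Type} [Field F] [NumberField F] (τ : F →+* ℝ)
    {𝔡₁ : Ideal (NumberField.RingOfIntegers F)} (h𝔡₁ : 𝔡₁ ≠ ⊥) :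
    Function.Injective (AwayFrom.toReal τ h𝔡₁) := by
  refine (IsLocalization.lift_injective_iff _).2 fun x y => ?_
  rw [(IsLocalization.injective (AwayFrom 𝔡₁) (awaySubmonoid_le_nonZeroDivisors h𝔡₁)).eq_iff,
    RingHom.comp_apply, RingHom.comp_apply, τ.injective.eq_iff,
    (FaithfulSMul.algebraMap_injective (NumberField.RingOfIntegers F) F).eq_iff]

/-- An element of the localization is invertible modulo the powers of almost all primes. -/
theorem AwayFrom.exists_isUnit_toQuotient {O : Type*} [CommRing O] [IsDedekindDomain O]
    {𝔡₁ : Ideal O} {f : AwayFrom 𝔡₁} (hf : f ≠ 0) :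
    ∃ a : O, a ≠ 0 ∧ ∀ 𝔭 : Ideal O, 𝔭.IsPrime → 𝔭 ≠ ⊥ → a ∉ 𝔭 → ∀ j (h : IsCoprime 𝔡₁ (𝔭 ^ j)),
      IsUnit (AwayFrom.toQuotient h f) := by
  -- Writing f = a/s, the only primes at which f can fail to be a unit are those containing the
  -- numerator a.
  obtain ⟨⟨a, s⟩, has⟩ := IsLocalization.surj (awaySubmonoid 𝔡₁) f
  dsimp only at has
  refine ⟨a, ?_, fun 𝔭 hp h0 ha j h => ?_⟩
  · rintro rfl
    rw [map_zero, (IsLocalization.map_units (AwayFrom 𝔡₁) s).mul_left_eq_zero] at has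
    exact hf has
  · have h1 := congrArg (AwayFrom.toQuotient h) has
    rw [map_mul, AwayFrom.toQuotient_algebraMap h a] at h1
    refine isUnit_of_mul_isUnit_left (y := AwayFrom.toQuotient h (algebraMap _ _ s.1)) ?_
    rw [h1]
    have hmax := hp.isMaximal h0
    have h2 : IsCoprime (Ideal.span {a}) (𝔭 ^ j) := by
      refine IsCoprime.pow_right ?_
      rw [Ideal.isCoprime_iff_sup_eq, sup_comm]
      refine hmax.out.2 _ (left_lt_sup.2 ?_)
      rwa [Ideal.span_singleton_le_iff_mem]
    obtain ⟨x, hx, y, hy, hxy⟩ := Submodule.mem_sup.1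
      ((Ideal.eq_top_iff_one _).1 (Ideal.isCoprime_iff_sup_eq.1 h2))
    obtain ⟨c, rfl⟩ := Ideal.mem_span_singleton'.1 hx
    refine IsUnit.of_mul_eq_one_right (Ideal.Quotient.mk _ c) ?_
    rw [← map_mul, ← map_one (Ideal.Quotient.mk _), Ideal.Quotient.eq, ← hxy, sub_add_cancel_left]
    exact neg_mem hy

end AwayFrom

/-! ### Climbing the powers of 𝔭 -/

section Ladder

variable {O : Type} [CommRing O] {𝔡₁ 𝔭 : Ideal O} {N : ℕ}
  (𝒢 : ClosedSubgroupScheme (AwayFrom 𝔡₁) N)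

namespace ClosedSubgroupScheme

/-- The reductions `𝒢(O / 𝔭 ^ (j + 1)) → 𝒢(O / 𝔭 ^ j)` are surjective for `j ≥ 1`. -/
def LiftsAt (h𝔭 : IsCoprime 𝔡₁ 𝔭) : Prop :=
  ∀ j, 1 ≤ j → ∀ g ∈ 𝒢.points (AwayFrom.toQuotient (h𝔭.pow_right (n := j))),
    ∃ g' ∈ 𝒢.points (AwayFrom.toQuotient (h𝔭.pow_right (n := j + 1))),
      Matrix.GeneralLinearGroup.map (Ideal.Quotient.factor (Ideal.pow_le_pow_right j.le_succ)) g' = g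

variable {𝒢} {h𝔭 : IsCoprime 𝔡₁ 𝔭}

theorem LiftsAt.exists_map_eq (hL : 𝒢.LiftsAt h𝔭) {k : ℕ} (hk : 1 ≤ k) (l : ℕ) :
    ∀ g ∈ 𝒢.points (AwayFrom.toQuotient (h𝔭.pow_right (n := k))),
    ∃ g' ∈ 𝒢.points (AwayFrom.toQuotient (h𝔭.pow_right (n := k + l))),
      Matrix.GeneralLinearGroup.map
        (Ideal.Quotient.factor (Ideal.pow_le_pow_right (Nat.le_add_right k l))) g' = g := by
  induction l with
  | zero =>
    intro g hg
    refine ⟨g, hg, generalLinearGroup_ext fun i j => ?_⟩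
    obtain ⟨x, hx⟩ := Ideal.Quotient.mk_surjective (g.1 i j)
    change Ideal.Quotient.factor le_rfl (g.1 i j) = g.1 i j
    rw [← hx]
    exact Ideal.Quotient.factor_mk _ _
  | succ l ih =>
    intro g hg
    obtain ⟨g₁, hg₁, h1⟩ := ih g hg
    obtain ⟨g₂, hg₂, h2⟩ := hL (k + l) (by omega) g₁ hg₁
    refine ⟨g₂, hg₂, ?_⟩
    rw [← h1, ← h2]
    refine generalLinearGroup_ext fun i j => ?_
    obtain ⟨x, hx⟩ := Ideal.Quotient.mk_surjective (g₂.1 i j)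
    change Ideal.Quotient.factor (Ideal.pow_le_pow_right (by omega)) (g₂.1 i j)
      = Ideal.Quotient.factor (Ideal.pow_le_pow_right (by omega))
        (Ideal.Quotient.factor (Ideal.pow_le_pow_right (by omega)) (g₂.1 i j))
    rw [← hx]
    rfl

variable [IsDedekindDomain O]

/-- The kernel of reduction is described with w = ϖ^l. It squares to zero in O/𝔭^(l+1) because l ≥
1, and its annihilator is the image of 𝔭, so the kernel is the Lie algebra over the residue field.
-/
theorem LiftsAt.card_points_succ (hL : 𝒢.LiftsAt h𝔭) (hp : 𝔭.IsPrime) (h0 : 𝔭 ≠ ⊥) {l : ℕ}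
    (hl : 1 ≤ l) :
    Nat.card (𝒢.points (AwayFrom.toQuotient (h𝔭.pow_right (n := l + 1))))
      = Nat.card (𝒢.lieAlgebra (AwayFrom.toQuotient h𝔭))
        * Nat.card (𝒢.points (AwayFrom.toQuotient (h𝔭.pow_right (n := l)))) := by
  obtain ⟨ϖ, h1, h2⟩ := Ideal.exists_mem_notMem_sq hp h0
  have hle : 𝔭 ^ (l + 1) ≤ 𝔭 ^ l := Ideal.pow_le_pow_right l.le_succ
  have hle' : 𝔭 ^ (l + 1) ≤ 𝔭 := Ideal.pow_le_self l.succ_ne_zero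
  set φ := AwayFrom.toQuotient (h𝔭.pow_right (n := l + 1))
  have e1 : (Ideal.Quotient.factor hle).comp φ = AwayFrom.toQuotient (h𝔭.pow_right (n := l)) :=
    AwayFrom.factor_comp_toQuotient _ _ _
  have e2 : (Ideal.Quotient.factor hle').comp φ = AwayFrom.toQuotient h𝔭 :=
    AwayFrom.factor_comp_toQuotient _ _ _
  have hsurj : Function.Surjective (𝒢.mapHom φ (Ideal.Quotient.factor hle)) := by
    rintro ⟨g, hg⟩
    rw [e1] at hg
    obtain ⟨g', hg', rfl⟩ := hL l hl g hg
    exact ⟨⟨g', hg'⟩, rfl⟩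
  rw [Subgroup.card_eq_card_ker_mul _ hsurj, 𝒢.card_ker_mapHom φ
    (Ideal.Quotient.factor_surjective hle')
    (Ideal.Quotient.pow_mul_self_eq_zero h1 rfl hl)
    (Ideal.Quotient.pow_mul_eq_zero_iff hp h0 h1 h2 rfl (pow_one 𝔭).symm hle') _
    (fun a => Ideal.Quotient.exists_eq_pow_mul hp h0 h1 h2 rfl rfl hle), e1, e2]
  rw [Ideal.Quotient.factor_mk, Ideal.Quotient.eq_zero_iff_mem]
  exact Ideal.pow_mem_pow h1 l

theorem LiftsAt.card_points (hL : 𝒢.LiftsAt h𝔭) (hp : 𝔭.IsPrime) (h0 : 𝔭 ≠ ⊥) (j : ℕ)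
    {𝔮 : Ideal O} (h𝔮 : 𝔮 = 𝔭 ^ (j + 1)) (hc : IsCoprime 𝔡₁ 𝔮) :
    Nat.card (𝒢.points (AwayFrom.toQuotient hc))
      = Nat.card (𝒢.points (AwayFrom.toQuotient h𝔭))
        * Nat.card (𝒢.lieAlgebra (AwayFrom.toQuotient h𝔭)) ^ j := by
  induction j generalizing 𝔮 with
  | zero =>
    rw [zero_add, pow_one] at h𝔮
    subst h𝔮
    rw [pow_zero, mul_one]
  | succ j ih =>
    subst h𝔮
    rw [hL.card_points_succ hp h0 (Nat.le_add_left 1 j), ih rfl, pow_succ]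
    ring

variable (𝒢)

/-- The matrix X is taken over O so that its reductions at all levels are compatible. The kernel of
reduction between two consecutive centralizers embeds in the Lie centralizer modulo 𝔭. -/
theorem card_centralizerSubgroup_succ_le (hp : 𝔭.IsPrime) (h0 : 𝔭 ≠ ⊥) [Finite (O ⧸ 𝔭)] {l : ℕ}
    (hl : 1 ≤ l) [Finite (O ⧸ 𝔭 ^ l)] (X : Matrix (Fin N) (Fin N) O) :
    Nat.card (𝒢.centralizerSubgroup (AwayFrom.toQuotient (h𝔭.pow_right (n := l + 1)))
        (X.map (Ideal.Quotient.mk _)))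
      ≤ Nat.card (𝒢.lieCentralizer (AwayFrom.toQuotient h𝔭) (X.map (Ideal.Quotient.mk _)))
        * Nat.card (𝒢.centralizerSubgroup (AwayFrom.toQuotient (h𝔭.pow_right (n := l)))
            (X.map (Ideal.Quotient.mk _))) := by
  obtain ⟨ϖ, h1, h2⟩ := Ideal.exists_mem_notMem_sq hp h0
  have hle : 𝔭 ^ (l + 1) ≤ 𝔭 ^ l := Ideal.pow_le_pow_right l.le_succ
  have hle' : 𝔭 ^ (l + 1) ≤ 𝔭 := Ideal.pow_le_self l.succ_ne_zero
  set φ := AwayFrom.toQuotient (h𝔭.pow_right (n := l + 1))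
  have e1 : (Ideal.Quotient.factor hle).comp φ = AwayFrom.toQuotient (h𝔭.pow_right (n := l)) :=
    AwayFrom.factor_comp_toQuotient _ _ _
  have e2 : (Ideal.Quotient.factor hle').comp φ = AwayFrom.toQuotient h𝔭 :=
    AwayFrom.factor_comp_toQuotient _ _ _
  set Z : Matrix (Fin N) (Fin N) (O ⧸ 𝔭 ^ (l + 1)) := X.map (Ideal.Quotient.mk _) with hZ
  have e3 : Z.map (Ideal.Quotient.factor hle) = X.map (Ideal.Quotient.mk _) := by
    ext i j
    rfl
  have e4 : Z.map (Ideal.Quotient.factor hle') = X.map (Ideal.Quotient.mk _) := by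
    ext i j
    rfl
  have h3 := 𝒢.card_ker_mapCentralizerHom_le φ
    (Ideal.Quotient.pow_mul_self_eq_zero h1 rfl hl)
    (Ideal.Quotient.pow_mul_eq_zero_iff hp h0 h1 h2 rfl (pow_one 𝔭).symm hle')
    (fun a => Ideal.Quotient.exists_eq_pow_mul hp h0 h1 h2 rfl rfl hle) Z
  refine (Subgroup.card_le_card_ker_mul
    (𝒢.mapCentralizerHom φ (Ideal.Quotient.factor hle) Z)).trans ?_
  rw [e2, e4] at h3
  rw [← e1, ← e3]
  exact Nat.mul_le_mul_right _ h3

theorem card_centralizerSubgroup_le (h𝔭 : IsCoprime 𝔡₁ 𝔭) (hp : 𝔭.IsPrime) (h0 : 𝔭 ≠ ⊥)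
    (hfin : ∀ j, Finite (O ⧸ 𝔭 ^ j)) (X : Matrix (Fin N) (Fin N) O) (j : ℕ)
    {𝔮 : Ideal O} (h𝔮 : 𝔮 = 𝔭 ^ (j + 1)) (hc : IsCoprime 𝔡₁ 𝔮) :
    Nat.card (𝒢.centralizerSubgroup (AwayFrom.toQuotient hc) (X.map (Ideal.Quotient.mk _)))
      ≤ Nat.card (𝒢.groupCentralizer (AwayFrom.toQuotient h𝔭) (X.map (Ideal.Quotient.mk _)))
        * Nat.card (𝒢.lieCentralizer (AwayFrom.toQuotient h𝔭) (X.map (Ideal.Quotient.mk _)))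
          ^ j := by
  induction j generalizing 𝔮 with
  | zero =>
    rw [zero_add, pow_one] at h𝔮
    subst h𝔮
    rw [pow_zero, mul_one]
    exact le_rfl
  | succ j ih =>
    subst h𝔮
    have : Finite (O ⧸ 𝔭) := by
      have := hfin 1
      rwa [pow_one] at this
    have := hfin (j + 1)
    refine (𝒢.card_centralizerSubgroup_succ_le (h𝔭 := h𝔭) hp h0 (Nat.le_add_left 1 j) X).trans ?_
    refine (Nat.mul_le_mul_left _ (ih rfl (h𝔭.pow_right (n := j + 1)))).trans (le_of_eq ?_)
    rw [pow_succ]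
    ring

end ClosedSubgroupScheme

end Ladder

/-! ### The dimension bound at one prime -/

section DimensionBound

variable {O : Type} [CommRing O] [IsDedekindDomain O] {𝔡₁ 𝔭 : Ideal O} {N : ℕ}
  {𝒢 : ClosedSubgroupScheme (AwayFrom 𝔡₁) N} {h𝔭 : IsCoprime 𝔡₁ 𝔭}

/-- The dimension bound for a representation of `𝒢(O / 𝔭 ^ (k + 1 + l))`, `k < l`, that is
nontrivial on the last congruence subgroup. -/
theorem ClosedSubgroupScheme.LiftsAt.exists_div_le_finrank (hL : 𝒢.LiftsAt h𝔭) (hp : 𝔭.IsPrime)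
    (h0 : 𝔭 ≠ ⊥) (hfin : ∀ j, Finite (O ⧸ 𝔭 ^ j)) {k l : ℕ} (hkl : k + 1 ≤ l)
    {T : Matrix (Fin N) (Fin N) (O ⧸ 𝔭 ^ (k + 1)) →ₗ[O ⧸ 𝔭 ^ (k + 1)]
      Matrix (Fin N) (Fin N) (O ⧸ 𝔭 ^ (k + 1))}
    (hT1 : ∀ A, T A ∈ 𝒢.lieAlgebra (AwayFrom.toQuotient (h𝔭.pow_right (n := k + 1))))
    (hT2 : ∀ X ∈ 𝒢.lieAlgebra (AwayFrom.toQuotient (h𝔭.pow_right (n := k + 1))), T X = X)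
    (hT3 : ∀ A C, (T A * C).trace = (A * T C).trace)
    {V : Type v} [AddCommGroup V] [Module ℂ V] [FiniteDimensional ℂ V]
    {ρ : Representation ℂ (𝒢.points (AwayFrom.toQuotient (h𝔭.pow_right (n := k + 1 + l)))) V}
    (hρ : HasLevel 𝒢 h𝔭 (k + 1 + l) ρ) :
    ∃ X ∈ 𝒢.lieAlgebra (AwayFrom.toQuotient h𝔭), X ≠ 0 ∧
      ((Nat.card (𝒢.points (AwayFrom.toQuotient h𝔭)) : ℝ)
          * (Nat.card (𝒢.lieAlgebra (AwayFrom.toQuotient h𝔭)) : ℝ) ^ k)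
        / ((Nat.card (𝒢.groupCentralizer (AwayFrom.toQuotient h𝔭) X) : ℝ)
          * (Nat.card (𝒢.lieCentralizer (AwayFrom.toQuotient h𝔭) X) : ℝ) ^ k)
      ≤ (Module.finrank ℂ V : ℝ) := by
  obtain ⟨ϖ, h1, h2⟩ := Ideal.exists_mem_notMem_sq hp h0
  have := hfin (k + 1)
  have := hfin (k + 1 + l)
  have hle : 𝔭 ^ (k + 1 + l) ≤ 𝔭 ^ (k + 1) := Ideal.pow_le_pow_right (Nat.le_add_right _ _)
  have hle' : 𝔭 ^ (k + 1) ≤ 𝔭 := Ideal.pow_le_self k.succ_ne_zero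
  let φ := AwayFrom.toQuotient (h𝔭.pow_right (n := k + 1 + l))
  have e1 : (Ideal.Quotient.factor hle).comp φ = AwayFrom.toQuotient (h𝔭.pow_right (n := k + 1)) :=
    AwayFrom.factor_comp_toQuotient _ _ _
  -- Only the last step s = r - 1 = k + l of the level condition is used.
  obtain ⟨g, hg, hg'⟩ := hρ (k + l) (by omega)
  have hw : Ideal.Quotient.mk (𝔭 ^ (k + 1 + l)) (ϖ ^ l)
      * Ideal.Quotient.mk (𝔭 ^ (k + 1 + l)) (ϖ ^ l) = 0 :=
    Ideal.Quotient.pow_mul_self_eq_zero h1 (by rw [add_comm]) hkl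
  have hw' : Ideal.Quotient.mk (𝔭 ^ (k + 1 + l)) (ϖ ^ (k + l))
      * Ideal.Quotient.mk (𝔭 ^ (k + 1 + l)) (ϖ ^ (k + l)) = 0 :=
    Ideal.Quotient.pow_mul_self_eq_zero h1 (k := 1) (by rw [add_right_comm]) (by omega)
  obtain ⟨Y, hY⟩ := exists_eq_oneAddUnit hw' (fun a =>
    Ideal.Quotient.exists_eq_pow_mul hp h0 h1 h2 (k := 1) (by rw [add_right_comm]) rfl _) hg
  -- Rewriting 1 + ϖ^(k+l) Y as 1 + ϖ^l (ϖ^k Y) places g in the larger abelian subgroup. The factor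
  -- ϖ^k is what later forces X to be nonzero modulo 𝔭.
  have hgY : g.1 = oneAddUnit hw (Ideal.Quotient.mk (𝔭 ^ (k + 1 + l)) (ϖ ^ k) • Y) := by
    rw [hY]
    apply Units.ext
    rw [oneAddUnit_val, oneAddUnit_val, smul_smul, ← map_mul, ← pow_add, add_comm l k]
  obtain ⟨ψ, hψ⟩ := exists_primitive_addChar hp h0 k
  obtain ⟨X, hX, hXψ, hXV⟩ := 𝒢.exists_card_conjOrbit_le φ (Ideal.Quotient.factor_surjective hle) hw
    (Ideal.Quotient.pow_mul_eq_zero_iff hp h0 h1 h2 (by rw [add_comm]) rfl hle)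
    (by rw [e1]; exact hT1) (by rw [e1]; exact hT2) hT3 hψ ρ hgY hg'
  obtain ⟨Z, rfl⟩ := exists_map_eq_of_surjective
    (Ideal.Quotient.mk_surjective (I := 𝔭 ^ (k + 1))) X
  refine ⟨Z.map (Ideal.Quotient.mk 𝔭), ?_, fun hZ => hXψ ?_, ?_⟩
  · rw [e1] at hX
    have h3 := 𝒢.map_mem_lieAlgebra _ (Ideal.Quotient.factor hle') hX
    rw [AwayFrom.factor_comp_toQuotient _ h𝔭] at h3
    exact h3
  -- If X vanished modulo 𝔭, then ϖ^k X would vanish in O/𝔭^(k+1), and the weight would be trivial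
  -- at g.
  · have h3 : Z.map (Ideal.Quotient.mk (𝔭 ^ (k + 1)))
        * (Ideal.Quotient.mk (𝔭 ^ (k + 1 + l)) (ϖ ^ k) • Y).map (Ideal.Quotient.factor hle)
        = 0 := by
      have h4 : (Ideal.Quotient.mk (𝔭 ^ (k + 1 + l)) (ϖ ^ k) • Y).map (Ideal.Quotient.factor hle)
          = Ideal.Quotient.mk (𝔭 ^ (k + 1)) (ϖ ^ k) • Y.map (Ideal.Quotient.factor hle) := by
        ext i j
        rw [Matrix.map_apply, Matrix.smul_apply, Matrix.smul_apply, Matrix.map_apply, smul_eq_mul,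
          smul_eq_mul, map_mul, Ideal.Quotient.factor_mk]
      have h5 : Ideal.Quotient.mk (𝔭 ^ (k + 1)) (ϖ ^ k)
          • Z.map (Ideal.Quotient.mk (𝔭 ^ (k + 1))) = 0 := by
        ext i j
        have h6 : Ideal.Quotient.mk 𝔭 (Z i j) = 0 := congrFun (congrFun hZ i) j
        rw [Matrix.smul_apply, Matrix.map_apply, smul_eq_mul, ← map_mul, Matrix.zero_apply,
          Ideal.Quotient.eq_zero_iff_mem, pow_succ]
        exact Ideal.mul_mem_mul (Ideal.pow_mem_pow h1 k) (Ideal.Quotient.eq_zero_iff_mem.1 h6)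
      rw [h4, Matrix.mul_smul, ← Matrix.smul_mul, h5, Matrix.zero_mul]
    rw [h3, Matrix.trace_zero, AddChar.map_zero_eq_one]
  · have hsurj : Function.Surjective (𝒢.mapHom φ (Ideal.Quotient.factor hle)) := by
      rintro ⟨x, hx⟩
      rw [e1] at hx
      obtain ⟨y, hy, rfl⟩ := hL.exists_map_eq k.succ_pos l x hx
      exact ⟨⟨y, hy⟩, rfl⟩
    -- Orbit-stabilizer at level 𝔭^(k+1): the point count is exact, the centralizer is bounded above
    -- and the orbit is bounded by the dimension.
    have h3 := 𝒢.card_points_eq_conjOrbit_mul φ _ hsurj (Z.map (Ideal.Quotient.mk (𝔭 ^ (k + 1))))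
    have h4 := 𝒢.card_centralizerSubgroup_le h𝔭 hp h0 hfin Z k rfl (h𝔭.pow_right (n := k + 1))
    rw [e1, hL.card_points hp h0 k rfl] at h3
    refine div_le_of_le_mul₀ (by positivity) (by positivity) ?_
    exact_mod_cast h3.le.trans (Nat.mul_le_mul hXV h4)

end DimensionBound

/-! ### Choice of 𝔡 and conclusion -/

theorem propositionp {F : Type} [Field F] [NumberField F] (τ : F →+* ℝ)
    (𝔡₁ : Ideal (NumberField.RingOfIntegers F)) (h𝔡₁ : 𝔡₁ ≠ ⊥) (N : ℕ)
    (𝒢 : ClosedSubgroupScheme (AwayFrom 𝔡₁) N)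
    (h𝒢 : (∃ n : ℕ, 2 ≤ n ∧ 𝒢.IsRealFormSO (AwayFrom.toReal τ h𝔡₁) n) ∨
      (∃ n : ℕ, 1 ≤ n ∧ 𝒢.IsRealFormSU (AwayFrom.toReal τ h𝔡₁) n)) :
    ∃ 𝔡 : Ideal (NumberField.RingOfIntegers F), 𝔡 ≠ ⊥ ∧ 𝔡 ≤ 𝔡₁ ∧
      ∀ (𝔭 : Ideal (NumberField.RingOfIntegers F)), 𝔭.IsPrime → 𝔭 ≠ ⊥ → ¬ 𝔭 ∣ 𝔡 →
      ∀ (h𝔭 : IsCoprime 𝔡₁ 𝔭) (r : ℕ), 1 < r →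
      ∀ (V : Type v) [AddCommGroup V] [Module ℂ V] [FiniteDimensional ℂ V]
        (ρ : Representation ℂ (𝒢.points (AwayFrom.toQuotient (h𝔭.pow_right (n := r)))) V),
      HasLevel 𝒢 h𝔭 r ρ →
      ∃ X ∈ 𝒢.lieAlgebra (AwayFrom.toQuotient h𝔭), X ≠ 0 ∧
        ((Nat.card (𝒢.points (AwayFrom.toQuotient h𝔭)) : ℝ)
            * (Nat.card (𝒢.lieAlgebra (AwayFrom.toQuotient h𝔭)) : ℝ) ^ (r / 2 - 1))
          / ((Nat.card (𝒢.groupCentralizer (AwayFrom.toQuotient h𝔭) X) : ℝ)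
            * (Nat.card (𝒢.lieCentralizer (AwayFrom.toQuotient h𝔭) X) : ℝ) ^ (r / 2 - 1))
        ≤ (Module.finrank ℂ V : ℝ) := by
  have hdom : IsDomain (AwayFrom 𝔡₁) :=
    IsLocalization.isDomain_localization (awaySubmonoid_le_nonZeroDivisors h𝔡₁)
  have hnoeth : IsNoetherianRing (AwayFrom 𝔡₁) :=
    IsLocalization.isNoetherianRing (awaySubmonoid 𝔡₁) _ inferInstance
  obtain ⟨E⟩ : Nonempty (ComplexForm 𝒢 (Complex.ofRealHom.comp (AwayFrom.toReal τ h𝔡₁))) := by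
    rcases h𝒢 with ⟨n, -, hn⟩ | ⟨n, -, hn⟩
    · exact hn.nonempty_complexForm
    · exact hn.nonempty_complexForm
  have hσ : Function.Injective (Complex.ofRealHom.comp (AwayFrom.toReal τ h𝔡₁)) :=
    Complex.ofReal_injective.comp (AwayFrom.toReal_injective τ h𝔡₁)
  obtain ⟨f₁, hf₁, hsmooth⟩ := E.exists_smooth hσ
  obtain ⟨f₂, hf₂, hproj⟩ := E.exists_lie_projector hσ
  obtain ⟨a₁, ha₁, hu₁⟩ := AwayFrom.exists_isUnit_toQuotient hf₁
  obtain ⟨a₂, ha₂, hu₂⟩ := AwayFrom.exists_isUnit_toQuotient hf₂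
  -- A prime not containing a₁a₂ makes both f₁ (lifting of points) and f₂ (the projection onto the
  -- Lie algebra) invertible modulo all its powers.
  refine ⟨𝔡₁ * Ideal.span {a₁ * a₂}, mul_ne_zero h𝔡₁ ?_, Ideal.mul_le_left, ?_⟩
  · rw [Ne, Ideal.zero_eq_bot, Ideal.span_singleton_eq_bot]
    exact mul_ne_zero ha₁ ha₂
  intro 𝔭 hp h0 hdvd h𝔭 r hr V _ _ _ ρ hρ
  have ha : a₁ * a₂ ∉ 𝔭 := fun h => hdvd ((Ideal.dvd_span_singleton.2 h).mul_left _)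
  have hm₁ : a₁ ∉ 𝔭 := fun h => ha (𝔭.mul_mem_right _ h)
  have hm₂ : a₂ ∉ 𝔭 := fun h => ha (𝔭.mul_mem_left _ h)
  have hL : 𝒢.LiftsAt h𝔭 := by
    intro j hj g hg
    refine hsmooth _ _ (Ideal.Quotient.factor (Ideal.pow_le_pow_right j.le_succ))
      (AwayFrom.toQuotient (h𝔭.pow_right (n := j + 1))) (Ideal.Quotient.factor_surjective _) ?_
      (hu₁ 𝔭 hp h0 hm₁ _ _) g (by rwa [AwayFrom.factor_comp_toQuotient])
    intro x y hx hy
    obtain ⟨x, rfl⟩ := Ideal.Quotient.mk_surjective x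
    obtain ⟨y, rfl⟩ := Ideal.Quotient.mk_surjective y
    rw [Ideal.Quotient.factor_mk, Ideal.Quotient.eq_zero_iff_mem] at hx hy
    rw [← map_mul, Ideal.Quotient.eq_zero_iff_mem]
    exact Ideal.pow_le_pow_right (by omega : j + 1 ≤ j + j) (pow_add 𝔭 j j ▸ Ideal.mul_mem_mul hx hy)
  -- Since r > 1, ⌊r/2⌋ is positive and may be written k + 1; then l = ⌈r/2⌉ ≥ k + 1, which makes
  -- ϖ^l square to zero in O/𝔭^r.
  obtain ⟨k, hk⟩ : ∃ k, r / 2 = k + 1 := ⟨r / 2 - 1, by omega⟩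
  obtain ⟨l, rfl⟩ : ∃ l, r = k + 1 + l := ⟨r - (k + 1), by omega⟩
  rw [hk, Nat.add_sub_cancel]
  obtain ⟨T, hT1, hT2, hT3⟩ := hproj _ (AwayFrom.toQuotient (h𝔭.pow_right (n := k + 1)))
    (hu₂ 𝔭 hp h0 hm₂ _ _)
  exact hL.exists_div_le_finrank hp h0
    (fun j => Ideal.finiteQuotientOfFreeOfNeBot _ (pow_ne_zero j h0)) (by omega) hT1 hT2 hT3 hρ
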